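/- **Algorithm.** Input: a prime $p$ and $0<\varepsilon<1$; write $h=(p-1)/2$. Let $B>1$ be the real number with $$\Bigl(1+\tfrac{2}{p-1}\Bigr)\Bigl(1-\tfrac1B\Bigr)^{\log_B\frac{p-1}{2}}=1-\varepsilon .$$ (1) Partially factor $p-1=2^{e_1}p_2^{e_2}\cdots p_k^{e_k}Q$, where $p_1=2$, the $p_i$ ($i\ge2$) are the odd primes $<B$ dividing $p-1$, and $Q$ is odd without prime factor $<B$. (2) For each $i$ draw uniformly random $\alpha_i\in\{1,\dots,p-1\}$ until $\alpha_i^{(p-1)/p_i}\not\equiv1\pmod p$; set $a\equiv\prod_i\alpha_i^{(p-1)/p_i^{e_i}}$. (3) If $Q=1$, return $a$ with reported probability of correctness $1$. Otherwise draw uniformly random $b\in\{1,\dots,p-1\}$ until $b^{(p-1)/Q}\not\equiv1$ and return $a\,b^{(p-1)/Q}\bmod p$ with reported probability of correctness $(1+\frac1{Q-1})(1-\frac1B)^{\log_BQ}$. *Pollard-rho partial factoring in the random-map model.* A list of numbers to be treated initially contains the odd part of $p-1$. A number $n$ of the list without prime factor $<B$ is discarded; if $n$ is a power of a prime $q$ and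 $q<B$, then $q$ is recorded as one of the $p_i$; otherwise a run of Pollard's rho (with Floyd's cycle finding) is performed on $n$: the iteration map $f$ is uniformly random among the self-maps of $\mathbb Z/n$ that are compatible with reduction modulo every divisor of $n$, the starting value $x_0$ is uniformly random, $x_{i+1}=f(x_i)$, and $m=n$ at first; in the $i$-th loop $g=\gcd(x_i-x_{2i},m)$ is computed, and if $g\neq1$ then $g$ is put on the list and all primes dividing $g$ are removed from $m$; the run ends as soon as $m$ has no prime factor $<B$. *Running time.* Each squaring, product, division, gcd, evaluation of $f$ or random draw on numbers of the size of $p$ costs $s^2$ bit operations, $s$ being the bit size of $p$; exponentiations use recursive squaring. Computing $B$, and deciding whether a number still has a prime factor $<B$ and whether it is a prime power, is not charged; that is, the cost of the partial factorization is the cost of the loops and divisions performed until it is complete. **Statement.** (a) *Correctness.* Let $p\ge5$ be prime and $0<\varepsilon<1$. Then $B$ exists and is unique. One has $B\le\ln(h)/\varepsilon$ whenever $p\ge11$ or $\ln(h)/\varepsilon\ge3$, and $B\le\max\{3,\ln(h)/\varepsilon\}$ always. If $Q\neq1$, then $$\omega(Q)\le\log_BQ,\qquad \Bigl(1+\tfrac1{Q-1}\Bigr)\Bigl(1-\tfrac1B\Bigr)^{\log_BQ}\le\frac{\varphi(Q)}{Q-1},\qquad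 \frac{\varphi(Q)}{Q-1}>1-\varepsilon .$$ Both with Pollard-rho partial factoring and when the partial factorization is given, the algorithm stops with probability one; it reports a probability of correctness that exceeds $1-\varepsilon$; its output is a primitive root modulo $p$ with at least the reported probability, hence with probability greater than $1-\varepsilon$; this probability is $1$ if $Q=1$ and at least $\varphi(Q)/(Q-1)$ if $Q\ne1$. (b) *Average running time.* With Pollard-rho partial factoring in the random-map model, the average running time is $O\bigl(\sqrt{1/\varepsilon}\,\log^{2.5}p+\log^3p\,\log\log p\bigr)$, the average being taken over the random choices of the algorithm and, in the sense of average orders, over the primes $p$. That is, if $T(p,\varepsilon)$ denotes the expected running time on input $(p,\varepsilon)$, there is an absolute constant $C>0$ such that for all $0<\varepsilon<1$ and all $x$ $$\sum_{\substack{5\le p\le x\\ p\text{ prime}}}T(p,\varepsilon)\;\le\;C\sum_{\substack{5\le p\le x\\ p\text{ prime}}}\Bigl(\sqrt{1/\varepsilon}\,\log^{2.5}p+\log^3p\,\log\log p\Bigr).$$ -/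

import Mathlib

namespace ProbRoot

open scoped ENNReal
open scoped Classical in
/-- The law of `k a` for `a` uniformly random in the finite set `s`.  The value `fallback` is
only there to make the function total: no empty set is drawn from below. -/
noncomputable def draw {α β : Type} (s : Finset α) (k : α → β) (fallback : β) : PMF β :=
  if h : s.Nonempty then (PMF.uniformOfFinset s h).map k else PMF.pure fallback

/-! ### The bound `B` and the partial factorization -/

/-- `B` solves `(1 + 2/(p-1)) (1 - 1/B) ^ (log_B ((p-1)/2)) = 1 - ε`. -/
def IsFactorBound (p : ℕ) (ε B : ℝ) : Prop :=
  1 < B ∧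
    (1 + 2 / ((p : ℝ) - 1)) * (1 - 1 / B) ^ Real.logb B (((p : ℝ) - 1) / 2) = 1 - ε

/-- The primes that are split off `p - 1`: the prime `2` and the prime factors below `B`. -/
noncomputable def smallPrimes (p : ℕ) (B : ℝ) : Finset ℕ :=
  open scoped Classical in (p - 1).primeFactors.filter (fun q => q = 2 ∨ (q : ℝ) < B)

/-- The unfactored part `Q` of `p - 1 = 2 ^ e₁ * p₂ ^ e₂ * ⋯ * p_h ^ e_h * Q`. -/
noncomputable def cofactor (p : ℕ) (B : ℝ) : ℕ :=
  (p - 1) / ∏ q ∈ smallPrimes p B, q ^ (p - 1).factorization q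

/-- The probability of correctness that the algorithm reports. -/
noncomputable def reportedProb (B : ℝ) (Q : ℕ) : ℝ :=
  if Q = 1 then 1 else (1 + 1 / ((Q : ℝ) - 1)) * (1 - 1 / B) ^ Real.logb B Q

/-- `n` has a prime factor below `B`. -/
def HasSmallFactor (B : ℝ) (n : ℕ) : Prop :=
  ∃ q : ℕ, q.Prime ∧ q ∣ n ∧ (q : ℝ) < B

/-- The self-maps of `{0, …, n-1}` that, like polynomial maps, are compatible with reduction modulo
every divisor of `n`.  In the random-map model the iteration map of Pollard's rho method modulo
`n` is a uniformly random one of these. -/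
noncomputable def compatibleMaps (n : ℕ) : Finset (Fin n → Fin n) :=
  open scoped Classical in
  Finset.univ.filter (fun f => ∀ d : ℕ, d ∣ n → ∀ a b : Fin n,
    (a : ℕ) ≡ (b : ℕ) [MOD d] → (f a : ℕ) ≡ (f b : ℕ) [MOD d])

/-- `gcd (x - y, m)`. -/
def gcdDiff {n : ℕ} (x y : Fin n) (m : ℕ) : ℕ :=
  Nat.gcd (((x : ℕ) : ℤ) - ((y : ℕ) : ℤ)).natAbs m

/-- `m` without those of its prime factors that divide `g`: the number `g ^ size m` contains each
prime factor of `g` at least as often as `m` does. -/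
def strip (m g : ℕ) : ℕ := m / Nat.gcd m (g ^ m.size)

/-! ### The algorithm as a randomized machine -/

/-- The states of the algorithm for the prime `p`.
* `init`: nothing has been done yet.
* `split work ps Q`: the numbers in `work` still have to be searched for primes below the bound,
  `ps` are the primes found so far, `Q` is `p - 1` without the primes in `ps`.
* `loop n f x y m work ps Q`: inside a run of Pollard's rho method on `n`, with iteration map `f`,
  current iterates `x = x_i`, `y = x_{2i}`, and remaining cofactor `m` of `n`.
* `pick ps a Q`: an `α` has to be drawn for the first prime of `ps`; `a` is the current product.
* `test α ps a Q`: `α` was drawn for the first prime of `ps` and has to be tested.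
* `pickLast a Q`, `testLast b a Q`: the same for the last random element `b`.
* `done g c`: the algorithm has returned `g`, with reported probability of correctness `c`. -/
inductive State (p : ℕ) : Type
  | init : State p
  | split (work ps : List ℕ) (Q : ℕ) : State p
  | loop (n : ℕ) (f : Fin n → Fin n) (x y : Fin n) (m : ℕ) (work ps : List ℕ) (Q : ℕ) : State p
  | pick (ps : List ℕ) (a : ZMod p) (Q : ℕ) : State p
  | test (α : ZMod p) (ps : List ℕ) (a : ZMod p) (Q : ℕ) : State p
  | pickLast (a : ZMod p) (Q : ℕ) : State p
  | testLast (b a : ZMod p) (Q : ℕ) : State p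
  | done (g : ZMod p) (c : ℝ) : State p

open State

open scoped Classical in
/-- One step of the algorithm. -/
noncomputable def step (p : ℕ) (B : ℝ) : State p → PMF (State p)
  | init =>
      let m := (p - 1) / 2 ^ (p - 1).factorization 2
      PMF.pure (split [m] [2] m)
  | split [] ps Q => PMF.pure (pick ps 1 Q)
  | split (n :: work) ps Q =>
      if ¬ HasSmallFactor B n then PMF.pure (split work ps Q)
      else if IsPrimePow n then
        PMF.pure (split work (n.minFac :: ps)
          (Q / n.minFac ^ (p - 1).factorization n.minFac))
      else
        draw (compatibleMaps n ×ˢ (Finset.univ : Finset (Fin n)))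
          (fun fx => loop n fx.1 fx.2 fx.2 n work ps Q) (split work ps Q)
  | loop n f x y m work ps Q =>
      if ¬ HasSmallFactor B m then PMF.pure (split work ps Q)
      else
        let x' := f x
        let y' := f (f y)
        let g := gcdDiff x' y' m
        if g = 1 then PMF.pure (loop n f x' y' m work ps Q)
        else PMF.pure (loop n f x' y' (strip m g) (g :: work) ps Q)
  | pick [] a Q =>
      if Q = 1 then PMF.pure (done a (reportedProb B Q)) else PMF.pure (pickLast a Q)
  | pick (q :: ps) a Q =>
      draw (Finset.Icc 1 (p - 1)) (fun α : ℕ => test (α : ZMod p) (q :: ps) a Q)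
        (pick (q :: ps) a Q)
  | test _ [] a Q => PMF.pure (pick [] a Q)
  | test α (q :: ps) a Q =>
      if α ^ ((p - 1) / q) = 1 then PMF.pure (pick (q :: ps) a Q)
      else PMF.pure
        (pick ps (a * α ^ ((p - 1) / q ^ (p - 1).factorization q)) Q)
  | pickLast a Q =>
      draw (Finset.Icc 1 (p - 1)) (fun b : ℕ => testLast (b : ZMod p) a Q) (pickLast a Q)
  | testLast b a Q =>
      if b ^ ((p - 1) / Q) = 1 then PMF.pure (pickLast a Q)
      else PMF.pure (done (a * b ^ ((p - 1) / Q)) (reportedProb B Q))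
  | done g c => PMF.pure (done g c)

/-- The number of multiplications of a recursive-squaring exponentiation with exponent `e`. -/
def powMults : ℕ → ℕ
  | 0 => 0
  | e + 1 => powMults ((e + 1) / 2) + 1 + (e + 1) % 2

/-- The number of operations (squarings, products, divisions, gcds, evaluations of an iteration map,
random draws) on numbers of at most the size of `p` that the step out of a state performs. -/
noncomputable def opCount (p : ℕ) (B : ℝ) : State p → ℕ
  | init => (p - 1).factorization 2 + 1
  | split [] _ _ => 0
  | split (n :: _) _ _ =>
      open scoped Classical in
      if HasSmallFactor B n ∧ IsPrimePow n then (p - 1).factorization n.minFac + 1 else 1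
  | loop _ f x y m _ _ _ =>
      open scoped Classical in
      if ¬ HasSmallFactor B m then 0
      else if gcdDiff (f x) (f (f y)) m = 1 then 4
      else 4 + (powMults m.size + 2)
  | pick [] _ _ => 0
  | pick (_ :: _) _ _ => 1
  | test _ [] _ _ => 0
  | test α (q :: _) _ _ =>
      if α ^ ((p - 1) / q) = 1 then powMults ((p - 1) / q)
      else powMults ((p - 1) / q) + powMults ((p - 1) / q ^ (p - 1).factorization q) + 1
  | pickLast _ _ => 1
  | testLast b _ Q =>
      if b ^ ((p - 1) / Q) = 1 then powMults ((p - 1) / Q) else powMults ((p - 1) / Q) + 1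
  | done _ _ => 0

/-- The bit cost of a step: with classical arithmetic each operation on numbers of the size of `p`
costs the square of the bit size of `p`. -/
noncomputable def cost (p : ℕ) (B : ℝ) (s : State p) : ℕ := opCount p B s * p.size ^ 2

/-- The law of the state after `t` steps from the state `s`. -/
noncomputable def law (p : ℕ) (B : ℝ) (s : State p) : ℕ → PMF (State p)
  | 0 => PMF.pure s
  | t + 1 => (law p B s t).bind (step p B)

/-- The probability that the algorithm, started in the state `s`, stops with an output `(g, c)` in
the set `E`. -/
noncomputable def outputProb (p : ℕ) (B : ℝ) (s : State p) (E : Set (ZMod p × ℝ)) : ℝ≥0∞ :=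
  ⨆ t : ℕ, (law p B s t).toOuterMeasure {s' | ∃ o ∈ E, s' = done o.1 o.2}

/-- The expected running time of the algorithm on the input `p` (expectation over its random
choices). -/
noncomputable def expectedTime (p : ℕ) (B : ℝ) : ℝ≥0∞ :=
  ∑' t : ℕ, ∑' s : State p, law p B init t s * (cost p B s : ℝ≥0∞)

/-- Started in the state `s`, the algorithm stops with probability one and reports a probability of
correctness which exceeds `1 - ε`; the output is a primitive root modulo `p` with at least the
reported probability, and it is one with probability at least `φ(Q) / (Q - 1)` if `Q ≠ 1`, and with
probability one if `Q = 1`. -/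
def Correct (p : ℕ) (ε B : ℝ) (s : State p) : Prop :=
  let Q := cofactor p B
  let success : ℝ≥0∞ := outputProb p B s {o | IsPrimitiveRoot o.1 (p - 1)}
  outputProb p B s {o | o.2 = reportedProb B Q} = 1 ∧
  1 - ε < reportedProb B Q ∧
  ENNReal.ofReal (reportedProb B Q) ≤ success ∧
  ENNReal.ofReal (1 - ε) < success ∧
  (Q = 1 → success = 1) ∧
  (Q ≠ 1 → ENNReal.ofReal ((Q.totient : ℝ) / ((Q : ℝ) - 1)) ≤ success)

end ProbRoot

namespace ProbRoot

open scoped ENNReal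
open State

/-! ### Expectations with respect to a `PMF` -/

/-! Correctness rests on the cyclicity of the unit group modulo p. Writing b as a power of a
primitive root shows that b^((p-1)/Q) is uniform on the subgroup of order Q; rejecting the value 1
leaves Q - 1 equally likely elements, φ(Q) of which generate it. For a prime q dividing p - 1, an
accepted α yields an element whose order is the full q-part of p - 1, and orders that are coprime
multiply. Hence only the last draw can spoil the output. All primes of Q are at least B, so φ(Q)/Q ≥
(1 - 1/B)^(log_B Q); since Q ≤ h, monotonicity compares the reported probability with the equation
that defines B. The left side of that equation increases strictly with B, so an upper bound for B
amounts to the inequality 1 - ln h / B ≤ left side: Bernoulli's inequality if ln B ≥ 1, a finite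
check in rational arithmetic for smaller B.

The running time is estimated by a potential: a function on states that dominates the cost of a step
plus its own expectation after the step bounds the total expected cost (`costUpTo_succ`). In the
random-map model the reductions modulo two distinct prime factors of n are independent uniform maps
(`card_mul_sum_redPair`), so the loop in which q is detected is Floyd's meeting time of a random map
on q points. Its mean is at most 2√q (`sum_meetTime_le`), and no single value has probability above
4 q^(-1/10) (`card_meetTime_eq_le`). Thus q is detected together with a given other prime, which may
force a further run, with probability at most τ = min(μ, 4 q^(-1/10)) for a fixed μ < 1. The
expected number of companions of q shrinks geometrically from run to run, and charging γ = τ/(1 - μ)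
runs per companion pays for all later ones. So q costs about 10√q once, plus terms in which √q is
weakened to q^(2/5) (`mean_loopCost_le`, `costUpTo_split_le`). The finiteness of this bound also
makes the partial factorization end almost surely, which carries correctness over to `init`
(`le_outputProb_of_phase`).

For the average over p, the main term is the sum of log p · √q over p ≤ x and q ∣ p - 1, q < b.
After interchanging the sums it needs only a bound O(x log q / q) for the primes p ≡ 1 modulo q,
weighted with log p and uniform in q (`sum_log_primesOneMod_le`); it follows from an elementary
divisibility, and the superfluous log q is harmless by Chebyshev's estimate. The other terms contain
powers of ω(p - 1), whose moments are controlled by the mean of 2^ω. The resulting (log log x)^3 is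
absorbed either by the b^(1/10) gained from the decay of τ or by a factor log x. Chebyshev's lower
bound for π(x) finally turns the estimate into the sum of the claimed orders (`le_sum_timeOrder`).
-/

/-- The expectation of a nonnegative function under a `PMF`. -/
noncomputable def mean {α : Type} (μ : PMF α) (u : α → ℝ≥0∞) : ℝ≥0∞ := ∑' a, μ a * u a

section mean

variable {α β : Type}

lemma mean_pure (a : α) (u : α → ℝ≥0∞) : mean (PMF.pure a) u = u a := by
  classical
  unfold mean
  rw [tsum_eq_single a]
  · simp
  · intro b hb
    simp [PMF.pure_apply, hb]

lemma mean_bind (μ : PMF α) (k : α → PMF β) (u : β → ℝ≥0∞) :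
    mean (μ.bind k) u = mean μ (fun a => mean (k a) u) := by
  unfold mean
  simp_rw [PMF.bind_apply, ← ENNReal.tsum_mul_right, ← ENNReal.tsum_mul_left]
  rw [ENNReal.tsum_comm]
  simp_rw [mul_assoc]

lemma mean_map (μ : PMF α) (k : α → β) (u : β → ℝ≥0∞) :
    mean (μ.map k) u = mean μ (fun a => u (k a)) := by
  rw [← PMF.bind_pure_comp, mean_bind]
  simp [mean_pure]

lemma mean_const (μ : PMF α) (c : ℝ≥0∞) : mean μ (fun _ => c) = c := by
  unfold mean
  rw [ENNReal.tsum_mul_right, μ.tsum_coe, one_mul]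

lemma mean_mono_support {μ : PMF α} {u v : α → ℝ≥0∞} (h : ∀ a ∈ μ.support, u a ≤ v a) :
    mean μ u ≤ mean μ v := by
  refine ENNReal.tsum_le_tsum fun a => ?_
  by_cases ha : μ a = 0
  · simp [ha]
  · exact mul_le_mul_right (h a ((μ.mem_support_iff a).2 ha)) _

lemma mean_mono {μ : PMF α} {u v : α → ℝ≥0∞} (h : ∀ a, u a ≤ v a) : mean μ u ≤ mean μ v :=
  mean_mono_support fun a _ => h a

lemma mean_add (μ : PMF α) (u v : α → ℝ≥0∞) :
    mean μ (fun a => u a + v a) = mean μ u + mean μ v := by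
  unfold mean
  rw [← ENNReal.tsum_add]
  simp_rw [mul_add]

lemma mean_mul_left (μ : PMF α) (c : ℝ≥0∞) (u : α → ℝ≥0∞) :
    mean μ (fun a => c * u a) = c * mean μ u := by
  unfold mean
  rw [← ENNReal.tsum_mul_left]
  simp_rw [mul_left_comm]

/-- Monotone convergence, read off from the Lebesgue integral for the counting measure. -/
lemma mean_iSup (μ : PMF α) (u : ℕ → α → ℝ≥0∞) (hu : Monotone u) :
    ⨆ t, mean μ (u t) = mean μ (fun a => ⨆ t, u t a) := by
  unfold mean
  simp_rw [ENNReal.mul_iSup]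
  let _ : MeasurableSpace α := ⊤
  have key := MeasureTheory.lintegral_iSup (μ := MeasureTheory.Measure.count)
    (f := fun t a => μ a * u t a) (fun t => measurable_from_top)
    (fun s t hst a => mul_le_mul_right (hu hst a) _)
  simpa [MeasureTheory.lintegral_count] using key.symm

lemma mean_draw {s : Finset α} (hs : s.Nonempty) (k : α → β) (b : β) (u : β → ℝ≥0∞) :
    mean (draw s k b) u = (s.card : ℝ≥0∞)⁻¹ * ∑ a ∈ s, u (k a) := by
  classical
  unfold draw
  rw [dif_pos hs, mean_map]
  unfold mean
  rw [tsum_eq_sum (s := s)]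
  · rw [Finset.mul_sum]
    refine Finset.sum_congr rfl fun a ha => ?_
    rw [PMF.uniformOfFinset_apply_of_mem _ ha]
  · intro a ha
    rw [PMF.uniformOfFinset_apply_of_notMem _ ha, zero_mul]

lemma support_draw {s : Finset α} (hs : s.Nonempty) (k : α → β) (b : β) :
    (draw s k b).support = k '' s := by
  classical
  unfold draw
  rw [dif_pos hs]
  ext x
  simp

end mean

/-! ### Output probabilities and expected costs -/

section machine

variable {p : ℕ} {B : ℝ}

/-- The definition of `law` appends the last step; first-step analysis needs the first one split off
instead. -/
lemma law_succ' (s : State p) (t : ℕ) :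
    law p B s (t + 1) = (step p B s).bind (fun s' => law p B s' t) := by
  induction t with
  | zero =>
    change (PMF.pure s).bind (step p B) = (step p B s).bind PMF.pure
    simp
  | succ t ih =>
    change (law p B s (t + 1)).bind (step p B) = _
    rw [ih, PMF.bind_bind]
    rfl

lemma mean_law_succ (s : State p) (t : ℕ) (u : State p → ℝ≥0∞) :
    mean (law p B s (t + 1)) u = mean (step p B s) (fun s' => mean (law p B s' t) u) := by
  rw [law_succ', mean_bind]

/-- The indicator function of having stopped with an output in `E`. -/
noncomputable def hit (E : Set (ZMod p × ℝ)) : State p → ℝ≥0∞ :=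
  Set.indicator {s' | ∃ o ∈ E, s' = done o.1 o.2} 1

lemma hit_done (E : Set (ZMod p × ℝ)) (g : ZMod p) (c : ℝ) (h : (g, c) ∈ E) :
    hit E (done g c) = 1 :=
  Set.indicator_of_mem (s := {s' | ∃ o ∈ E, s' = done o.1 o.2}) ⟨(g, c), h, rfl⟩ 1

lemma outputProb_eq (s : State p) (E : Set (ZMod p × ℝ)) :
    outputProb p B s E = ⨆ t, mean (law p B s t) (hit E) := by
  unfold outputProb mean hit
  refine iSup_congr fun t => ?_
  rw [PMF.toOuterMeasure_apply]
  refine tsum_congr fun x => ?_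
  by_cases hx : x ∈ {s' | ∃ o ∈ E, s' = done o.1 o.2}
  · rw [Set.indicator_of_mem hx, Set.indicator_of_mem hx]; simp
  · rw [Set.indicator_of_notMem hx, Set.indicator_of_notMem hx]; simp

lemma hit_le_mean_step (E : Set (ZMod p × ℝ)) (s : State p) :
    hit E s ≤ mean (step p B s) (hit E) := by
  by_cases hs : s ∈ {s' | ∃ o ∈ E, s' = done o.1 o.2}
  · obtain ⟨o, ho, rfl⟩ := hs
    rw [show step p B (done o.1 o.2) = PMF.pure (done o.1 o.2) from rfl, mean_pure]
  · rw [hit, Set.indicator_of_notMem hs]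
    exact zero_le

/-- The states `done g c` are absorbing, so the probability of having stopped in `E` can only grow
with time. -/
lemma mean_law_hit_mono (E : Set (ZMod p × ℝ)) :
    Monotone fun (t : ℕ) (s : State p) => mean (law p B s t) (hit E) := by
  refine monotone_nat_of_le_succ fun t s => ?_
  change _ ≤ mean ((law p B s t).bind (step p B)) (hit E)
  rw [mean_bind]
  exact mean_mono fun s' => hit_le_mean_step E s'

/-- The output probability is harmonic for the machine. -/
lemma outputProb_step (s : State p) (E : Set (ZMod p × ℝ)) :
    outputProb p B s E = mean (step p B s) (fun s' => outputProb p B s' E) := by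
  simp_rw [outputProb_eq]
  rw [← mean_iSup _ _ (mean_law_hit_mono E)]
  simp_rw [← mean_law_succ]
  exact (Monotone.iSup_nat_add (f := fun t => mean (law p B s t) (hit E))
    (fun i j h => mean_law_hit_mono E h s) 1).symm

lemma outputProb_le_one (s : State p) (E : Set (ZMod p × ℝ)) : outputProb p B s E ≤ 1 := by
  rw [outputProb_eq]
  refine iSup_le fun t => ?_
  calc _ ≤ mean (law p B s t) (fun _ => 1) := mean_mono fun s' => by
        unfold hit
        exact Set.indicator_le_self' (f := (1 : State p → ℝ≥0∞)) (fun _ _ => zero_le) s'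
    _ = 1 := mean_const _ _

lemma outputProb_done (E : Set (ZMod p × ℝ)) (g : ZMod p) (c : ℝ) (h : (g, c) ∈ E) :
    outputProb p B (done g c) E = 1 := by
  refine le_antisymm (outputProb_le_one _ _) ?_
  rw [outputProb_eq]
  refine le_trans ?_ (le_iSup _ 0)
  change 1 ≤ mean (PMF.pure _) _
  rw [mean_pure, hit_done E g c h]

/-- The expected cost of the first `T` steps. -/
noncomputable def costUpTo (p : ℕ) (B : ℝ) (c : State p → ℝ≥0∞) (T : ℕ) (s : State p) : ℝ≥0∞ :=
  ∑ t ∈ Finset.range T, mean (law p B s t) c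

lemma costUpTo_zero (c : State p → ℝ≥0∞) (s : State p) : costUpTo p B c 0 s = 0 := by
  simp [costUpTo]

/-- First-step recursion. By induction on `T`, a potential that is at least the cost of a state plus
its own mean after one step bounds `costUpTo` for every `T`; all cost estimates below are of this
kind. -/
lemma costUpTo_succ (c : State p → ℝ≥0∞) (T : ℕ) (s : State p) :
    costUpTo p B c (T + 1) s = c s + mean (step p B s) (costUpTo p B c T) := by
  unfold costUpTo
  rw [Finset.sum_range_succ', add_comm]
  congr 1
  · exact mean_pure s c
  · simp_rw [mean_law_succ]
    unfold mean
    rw [← Summable.tsum_finsetSum (fun _ _ => ENNReal.summable)]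
    simp_rw [Finset.mul_sum]

lemma tsum_mean_law_le {c : State p → ℝ≥0∞} {s : State p} {b : ℝ≥0∞}
    (h : ∀ T, costUpTo p B c T s ≤ b) : ∑' t, mean (law p B s t) c ≤ b := by
  rw [ENNReal.tsum_eq_iSup_nat]
  exact iSup_le h

lemma expectedTime_le {c : State p → ℝ≥0∞} {b : ℝ≥0∞}
    (hc : ∀ s, (opCount p B s : ℝ≥0∞) ≤ c s) (h : ∀ T, costUpTo p B c T init ≤ b) :
    expectedTime p B ≤ b * (p.size : ℝ≥0∞) ^ 2 := by
  refine le_trans ?_ (mul_le_mul_left (tsum_mean_law_le h) _)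
  unfold expectedTime
  rw [← ENNReal.tsum_mul_right]
  refine ENNReal.tsum_le_tsum fun t => ?_
  unfold mean
  rw [← ENNReal.tsum_mul_right]
  refine ENNReal.tsum_le_tsum fun s => ?_
  unfold cost
  push_cast
  rw [mul_assoc]
  gcongr
  exact hc s

/-- If a phase `J` is left almost surely, and only to states with output probability at least `K`,
then the output probability is at least `K` throughout the phase. -/
lemma le_outputProb_of_phase {E : Set (ZMod p × ℝ)} {J : State p → Prop} {K : ℝ≥0∞}
    (hK : K ≠ ∞) {c : State p → ℝ≥0∞} (hc : ∀ s, J s → 1 ≤ c s)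
    (hJ : ∀ s, J s → ∀ s' ∈ (step p B s).support, J s' ∨ K ≤ outputProb p B s' E)
    {s₀ : State p} (h₀ : J s₀) {b : ℝ≥0∞} (hb : b ≠ ∞) (h : ∀ T, costUpTo p B c T s₀ ≤ b) :
    K ≤ outputProb p B s₀ E := by
  -- `r t s` is the probability of being in the phase at time `t`. By induction on `t`, a path
  -- leaving the phase earlier contributes at least `K`, so at most `K * r t s` is missing.
  set r : ℕ → State p → ℝ≥0∞ := fun t s => mean (law p B s t) (Set.indicator {s | J s} 1) with hr
  have key : ∀ t s, J s → K ≤ outputProb p B s E + K * r t s := by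
    intro t
    induction t with
    | zero =>
      intro s hs
      have : r 0 s = 1 := by
        change mean (PMF.pure s) _ = 1
        rw [mean_pure]
        exact Set.indicator_of_mem (s := {s | J s}) hs 1
      rw [this, mul_one]
      exact le_add_self
    | succ t ih =>
      intro s hs
      have h1 : r (t + 1) s = mean (step p B s) (r t) := mean_law_succ s t _
      rw [h1, outputProb_step, ← mean_mul_left, ← mean_add, ← mean_const (step p B s) K]
      refine mean_mono_support fun s' hs' => ?_
      rw [mean_const]
      rcases hJ s hs s' hs' with h2 | h2
      · exact ih s' h2
      · exact h2.trans le_self_add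
  -- Every step inside the phase costs at least 1, so the expected time spent there is at most `b`.
  -- Finiteness forces `r t s₀` to tend to 0.
  have hsum : ∑' t, r t s₀ ≤ b := by
    refine le_trans (ENNReal.tsum_le_tsum fun t => ?_) (tsum_mean_law_le h)
    refine mean_mono fun s => ?_
    by_cases hs : J s
    · rw [Set.indicator_of_mem (s := {s | J s}) hs]
      exact hc s hs
    · rw [Set.indicator_of_notMem (s := {s | J s}) hs]
      exact zero_le
  have hlim := ENNReal.tendsto_atTop_zero_of_tsum_ne_top (ne_top_of_le_ne_top hb hsum)
  have hlim2 : Filter.Tendsto (fun t => outputProb p B s₀ E + K * r t s₀) Filter.atTop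
      (nhds (outputProb p B s₀ E + K * 0)) :=
    Filter.Tendsto.const_add _ (ENNReal.Tendsto.const_mul hlim (Or.inr hK))
  rw [mul_zero, add_zero] at hlim2
  exact ge_of_tendsto' hlim2 fun t => key t s₀ h₀

end machine

end ProbRoot

namespace ProbRoot

open scoped ENNReal
open State

/-! ### The unfactored part -/

lemma prod_mul_prod_sdiff_primeFactors {n : ℕ} (hn : n ≠ 0) {S : Finset ℕ}
    (hS : S ⊆ n.primeFactors) :
    (∏ q ∈ S, q ^ n.factorization q) * ∏ q ∈ n.primeFactors \ S, q ^ n.factorization q = n := by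
  rw [mul_comm, Finset.prod_sdiff hS, ← Nat.prod_factorization_eq_prod_primeFactors]
  exact Nat.prod_factorization_pow_eq_self hn

lemma div_prod_primeFactors {n : ℕ} (hn : n ≠ 0) {S : Finset ℕ} (hS : S ⊆ n.primeFactors) :
    n / ∏ q ∈ S, q ^ n.factorization q = ∏ q ∈ n.primeFactors \ S, q ^ n.factorization q := by
  refine Nat.div_eq_of_eq_mul_right (Finset.prod_pos fun q hq => ?_)
    (prod_mul_prod_sdiff_primeFactors hn hS).symm
  exact pow_pos (Nat.prime_of_mem_primeFactors (hS hq)).pos _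

lemma primeFactors_prod_pow_factorization {n : ℕ} {S : Finset ℕ} (hS : S ⊆ n.primeFactors) :
    (∏ q ∈ S, q ^ n.factorization q).primeFactors = S := by
  have h0 : (∏ q ∈ S, q ^ n.factorization q) ≠ 0 := Finset.prod_ne_zero_iff.2 fun q hq =>
    pow_ne_zero _ (Nat.prime_of_mem_primeFactors (hS hq)).ne_zero
  ext r
  rw [Nat.mem_primeFactors]
  constructor
  · rintro ⟨hr, hd, -⟩
    obtain ⟨q, hq, hrq⟩ := (hr.prime.dvd_finsetProd_iff _).1 hd
    have := (Nat.prime_dvd_prime_iff_eq hr (Nat.prime_of_mem_primeFactors (hS hq))).1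
      (hr.dvd_of_dvd_pow hrq)
    rwa [this]
  · intro hr
    have hr' : n.factorization r ≠ 0 := by
      rw [← Finsupp.mem_support_iff, Nat.support_factorization]; exact hS hr
    exact ⟨Nat.prime_of_mem_primeFactors (hS hr),
      (dvd_pow_self r hr').trans (Finset.dvd_prod_of_mem _ hr), h0⟩

section cofactor

variable {p : ℕ} {B : ℝ}

lemma smallPrimes_subset : smallPrimes p B ⊆ (p - 1).primeFactors := Finset.filter_subset _ _

lemma prod_smallPrimes_mul_cofactor (hp : 2 ≤ p) :
    (∏ q ∈ smallPrimes p B, q ^ (p - 1).factorization q) * cofactor p B = p - 1 := by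
  unfold cofactor
  rw [div_prod_primeFactors (by omega) smallPrimes_subset]
  exact prod_mul_prod_sdiff_primeFactors (by omega) smallPrimes_subset

lemma primeFactors_cofactor (hp : 2 ≤ p) :
    (cofactor p B).primeFactors = (p - 1).primeFactors \ smallPrimes p B := by
  unfold cofactor
  rw [div_prod_primeFactors (by omega) smallPrimes_subset]
  exact primeFactors_prod_pow_factorization Finset.sdiff_subset

lemma cofactor_dvd (hp : 2 ≤ p) : cofactor p B ∣ p - 1 :=
  Dvd.intro_left _ (prod_smallPrimes_mul_cofactor hp)

lemma cofactor_pos (hp : 2 ≤ p) : 0 < cofactor p B :=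
  Nat.pos_of_dvd_of_pos (cofactor_dvd hp) (by omega)

lemma two_notMem_primeFactors_cofactor (hp : 2 ≤ p) : 2 ∉ (cofactor p B).primeFactors := by
  rw [primeFactors_cofactor hp, Finset.mem_sdiff, smallPrimes, Finset.mem_filter]
  tauto

lemma odd_cofactor (hp : 2 ≤ p) : Odd (cofactor p B) := by
  rw [← Nat.not_even_iff_odd, even_iff_two_dvd]
  intro h
  exact two_notMem_primeFactors_cofactor (B := B) hp
    (Nat.mem_primeFactors.2 ⟨Nat.prime_two, h, (cofactor_pos hp).ne'⟩)

lemma le_of_mem_primeFactors_cofactor (hp : 2 ≤ p) {q : ℕ}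
    (hq : q ∈ (cofactor p B).primeFactors) : B ≤ q := by
  rw [primeFactors_cofactor hp, Finset.mem_sdiff, smallPrimes, Finset.mem_filter] at hq
  by_contra h
  exact hq.2 ⟨hq.1, Or.inr (not_le.1 h)⟩

lemma coprime_prod_smallPrimes_cofactor (hp : 2 ≤ p) :
    Nat.Coprime (∏ q ∈ smallPrimes p B, q ^ (p - 1).factorization q) (cofactor p B) := by
  have h1 : (∏ q ∈ smallPrimes p B, q ^ (p - 1).factorization q) ≠ 0 :=
    Finset.prod_ne_zero_iff.2 fun q hq =>
      pow_ne_zero _ (Nat.prime_of_mem_primeFactors (smallPrimes_subset hq)).ne_zero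
  rw [← Nat.disjoint_primeFactors h1 (cofactor_pos hp).ne',
    primeFactors_prod_pow_factorization smallPrimes_subset, primeFactors_cofactor hp]
  exact Finset.disjoint_sdiff

end cofactor

/-! ### Success of the random draws -/

/-- A value that is an average over `s` of itself on a part of `s` and of `w` on the rest
is the average of `w` over the rest. -/
lemma card_mul_eq_sum_of_self_loop {α : Type} {s : Finset α} (hs : s.Nonempty) (w : α → ℝ≥0∞)
    {u : ℝ≥0∞} (hu : u ≠ ∞) (bad : α → Prop) [DecidablePred bad]
    (h : u = (s.card : ℝ≥0∞)⁻¹ * ∑ a ∈ s, if bad a then u else w a) :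
    ((s.filter fun a => ¬ bad a).card : ℝ≥0∞) * u = ∑ a ∈ s.filter fun a => ¬ bad a, w a := by
  have h0 : (s.card : ℝ≥0∞) ≠ 0 := by simpa using hs.card_pos.ne'
  have h1 : (s.card : ℝ≥0∞) * u = ∑ a ∈ s, if bad a then u else w a := by
    conv_lhs => rw [h]
    rw [← mul_assoc, ENNReal.mul_inv_cancel h0 (ENNReal.natCast_ne_top _), one_mul]
  rw [Finset.sum_ite, Finset.sum_const, nsmul_eq_mul,
    ← Finset.card_filter_add_card_filter_not bad, Nat.cast_add, add_mul] at h1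
  refine (ENNReal.add_right_inj ?_).1 h1
  exact ENNReal.mul_ne_top (ENNReal.natCast_ne_top _) hu

section picks

variable {p : ℕ} [hp : Fact p.Prime] {B : ℝ} {E : Set (ZMod p × ℝ)}

lemma Icc_one_pred_nonempty : (Finset.Icc 1 (p - 1)).Nonempty :=
  Finset.nonempty_Icc.2 (by have := hp.out.two_le; omega)

/-- The powers of a primitive root run through the numbers `1, …, p - 1`. -/
lemma exists_orderOf_eq_sum :
    ∃ ζ : ZMod p, orderOf ζ = p - 1 ∧ ∀ F : ZMod p → ℕ,
      ∑ b ∈ Finset.Icc 1 (p - 1), F ((b : ℕ) : ZMod p) = ∑ j ∈ Finset.Ioc 0 (p - 1), F (ζ ^ j) := by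
  obtain ⟨g, hg⟩ := IsCyclic.exists_generator (α := (ZMod p)ˣ)
  have hord : orderOf g = p - 1 := by
    rw [orderOf_eq_card_of_forall_mem_zpowers hg, Nat.card_eq_fintype_card, ZMod.card_units]
  have hp2 := hp.out.two_le
  refine ⟨g, by rw [orderOf_units, hord], fun F => ?_⟩
  symm
  refine Finset.sum_bij (fun j _ => ((g : ZMod p) ^ j).val) ?_ ?_ ?_ ?_
  · intro j hj
    have hne : ((g : ZMod p) ^ j) ≠ 0 := pow_ne_zero _ g.ne_zero
    have h1 : ((g : ZMod p) ^ j).val ≠ 0 := by rwa [Ne, ZMod.val_eq_zero]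
    have h2 := ZMod.val_lt ((g : ZMod p) ^ j)
    exact Finset.mem_Icc.2 ⟨by omega, by omega⟩
  · intro i hi j hj hij
    rw [Finset.mem_Ioc] at hi hj
    have h1 := ZMod.val_injective p hij
    have h2 : g ^ i = g ^ j := by ext; simpa using h1
    have h3 := pow_eq_pow_iff_modEq.1 h2
    rw [hord] at h3
    -- Exponents run through 1, …, p - 1; shifted down by one they become reduced residues and can
    -- be compared.
    have h4 : i - 1 ≡ j - 1 [MOD p - 1] := by
      refine Nat.ModEq.add_right_cancel' 1 ?_
      rwa [Nat.sub_add_cancel (by omega), Nat.sub_add_cancel (by omega)]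
    have h5 := Nat.ModEq.eq_of_lt_of_lt h4 (by omega) (by omega)
    omega
  · intro b hb
    rw [Finset.mem_Icc] at hb
    have hb0 : (b : ZMod p) ≠ 0 := by
      rw [Ne, ZMod.natCast_eq_zero_iff]
      intro h
      have := Nat.le_of_dvd (by omega) h
      omega
    obtain ⟨n, hn⟩ := (mem_powers_iff_mem_zpowers.2 (hg (Units.mk0 _ hb0)))
    have hn' : (g : ZMod p) ^ n = b := by
      have := congrArg Units.val hn
      simpa using this
    have hper : ∀ m, (g : ZMod p) ^ (m % (p - 1)) = (g : ZMod p) ^ m := by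
      intro m
      rw [← hord, ← orderOf_units, pow_mod_orderOf]
    have hval : ((b : ZMod p)).val = b := ZMod.val_cast_of_lt (by omega)
    -- The residue class 0 is represented by the exponent p - 1.
    rcases Nat.eq_zero_or_pos (n % (p - 1)) with h0 | h0
    · refine ⟨p - 1, Finset.mem_Ioc.2 ⟨by omega, le_rfl⟩, ?_⟩
      rw [← hper, Nat.mod_self, ← h0, hper, hn', hval]
    · refine ⟨n % (p - 1), Finset.mem_Ioc.2 ⟨h0, (Nat.mod_lt _ (by omega)).le⟩, ?_⟩
      rw [hper, hn', hval]
  · intro j _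
    rw [ZMod.natCast_zmod_val]

/-- Each block of Q consecutive integers contains φ(Q) numbers coprime to Q. -/
lemma card_filter_coprime_Ioc (Q k : ℕ) :
    ((Finset.Ioc 0 (k * Q)).filter fun j => Q.Coprime j).card = k * Q.totient := by
  induction k with
  | zero => simp
  | succ k ih =>
    have h1 : Finset.Ioc 0 ((k + 1) * Q) = Finset.Ioc 0 (k * Q) ∪ Finset.Ico (k * Q + 1) (k * Q + 1 + Q) := by
      ext j
      simp only [Finset.mem_Ioc, Finset.mem_union, Finset.mem_Ico]
      have : (k + 1) * Q = k * Q + Q := by ring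
      omega
    rw [h1, Finset.filter_union, Finset.card_union_of_disjoint, ih,
      Nat.filter_coprime_Ico_eq_totient]
    · ring
    · refine Finset.disjoint_filter_filter ?_
      rw [Finset.disjoint_left]
      intro j hj hj'
      simp only [Finset.mem_Ioc, Finset.mem_Ico] at hj hj'
      omega

/-- The number of `b` with `b ^ ((p - 1) / Q) ≠ 1`. -/
lemma card_filter_pow_ne_one {Q : ℕ} (hQ : Q ∣ p - 1) :
    ((Finset.Icc 1 (p - 1)).filter fun b : ℕ => ¬ (b : ZMod p) ^ ((p - 1) / Q) = 1).card
      = (p - 1) / Q * (Q - 1) := by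
  classical
  have hp2 := hp.out.two_le
  obtain ⟨k, hk⟩ := hQ
  have hk0 : 0 < k := Nat.pos_of_ne_zero (by rintro rfl; omega)
  have hQ0 : 0 < Q := Nat.pos_of_ne_zero (by rintro rfl; omega)
  have hdiv : (p - 1) / Q = k := by rw [hk, Nat.mul_div_cancel_left _ hQ0]
  obtain ⟨ζ, hζ, hcard⟩ := exists_orderOf_eq_sum (p := p)
  rw [Finset.card_filter, hcard (fun b => if ¬ b ^ ((p - 1) / Q) = 1 then 1 else 0),
    ← Finset.card_filter, hdiv]
  -- With p - 1 = Qk and b = ζ^j, the power is 1 exactly if Qk divides jk, which happens for k of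
  -- the Qk exponents.
  have h1 : ∀ j, (ζ ^ j) ^ k = 1 ↔ Q ∣ j := by
    intro j
    rw [← pow_mul, ← orderOf_dvd_iff_pow_eq_one, hζ, hk]
    exact Nat.mul_dvd_mul_iff_right hk0
  simp_rw [h1]
  have h2 := Finset.card_filter_add_card_filter_not (s := Finset.Ioc 0 (p - 1)) (fun j => Q ∣ j)
  rw [Nat.Ioc_filter_dvd_card_eq_div, Nat.card_Ioc, hdiv] at h2
  rw [Nat.mul_sub, mul_comm k Q, ← hk, mul_one]
  omega

/-- The number of `b` for which `b ^ ((p - 1) / Q)` has order `Q`. -/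
lemma card_filter_orderOf_pow {Q : ℕ} (hQ : Q ∣ p - 1) :
    ((Finset.Icc 1 (p - 1)).filter fun b : ℕ => orderOf ((b : ZMod p) ^ ((p - 1) / Q)) = Q).card
      = (p - 1) / Q * Q.totient := by
  classical
  have hp2 := hp.out.two_le
  obtain ⟨k, hk⟩ := hQ
  have hk0 : 0 < k := Nat.pos_of_ne_zero (by rintro rfl; omega)
  have hQ0 : 0 < Q := Nat.pos_of_ne_zero (by rintro rfl; omega)
  have hdiv : (p - 1) / Q = k := by rw [hk, Nat.mul_div_cancel_left _ hQ0]
  obtain ⟨ζ, hζ, hcard⟩ := exists_orderOf_eq_sum (p := p)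
  rw [Finset.card_filter, hcard (fun b => if orderOf (b ^ ((p - 1) / Q)) = Q then 1 else 0),
    ← Finset.card_filter, hdiv, ← card_filter_coprime_Ioc, mul_comm k Q, ← hk]
  congr 1
  -- The order of ζ^(jk) is Qk / gcd(Qk, jk) = Q / gcd(Q, j), so it equals Q exactly if j is coprime
  -- to Q.
  refine Finset.filter_congr fun j hj => ?_
  have hj0 : j ≠ 0 := by have := (Finset.mem_Ioc.1 hj).1; omega
  rw [← pow_mul, orderOf_pow' _ (mul_ne_zero hj0 hk0.ne'), hζ, hk, Nat.gcd_mul_right,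
    Nat.mul_div_mul_right _ _ hk0]
  rw [Nat.div_eq_self, Nat.Coprime]
  omega

/-- A rejected b leads back to `pickLast`, so this output probability is an average of itself and of
the values after acceptance. Cancelling the self-loop leaves the average over the accepted b. -/
lemma outputProb_pickLast_eq (a : ZMod p) {Q : ℕ} (hQ : Q ∣ p - 1) :
    (((p - 1) / Q * (Q - 1) : ℕ) : ℝ≥0∞) * outputProb p B (pickLast a Q) E =
      ∑ b ∈ (Finset.Icc 1 (p - 1)).filter
          (fun b : ℕ => ¬ (b : ZMod p) ^ ((p - 1) / Q) = 1),
        outputProb p B (done (a * (b : ZMod p) ^ ((p - 1) / Q)) (reportedProb B Q)) E := by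
  classical
  rw [← card_filter_pow_ne_one hQ]
  refine card_mul_eq_sum_of_self_loop Icc_one_pred_nonempty _
    (ne_top_of_le_ne_top ENNReal.one_ne_top (outputProb_le_one _ _)) _ ?_
  conv_lhs => rw [outputProb_step, step, mean_draw Icc_one_pred_nonempty]
  congr 1
  refine Finset.sum_congr rfl fun b _ => ?_
  rw [outputProb_step, step]
  split_ifs <;> rw [mean_pure]

lemma outputProb_pickLast_eq_one (a : ZMod p) {Q : ℕ} (hQ : Q ∣ p - 1) (hQ1 : 1 < Q)
    (hE : ∀ g, (g, reportedProb B Q) ∈ E) : outputProb p B (pickLast a Q) E = 1 := by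
  classical
  have hp2 := hp.out.two_le
  have h := outputProb_pickLast_eq (B := B) (E := E) a hQ
  rw [Finset.sum_congr rfl (fun b _ => outputProb_done E _ _ (hE _)), Finset.sum_const,
    card_filter_pow_ne_one hQ, nsmul_eq_mul] at h
  have hpos : 0 < (p - 1) / Q * (Q - 1) :=
    Nat.mul_pos (Nat.div_pos (Nat.le_of_dvd (by omega) hQ) (by omega)) (by omega)
  exact (ENNReal.mul_right_inj (by exact_mod_cast hpos.ne') (ENNReal.natCast_ne_top _)).1 h

/-- With k = (p-1)/Q there are k(Q-1) accepted b, and kφ(Q) of them give an element of order Q;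
these are indeed accepted, as Q > 1. -/
lemma le_outputProb_pickLast (a : ZMod p) {Q : ℕ} (hQ : Q ∣ p - 1) (hQ1 : 1 < Q)
    (hE : ∀ b : ZMod p, orderOf (b ^ ((p - 1) / Q)) = Q →
      (a * b ^ ((p - 1) / Q), reportedProb B Q) ∈ E) :
    ENNReal.ofReal ((Q.totient : ℝ) / ((Q : ℝ) - 1)) ≤ outputProb p B (pickLast a Q) E := by
  classical
  have hp2 := hp.out.two_le
  have h := outputProb_pickLast_eq (B := B) (E := E) a hQ
  have hk : 0 < (p - 1) / Q := Nat.div_pos (Nat.le_of_dvd (by omega) hQ) (by omega)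
  have h2 : (((p - 1) / Q * Q.totient : ℕ) : ℝ≥0∞) ≤
      (((p - 1) / Q * (Q - 1) : ℕ) : ℝ≥0∞) * outputProb p B (pickLast a Q) E := by
    rw [h, ← card_filter_orderOf_pow hQ]
    refine le_trans ?_ (Finset.sum_le_sum_of_subset (s := (Finset.Icc 1 (p - 1)).filter
      fun b : ℕ => orderOf ((b : ZMod p) ^ ((p - 1) / Q)) = Q) ?_)
    · rw [Finset.sum_congr rfl (fun b hb => outputProb_done E _ _ (hE _ (Finset.mem_filter.1 hb).2)),
        Finset.sum_const, nsmul_eq_mul, mul_one]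
    · intro b hb
      rw [Finset.mem_filter] at hb ⊢
      refine ⟨hb.1, fun h1 => ?_⟩
      have h2 := hb.2
      rw [h1, orderOf_one] at h2
      omega
  push_cast at h2
  rw [mul_assoc] at h2
  have hk' : (((p - 1) / Q : ℕ) : ℝ≥0∞) ≠ 0 := by exact_mod_cast hk.ne'
  rw [ENNReal.mul_le_mul_iff_right hk' (ENNReal.natCast_ne_top _)] at h2
  have hQr : (1 : ℝ) < Q := by exact_mod_cast hQ1
  rw [ENNReal.ofReal_div_of_pos (by linarith), ENNReal.ofReal_natCast]
  have hsub : ENNReal.ofReal ((Q : ℝ) - 1) = (Q : ℝ≥0∞) - 1 := by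
    rw [ENNReal.ofReal_sub _ zero_le_one, ENNReal.ofReal_natCast, ENNReal.ofReal_one]
  rw [hsub]
  exact ENNReal.div_le_of_le_mul' h2

/-- Let e be the exponent of q in p - 1. The q^e-th power of the element is α^(p-1) = 1, while its
q^(e-1)-th power is α^((p-1)/q), which is not 1. -/
lemma orderOf_pow_div_prime_pow {q : ℕ} (hq : q.Prime) (hqd : q ∣ p - 1) {α : ZMod p}
    (h0 : α ≠ 0) (hα : α ^ ((p - 1) / q) ≠ 1) :
    orderOf (α ^ ((p - 1) / q ^ (p - 1).factorization q)) = q ^ (p - 1).factorization q := by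
  have hp2 := hp.out.two_le
  have hv : (p - 1).factorization q ≠ 0 := by
    have := hq.factorization_pos_of_dvd (by omega) hqd; omega
  obtain ⟨e, he⟩ := Nat.exists_eq_succ_of_ne_zero hv
  have hdvd := Nat.ordProj_dvd (p - 1) q
  rw [he] at hdvd ⊢
  have : Fact q.Prime := ⟨hq⟩
  refine orderOf_eq_prime_pow ?_ ?_
  · rw [← pow_mul]
    have : (p - 1) / q ^ (e + 1) * q ^ e = (p - 1) / q := by
      obtain ⟨k, hk⟩ := hdvd
      rw [hk, Nat.mul_div_cancel_left _ (pow_pos hq.pos _), pow_succ, mul_assoc, mul_comm q k,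
        ← mul_assoc, Nat.mul_div_cancel _ hq.pos, mul_comm]
    rwa [this]
  · rw [← pow_mul, Nat.div_mul_cancel hdvd]
    exact ZMod.pow_card_sub_one_eq_one h0

/-- A lower bound for the output probability once all `α`s have been found carries over to the
beginning of the search for the `α`s. -/
lemma le_outputProb_pick {Q : ℕ} {K : ℝ≥0∞} (ps : List ℕ) : ∀ a : ZMod p, ps.Nodup →
    (∀ q ∈ ps, q.Prime ∧ q ∣ p - 1 ∧ Nat.Coprime q (orderOf a)) →
    (∀ a' : ZMod p, orderOf a' = orderOf a * (ps.map fun q => q ^ (p - 1).factorization q).prod →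
      K ≤ outputProb p B (pick [] a' Q) E) →
    K ≤ outputProb p B (pick ps a Q) E := by
  classical
  induction ps with
  | nil => intro a _ _ h; exact h a (by simp)
  | cons q ps ih =>
    intro a hnd hps hK
    have hp2 := hp.out.two_le
    obtain ⟨hq, hqd, hqa⟩ := hps q List.mem_cons_self
    have key := card_mul_eq_sum_of_self_loop (s := Finset.Icc 1 (p - 1)) Icc_one_pred_nonempty
      (fun α : ℕ => outputProb p B
        (pick ps (a * (α : ZMod p) ^ ((p - 1) / q ^ (p - 1).factorization q)) Q) E)
      (u := outputProb p B (pick (q :: ps) a Q) E)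
      (ne_top_of_le_ne_top ENNReal.one_ne_top (outputProb_le_one _ _))
      (fun α : ℕ => (α : ZMod p) ^ ((p - 1) / q) = 1) (by
        conv_lhs => rw [outputProb_step, step, mean_draw Icc_one_pred_nonempty]
        congr 1
        refine Finset.sum_congr rfl fun b _ => ?_
        rw [outputProb_step, step]
        split_ifs <;> rw [mean_pure])
    have hcard := card_filter_pow_ne_one (p := p) hqd
    have hpos : 0 < (p - 1) / q * (q - 1) :=
      Nat.mul_pos (Nat.div_pos (Nat.le_of_dvd (by omega) hqd) hq.pos)
        (by have := hq.two_le; omega)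
    rw [← hcard] at hpos
    have hc0 : ((((Finset.Icc 1 (p - 1)).filter
        fun b : ℕ => ¬ (b : ZMod p) ^ ((p - 1) / q) = 1).card : ℕ) : ℝ≥0∞) ≠ 0 := by
      exact_mod_cast hpos.ne'
    rw [← ENNReal.mul_le_mul_iff_right hc0 (ENNReal.natCast_ne_top _), key, ← nsmul_eq_mul]
    refine Finset.card_nsmul_le_sum _ _ _ fun α hα => ?_
    rw [Finset.mem_filter, Finset.mem_Icc] at hα
    have hα0 : (α : ZMod p) ≠ 0 := by
      rw [Ne, ZMod.natCast_eq_zero_iff]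
      intro h
      have := Nat.le_of_dvd (by omega) h
      omega
    have hord := orderOf_pow_div_prime_pow hq hqd hα0 hα.2
    -- The primes treated earlier differ from q, so q is coprime to the order of a and the two
    -- orders multiply.
    have hmul : orderOf (a * (α : ZMod p) ^ ((p - 1) / q ^ (p - 1).factorization q)) =
        orderOf a * q ^ (p - 1).factorization q := by
      rw [(Commute.all _ _).orderOf_mul_eq_mul_orderOf_of_coprime, hord]
      rw [hord]
      exact (Nat.Coprime.pow_left _ hqa).symm
    rw [List.nodup_cons] at hnd
    refine ih _ hnd.2 ?_ ?_
    · intro r hr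
      obtain ⟨h1, h2, h3⟩ := hps r (List.mem_cons_of_mem _ hr)
      refine ⟨h1, h2, ?_⟩
      rw [hmul]
      refine h3.mul_right (Nat.Coprime.pow_right _ ((Nat.coprime_primes h1 hq).2 ?_))
      rintro rfl
      exact hnd.1 hr
    · intro a' ha'
      refine hK a' ?_
      rw [ha', hmul, List.map_cons, List.prod_cons, mul_assoc]

/-- The two output probabilities of the algorithm when the partial factorization is given. -/
lemma outputProb_pick_smallPrimes {ps : List ℕ} (hnd : ps.Nodup)
    (hps : ps.toFinset = smallPrimes p B) :
    outputProb p B (pick ps 1 (cofactor p B)) {o | o.2 = reportedProb B (cofactor p B)} = 1 ∧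
    (cofactor p B = 1 → outputProb p B (pick ps 1 (cofactor p B))
      {o | IsPrimitiveRoot o.1 (p - 1)} = 1) ∧
    (cofactor p B ≠ 1 → ENNReal.ofReal (((cofactor p B).totient : ℝ) / ((cofactor p B : ℝ) - 1)) ≤
      outputProb p B (pick ps 1 (cofactor p B)) {o | IsPrimitiveRoot o.1 (p - 1)}) := by
  have hp2 := hp.out.two_le
  have hmem : ∀ q ∈ ps, q.Prime ∧ q ∣ p - 1 ∧ Nat.Coprime q (orderOf (1 : ZMod p)) := by
    intro q hq
    have h1 : q ∈ smallPrimes p B := by rw [← hps]; exact List.mem_toFinset.2 hq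
    have h2 := smallPrimes_subset h1
    refine ⟨Nat.prime_of_mem_primeFactors h2, Nat.dvd_of_mem_primeFactors h2, ?_⟩
    rw [orderOf_one]
    exact Nat.coprime_one_right q
  have hprod : (ps.map fun q => q ^ (p - 1).factorization q).prod =
      ∏ q ∈ smallPrimes p B, q ^ (p - 1).factorization q := by
    rw [← hps, List.prod_toFinset _ hnd]
  have hQd := cofactor_dvd (B := B) hp2
  have hQ0 := cofactor_pos (B := B) hp2
  have hfact := prod_smallPrimes_mul_cofactor (B := B) hp2
  have hcop := coprime_prod_smallPrimes_cofactor (B := B) hp2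
  refine ⟨le_antisymm (outputProb_le_one _ _) ?_, fun hQ => le_antisymm (outputProb_le_one _ _) ?_,
    fun hQ => ?_⟩
  · refine le_outputProb_pick ps 1 hnd hmem fun a' _ => ?_
    rw [outputProb_step, step]
    split_ifs with h
    · rw [mean_pure, outputProb_done]
      rfl
    · rw [mean_pure, outputProb_pickLast_eq_one _ hQd (by omega)]
      exact fun g => rfl
  · refine le_outputProb_pick ps 1 hnd hmem fun a' ha' => ?_
    rw [hprod, orderOf_one, one_mul] at ha'
    rw [hQ, mul_one] at hfact
    rw [outputProb_step, step, if_pos hQ, mean_pure, outputProb_done]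
    change IsPrimitiveRoot a' (p - 1)
    rw [IsPrimitiveRoot.iff_orderOf, ha', hfact]
  · refine le_outputProb_pick ps 1 hnd hmem fun a' ha' => ?_
    rw [hprod, orderOf_one, one_mul] at ha'
    rw [outputProb_step, step, if_neg hQ, mean_pure]
    refine le_outputProb_pickLast _ hQd (by omega) fun b hb => ?_
    change IsPrimitiveRoot (a' * b ^ _) (p - 1)
    rw [IsPrimitiveRoot.iff_orderOf, (Commute.all _ _).orderOf_mul_eq_mul_orderOf_of_coprime, ha',
      hb, hfact]
    rw [ha', hb]
    exact hcop

end picks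

end ProbRoot

namespace ProbRoot

open scoped ENNReal
open State

/-! ### The bound `B` -/

section bound

/-- The left side of the equation for `B`, with `h = (p - 1) / 2`. -/
noncomputable def boundFun (h B : ℝ) : ℝ := (1 + 1 / h) * (1 - 1 / B) ^ Real.logb B h

/-- As B grows, the base 1 - 1/B grows towards 1 and the exponent log_B h shrinks; both raise the
power. -/
lemma one_sub_inv_rpow_logb_strictMono {h : ℝ} (hh : 1 < h) {a b : ℝ} (ha : 1 < a) (hab : a < b) :
    (1 - 1 / a) ^ Real.logb a h < (1 - 1 / b) ^ Real.logb b h := by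
  have hL : 0 < Real.log h := Real.log_pos hh
  have hla : 0 < Real.log a := Real.log_pos ha
  have hlab : Real.log a < Real.log b := Real.log_lt_log (by linarith) hab
  have h1 : 1 / b < 1 / a := one_div_lt_one_div_of_lt (by linarith) hab
  have h2 : 1 / a < 1 := by rw [div_lt_one (by linarith)]; exact ha
  have h3 : 0 < 1 / b := one_div_pos.2 (by linarith)
  calc (1 - 1 / a) ^ Real.logb a h < (1 - 1 / b) ^ Real.logb a h :=
        Real.rpow_lt_rpow (by linarith) (by linarith) (div_pos hL hla)
    _ ≤ (1 - 1 / b) ^ Real.logb b h := by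
        refine Real.rpow_le_rpow_of_exponent_ge (by linarith) (by linarith) ?_
        unfold Real.logb
        gcongr

lemma boundFun_strictMono {h : ℝ} (hh : 1 < h) {a b : ℝ} (ha : 1 < a) (hab : a < b) :
    boundFun h a < boundFun h b :=
  mul_lt_mul_of_pos_left (one_sub_inv_rpow_logb_strictMono hh ha hab)
    (add_pos one_pos (one_div_pos.2 (by linarith)))

lemma le_of_boundFun_le {h : ℝ} (hh : 1 < h) {a b : ℝ} (hb : 1 < b)
    (hab : boundFun h a ≤ boundFun h b) : a ≤ b := by
  by_contra hlt
  exact absurd (boundFun_strictMono hh hb (not_le.1 hlt)) (not_lt.2 hab)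

lemma continuousOn_boundFun {h : ℝ} : ContinuousOn (boundFun h) (Set.Ioi 1) := by
  unfold boundFun Real.logb
  refine continuousOn_const.mul (ContinuousOn.rpow ?_ ?_ ?_)
  · exact continuousOn_const.sub (continuousOn_const.div continuousOn_id
      fun x hx => ne_of_gt (lt_trans zero_lt_one hx))
  · refine continuousOn_const.div (Real.continuousOn_log.mono ?_) ?_
    · intro x hx
      have : (1 : ℝ) < x := hx
      simp only [Set.mem_compl_iff, Set.mem_singleton_iff]
      linarith
    · intro x hx
      exact (Real.log_pos hx).ne'
  · intro x hx
    have h1 : (1 : ℝ) < x := hx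
    left
    have : 1 / x < 1 := by rw [div_lt_one (by linarith)]; exact h1
    linarith

/-- If the exponent r = log_B h is at least 1, Bernoulli gives (1 - 1/B)^r ≥ 1 - r/B, and r ≤ log h
because log B ≥ 1. If r < 1, then h < B and the power is at least 1 - 1/B; the remaining inequality
has cleared numerator B - h + (h log h - 1), which is nonnegative since h ≥ 2. -/
lemma one_sub_log_div_le_boundFun {h B : ℝ} (hh : 2 ≤ h) (hB : 1 ≤ Real.log B) (hB1 : 1 < B) :
    1 - Real.log h / B ≤ boundFun h B := by
  have hL : 0 < Real.log h := Real.log_pos (by linarith)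
  have hB' : 1 / B < 1 := by rw [div_lt_one (by linarith)]; exact hB1
  have hBpos : 0 < 1 / B := by positivity
  unfold boundFun
  rcases le_or_gt 1 (Real.logb B h) with hr | hr
  · have h1 := one_add_mul_self_le_rpow_one_add (s := -(1 / B)) (by linarith) hr
    have h2 : Real.logb B h ≤ Real.log h := div_le_self hL.le hB
    have h3 : Real.logb B h * (1 / B) ≤ Real.log h * (1 / B) := by gcongr
    have h4 : (1 + -(1 / B)) ^ Real.logb B h ≤ (1 + 1 / h) * (1 - 1 / B) ^ Real.logb B h := by
      rw [← sub_eq_add_neg]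
      refine le_mul_of_one_le_left (Real.rpow_nonneg (by linarith) _) ?_
      have : 0 < 1 / h := by positivity
      linarith
    have h5 : Real.log h / B = Real.log h * (1 / B) := by ring
    rw [h5]
    linarith
  · have h1 : 1 - 1 / B ≤ (1 - 1 / B) ^ Real.logb B h := by
      conv_lhs => rw [← Real.rpow_one (1 - 1 / B)]
      exact Real.rpow_le_rpow_of_exponent_ge (by linarith) (by linarith) hr.le
    have h2 : h < B := by
      have : Real.log h < Real.log B := by
        unfold Real.logb at hr
        rwa [div_lt_one (by linarith)] at hr
      exact (Real.log_lt_log_iff (by linarith) (by linarith)).1 this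
    have h3 : 1 / 2 ≤ Real.log h := by
      have h4 : Real.log 2 ≤ Real.log h := Real.log_le_log (by norm_num) hh
      have := Real.log_two_gt_d9
      linarith
    calc 1 - Real.log h / B ≤ (1 + 1 / h) * (1 - 1 / B) := by
          have hh0 : h ≠ 0 := by linarith
          have hB0 : B ≠ 0 := by linarith
          rw [← sub_nonneg]
          have : (1 + 1 / h) * (1 - 1 / B) - (1 - Real.log h / B) =
              (B - h + (h * Real.log h - 1)) / (h * B) := by field_simp; ring
          rw [this]
          refine div_nonneg ?_ (by nlinarith)
          nlinarith
      _ ≤ _ := by gcongr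

/-- Reduces the inequality on [a, b] to rational arithmetic. Both sides increase with B, so the left
is taken at b, with a lower bound ℓ for log h, and the right at a. There h^m ≤ a^k certifies log_a h
≤ k/m, and v is a rational lower bound for (1 - 1/a)^(k/m). -/
lemma one_sub_log_div_le_on_Icc {h m k : ℕ} {κ a b v ℓ B : ℝ} (hh : 1 < h) (hm : m ≠ 0) (ha : 1 < a)
    (hκ : 0 < κ) (hv : 0 ≤ v) (h1 : (h : ℝ) ^ m ≤ a ^ k) (h2 : v ^ m ≤ (1 - 1 / a) ^ k)
    (h3 : 1 - ℓ / b ≤ κ * v) (hℓ : ℓ ≤ Real.log h) (haB : a ≤ B) (hBb : B ≤ b) :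
    1 - Real.log h / B ≤ κ * (1 - 1 / B) ^ Real.logb B h := by
  have hhr : (1 : ℝ) < h := by exact_mod_cast hh
  have hla := Real.log_pos ha
  have ha1 : 1 / a < 1 := by rw [div_lt_one (by linarith)]; exact ha
  have hr : Real.logb a h ≤ (k : ℝ) / m := by
    have hm' : (0 : ℝ) < m := by positivity
    unfold Real.logb
    rw [div_le_div_iff₀ hla hm']
    have := Real.log_le_log (by positivity) h1
    rw [Real.log_pow, Real.log_pow] at this
    linarith
  have hv' : v ≤ (1 - 1 / a) ^ ((k : ℝ) / m) := by
    have h4 : v = (v ^ m) ^ ((1 : ℝ) / m) := by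
      rw [one_div, Real.pow_rpow_inv_natCast hv hm]
    rw [h4]
    refine (Real.rpow_le_rpow (by positivity) h2 (by positivity)).trans_eq ?_
    rw [← Real.rpow_natCast, ← Real.rpow_mul (by linarith)]
    congr 1
    ring
  have h5 : (1 - 1 / a) ^ ((k : ℝ) / m) ≤ (1 - 1 / B) ^ Real.logb B h := by
    refine (Real.rpow_le_rpow_of_exponent_ge (by linarith) (by
      have : 0 < 1 / a := by positivity
      linarith) hr).trans ?_
    rcases eq_or_lt_of_le haB with rfl | hlt
    · exact le_rfl
    · exact (one_sub_inv_rpow_logb_strictMono hhr ha hlt).le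
  have h6 : 1 - Real.log h / B ≤ 1 - ℓ / b := by
    have : ℓ / b ≤ Real.log h / B := by gcongr; linarith
    linarith
  calc _ ≤ _ := h6
    _ ≤ κ * v := h3
    _ ≤ _ := by gcongr; exact hv'.trans h5

/-- Amounts to e^37 ≤ 5^23, checked with a decimal upper bound for e. -/
lemma log_five_gt : (37 / 23 : ℝ) ≤ Real.log (5 : ℕ) := by
  rw [Real.le_log_iff_exp_le (by norm_num)]
  refine le_of_pow_le_pow_left₀ (n := 23) (by norm_num) (by norm_num) ?_
  rw [← Real.exp_nat_mul, show ((23 : ℕ) : ℝ) * (37 / 23) = ((37 : ℕ) : ℝ) * 1 by norm_num,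
    Real.exp_nat_mul]
  refine (pow_le_pow_left₀ (Real.exp_pos 1).le Real.exp_one_lt_d9.le 37).trans ?_
  norm_num

lemma log_six_gt : (43 / 24 : ℝ) ≤ Real.log (6 : ℕ) := by
  rw [Real.le_log_iff_exp_le (by norm_num)]
  refine le_of_pow_le_pow_left₀ (n := 24) (by norm_num) (by norm_num) ?_
  rw [← Real.exp_nat_mul, show ((24 : ℕ) : ℝ) * (43 / 24) = ((43 : ℕ) : ℝ) * 1 by norm_num,
    Real.exp_nat_mul]
  refine (pow_le_pow_left₀ (Real.exp_pos 1).le Real.exp_one_lt_d9.le 43).trans ?_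
  norm_num

/-- The range starts just below 43/24 ≤ log 6, since only B > log h matters later. The subdivision
is finer at the left end. The factor 1 + 1/h is not needed here, hence κ = 1. -/
lemma one_sub_log_six_div_le {B : ℝ} (h1 : 179 / 100 ≤ B) (h2 : B ≤ 3) :
    1 - Real.log (6 : ℕ) / B ≤ 1 * (1 - 1 / B) ^ Real.logb B (6 : ℕ) := by
  have key := fun (a b v : ℝ) (k m : ℕ) => one_sub_log_div_le_on_Icc (h := 6) (m := m) (k := k)
    (κ := 1) (a := a) (b := b) (v := v) (B := B) (ℓ := 43 / 24) (by norm_num)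
  rcases le_total B (97 / 50) with h | h
  · exact key (179 / 100) (97 / 50) (77 / 1000) 25 8 (by norm_num) (by norm_num) (by norm_num)
      (by norm_num) (by norm_num) (by norm_num) (by norm_num) log_six_gt h1 h
  rcases le_total B (52 / 25) with h' | h'
  · exact key (97 / 50) (52 / 25) (139 / 1000) 19 7 (by norm_num) (by norm_num) (by norm_num)
      (by norm_num) (by norm_num) (by norm_num) (by norm_num) log_six_gt h h'
  rcases le_total B (111 / 50) with h | h
  · exact key (52 / 25) (111 / 50) (97 / 500) 5 2 (by norm_num) (by norm_num) (by norm_num)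
      (by norm_num) (by norm_num) (by norm_num) (by norm_num) log_six_gt h' h
  rcases le_total B (121 / 50) with h' | h'
  · exact key (111 / 50) (121 / 50) (13 / 50) 9 4 (by norm_num) (by norm_num) (by norm_num)
      (by norm_num) (by norm_num) (by norm_num) (by norm_num) log_six_gt h h'
  rcases le_total B (269 / 100) with h | h
  · exact key (121 / 50) (269 / 100) (167 / 500) 37 18 (by norm_num) (by norm_num) (by norm_num)
      (by norm_num) (by norm_num) (by norm_num) (by norm_num) log_six_gt h' h
  · exact key (269 / 100) (157 / 50) (43 / 100) 29 16 (by norm_num) (by norm_num) (by norm_num)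
      (by norm_num) (by norm_num) (by norm_num) (by norm_num) log_six_gt h
      (by linarith)

/-- This is the case p = 11, where the factor 1 + 1/5 is kept. The range begins below 37/23 ≤ log 5
and ends at 11/4 > e, from where the general estimate with log B ≥ 1 takes over. -/
lemma one_sub_log_five_div_le {B : ℝ} (h1 : 8 / 5 ≤ B) (h2 : B ≤ 11 / 4) :
    1 - Real.log (5 : ℕ) / B ≤ 6 / 5 * (1 - 1 / B) ^ Real.logb B (5 : ℕ) := by
  have key := fun (a b v : ℝ) (k m : ℕ) => one_sub_log_div_le_on_Icc (h := 5) (m := m) (k := k)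
    (κ := 6 / 5) (a := a) (b := b) (v := v) (B := B) (ℓ := 37 / 23) (by norm_num)
  rcases le_total B (167 / 100) with h | h
  · exact key (8 / 5) (167 / 100) (4 / 125) 7 2 (by norm_num) (by norm_num) (by norm_num)
      (by norm_num) (by norm_num) (by norm_num) (by norm_num) log_five_gt h1 h
  rcases le_total B (43 / 25) with h' | h'
  · exact key (167 / 100) (43 / 25) (11 / 200) 19 6 (by norm_num) (by norm_num) (by norm_num)
      (by norm_num) (by norm_num) (by norm_num) (by norm_num) log_five_gt h h'
  rcases le_total B (44 / 25) with h | h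
  · exact key (43 / 25) (44 / 25) (73 / 1000) 3 1 (by norm_num) (by norm_num) (by norm_num)
      (by norm_num) (by norm_num) (by norm_num) (by norm_num) log_five_gt h' h
  rcases le_total B (9 / 5) with h' | h'
  · exact key (44 / 25) (9 / 5) (9 / 100) 20 7 (by norm_num) (by norm_num) (by norm_num)
      (by norm_num) (by norm_num) (by norm_num) (by norm_num) log_five_gt h h'
  rcases le_total B (46 / 25) with h | h
  · exact key (9 / 5) (46 / 25) (107 / 1000) 11 4 (by norm_num) (by norm_num) (by norm_num)
      (by norm_num) (by norm_num) (by norm_num) (by norm_num) log_five_gt h' h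
  rcases le_total B (47 / 25) with h' | h'
  · exact key (46 / 25) (47 / 25) (123 / 1000) 8 3 (by norm_num) (by norm_num) (by norm_num)
      (by norm_num) (by norm_num) (by norm_num) (by norm_num) log_five_gt h h'
  rcases le_total B (97 / 50) with h | h
  · exact key (47 / 25) (97 / 50) (143 / 1000) 23 9 (by norm_num) (by norm_num) (by norm_num)
      (by norm_num) (by norm_num) (by norm_num) (by norm_num) log_five_gt h' h
  rcases le_total B (101 / 50) with h' | h'
  · exact key (97 / 50) (101 / 50) (17 / 100) 22 9 (by norm_num) (by norm_num) (by norm_num)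
      (by norm_num) (by norm_num) (by norm_num) (by norm_num) log_five_gt h h'
  rcases le_total B (107 / 50) with h | h
  · exact key (101 / 50) (107 / 50) (207 / 1000) 23 10 (by norm_num) (by norm_num) (by norm_num)
      (by norm_num) (by norm_num) (by norm_num) (by norm_num) log_five_gt h' h
  rcases le_total B (117 / 50) with h' | h'
  · exact key (107 / 50) (117 / 50) (131 / 500) 17 8 (by norm_num) (by norm_num) (by norm_num)
      (by norm_num) (by norm_num) (by norm_num) (by norm_num) log_five_gt h h'
  · exact key (117 / 50) (11 / 4) (173 / 500) 19 10 (by norm_num) (by norm_num) (by norm_num)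
      (by norm_num) (by norm_num) (by norm_num) (by norm_num) log_five_gt h' h2

/-- The inequality for small `B`, transferred from `h = 6` to larger `h` by Bernoulli. -/
lemma one_sub_log_div_le_boundFun_of_six_le {h B : ℝ} (hh : 6 ≤ h) (hB : Real.log h < B)
    (hB3 : B ≤ 3) : 1 - Real.log h / B ≤ boundFun h B := by
  have h6 := log_six_gt
  push_cast at h6
  have hL : Real.log 6 ≤ Real.log h := Real.log_le_log (by norm_num) hh
  have hB1 : 1 < B := by linarith
  have hB' : 1 / B < 1 := by rw [div_lt_one (by linarith)]; exact hB1
  have hBpos : 0 < 1 / B := by positivity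
  have h1 := one_sub_log_six_div_le (B := B) (by linarith) hB3
  push_cast at h1
  rw [one_mul] at h1
  -- Raising the inequality for h = 6 to the power t ≥ 1 turns log_B 6 into log_B h on the right; on
  -- the left Bernoulli gives (1 - log 6 / B)^t ≥ 1 - log h / B.
  set t := Real.log h / Real.log 6 with ht
  have ht1 : 1 ≤ t := by rw [ht, le_div_iff₀ (by linarith)]; linarith
  have h2 : Real.log 6 / B < 1 := by rw [div_lt_one (by linarith)]; linarith
  have h3 := one_add_mul_self_le_rpow_one_add (s := -(Real.log 6 / B)) (by linarith) ht1
  have h4 : (1 + -(Real.log 6 / B)) ^ t ≤ ((1 - 1 / B) ^ Real.logb B 6) ^ t :=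
    Real.rpow_le_rpow (by linarith) (by linarith) (by linarith)
  rw [← Real.rpow_mul (by linarith)] at h4
  have h5 : Real.logb B 6 * t = Real.logb B h := by
    rw [ht]; unfold Real.logb; field_simp
  have h6' : t * -(Real.log 6 / B) = -(Real.log h / B) := by
    rw [ht]; field_simp
  rw [h5] at h4
  rw [h6'] at h3
  unfold boundFun
  have h7 : 0 ≤ (1 - 1 / B) ^ Real.logb B h := Real.rpow_nonneg (by linarith) _
  have h8 : 0 ≤ 1 / h * (1 - 1 / B) ^ Real.logb B h := by positivity
  have h9 : (1 + 1 / h) * (1 - 1 / B) ^ Real.logb B h =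
    (1 - 1 / B) ^ Real.logb B h + 1 / h * (1 - 1 / B) ^ Real.logb B h := by ring
  linarith

variable {p : ℕ} {ε B : ℝ}

lemma isFactorBound_iff :
    IsFactorBound p ε B ↔ 1 < B ∧ boundFun (((p : ℝ) - 1) / 2) B = 1 - ε := by
  unfold IsFactorBound boundFun
  rw [one_div_div]

lemma two_le_half (hp : 5 ≤ p) : (2 : ℝ) ≤ ((p : ℝ) - 1) / 2 := by
  have : (5 : ℝ) ≤ p := by exact_mod_cast hp
  linarith

lemma one_le_log_of_three_le {B : ℝ} (hB : 3 ≤ B) : 1 ≤ Real.log B := by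
  rw [Real.le_log_iff_exp_le (by linarith)]
  have := Real.exp_one_lt_d9
  linarith

lemma existsUnique_isFactorBound (hp : 5 ≤ p) (hε : 0 < ε) (hε1 : ε < 1) :
    ∃! B : ℝ, IsFactorBound p ε B := by
  have hh := two_le_half hp
  set h := ((p : ℝ) - 1) / 2 with hdef
  simp_rw [isFactorBound_iff, ← hdef]
  have hL : 0 < Real.log h := Real.log_pos (by linarith)
  have hex : ∃ B, 1 < B ∧ boundFun h B = 1 - ε := by
    set b₂ := max 3 (Real.log h / ε) with hb₂
    have hb₂3 : 3 ≤ b₂ := le_max_left _ _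
    have hb₂L : Real.log h / ε ≤ b₂ := le_max_right _ _
    have h2 : 1 - ε ≤ boundFun h b₂ := by
      refine le_trans ?_ (one_sub_log_div_le_boundFun hh (one_le_log_of_three_le hb₂3)
        (by linarith))
      have : Real.log h / b₂ ≤ ε := by
        rw [div_le_iff₀ (by linarith)]
        rw [div_le_iff₀ hε] at hb₂L
        linarith
      linarith
    -- The bound b₁ ≤ h makes the exponent at least 1, and b₁ ≤ 2/(1+ε) makes 1 - 1/b₁ at most
    -- (1-ε)/2; the prefactor 1 + 1/h is at most 2, so the value at b₁ does not exceed 1 - ε.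
    set b₁ := min h (2 / (1 + ε)) with hb₁
    have hb₁1 : 1 < b₁ := lt_min (by linarith) (by rw [lt_div_iff₀ (by linarith)]; linarith)
    have h1 : boundFun h b₁ ≤ 1 - ε := by
      have hl1 : 1 ≤ Real.logb b₁ h := by
        unfold Real.logb
        rw [le_div_iff₀ (Real.log_pos hb₁1), one_mul]
        exact Real.log_le_log (by linarith) (min_le_left _ _)
      have hinv : (1 + ε) / 2 ≤ 1 / b₁ := by
        rw [div_le_div_iff₀ (by norm_num) (by linarith)]
        have : b₁ ≤ 2 / (1 + ε) := min_le_right _ _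
        rw [le_div_iff₀ (by linarith)] at this
        linarith
      have hlt : 1 / b₁ < 1 := by rw [div_lt_one (by linarith)]; exact hb₁1
      have h3 : (1 - 1 / b₁) ^ Real.logb b₁ h ≤ 1 - 1 / b₁ := by
        conv_rhs => rw [← Real.rpow_one (1 - 1 / b₁)]
        refine Real.rpow_le_rpow_of_exponent_ge (by linarith) ?_ hl1
        have : 0 < 1 / b₁ := by positivity
        linarith
      have h4 : 1 + 1 / h ≤ 2 := by
        have : 1 / h ≤ 1 := by rw [div_le_one (by linarith)]; linarith
        linarith
      unfold boundFun
      calc _ ≤ 2 * (1 - 1 / b₁) := by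
            gcongr
        _ ≤ _ := by linarith
    have hsub : Set.uIcc b₁ b₂ ⊆ Set.Ioi 1 := by
      intro x hx
      rw [Set.mem_uIcc] at hx
      change 1 < x
      rcases hx with hx | hx <;> linarith
    obtain ⟨x, hx, hxe⟩ := intermediate_value_uIcc ((continuousOn_boundFun (h := h)).mono hsub)
      (Set.mem_uIcc.2 (Or.inl ⟨h1, h2⟩))
    exact ⟨x, hsub hx, hxe⟩
  obtain ⟨x, hx1, hx⟩ := hex
  refine ⟨x, ⟨hx1, hx⟩, ?_⟩
  rintro y ⟨hy1, hy⟩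
  exact le_antisymm (le_of_boundFun_le (h := h) (by linarith) hx1 (by rw [hy, hx]))
    (le_of_boundFun_le (h := h) (by linarith) hy1 (by rw [hy, hx]))

lemma IsFactorBound.le_of_log_div_le (hp : 5 ≤ p) (hB : IsFactorBound p ε B) {b : ℝ} (hb : 1 < b)
    (h1 : 1 - ε ≤ boundFun (((p : ℝ) - 1) / 2) b) : B ≤ b := by
  rw [isFactorBound_iff] at hB
  refine le_of_boundFun_le (h := ((p : ℝ) - 1) / 2) ?_ hb (hB.2 ▸ h1)
  linarith [two_le_half hp]

/-- At b = log h / ε the number 1 - ε equals 1 - log h / b, so by monotonicity B ≤ b is the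
inequality 1 - log h / b ≤ `boundFun h b`. For b ≥ 3 the general estimate applies. For smaller b, p
= 11 gives h = 5, and all larger primes give h ≥ 6. -/
lemma IsFactorBound.le_log_div (hp : 5 ≤ p) (hpp : p.Prime) (hε : 0 < ε) (hε1 : ε < 1)
    (hB : IsFactorBound p ε B)
    (hc : 11 ≤ p ∨ 3 * ε ≤ Real.log (((p : ℝ) - 1) / 2)) :
    B ≤ Real.log (((p : ℝ) - 1) / 2) / ε := by
  have hh := two_le_half hp
  set h := ((p : ℝ) - 1) / 2 with hdef
  have hL : 0 < Real.log h := Real.log_pos (by linarith)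
  set b := Real.log h / ε with hb
  have hbε : 1 - ε = 1 - Real.log h / b := by rw [hb]; field_simp
  have hLb : Real.log h < b := by rw [hb, lt_div_iff₀ hε]; nlinarith
  have big : 3 ≤ b → B ≤ b := fun h3 => by
    refine hB.le_of_log_div_le hp (by linarith) ?_
    rw [hbε]
    exact one_sub_log_div_le_boundFun hh (one_le_log_of_three_le h3) (by linarith)
  rcases hc with hc | hc
  · rcases le_or_gt 3 b with h3 | h3
    · exact big h3
    rcases Nat.lt_or_ge p 13 with hp13 | hp13
    · rcases Nat.lt_or_ge p 12 with hp12 | hp12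
      · have : p = 11 := by omega
        have h5 : h = (5 : ℕ) := by rw [hdef, this]; norm_num
        have hb1 : 8 / 5 ≤ b := by 
          have h37 := log_five_gt
          rw [h5] at hLb
          exact le_trans (by norm_num) (h37.trans hLb.le)
        refine hB.le_of_log_div_le hp (by linarith) ?_
        rw [hbε]
        change _ ≤ boundFun h b
        rcases le_total b (11 / 4) with h11 | h11
        · rw [h5]
          refine (one_sub_log_five_div_le hb1 h11).trans_eq ?_
          unfold boundFun
          norm_num
        · refine one_sub_log_div_le_boundFun hh ?_ (by linarith)
          rw [Real.le_log_iff_exp_le (by linarith)]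
          have := Real.exp_one_lt_d9
          linarith
      · have h12 : p = 12 := by omega
        rw [h12] at hpp
        exact absurd hpp (by norm_num)
    · have h6 : 6 ≤ h := by
        have : (13 : ℝ) ≤ p := by exact_mod_cast hp13
        rw [hdef]; linarith
      have h6' : Real.log (6 : ℕ) ≤ Real.log h := Real.log_le_log (by norm_num) (by exact_mod_cast h6)
      refine hB.le_of_log_div_le hp
        (lt_of_lt_of_le (by norm_num) ((log_six_gt.trans h6').trans hLb.le)) ?_
      rw [hbε]
      exact one_sub_log_div_le_boundFun_of_six_le h6 hLb h3.le
  · exact big (by rw [hb, le_div_iff₀ hε]; linarith)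

lemma IsFactorBound.le_max (hp : 5 ≤ p) (hε : 0 < ε) (hB : IsFactorBound p ε B) :
    B ≤ max 3 (Real.log (((p : ℝ) - 1) / 2) / ε) := by
  have hh := two_le_half hp
  set b := max 3 (Real.log (((p : ℝ) - 1) / 2) / ε) with hb
  have hb3 : 3 ≤ b := le_max_left _ _
  refine hB.le_of_log_div_le hp (by linarith) ?_
  refine le_trans ?_ (one_sub_log_div_le_boundFun hh (one_le_log_of_three_le hb3) (by linarith))
  have h1 : Real.log (((p : ℝ) - 1) / 2) / ε ≤ b := le_max_right _ _
  have : Real.log (((p : ℝ) - 1) / 2) / b ≤ ε := by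
    rw [div_le_iff₀ (by linarith)]
    rw [div_le_iff₀ hε] at h1
    linarith
  linarith

end bound

/-! ### The unfactored part and the reported probability -/

section reported

variable {p : ℕ} {ε B : ℝ}

/-- All prime factors of Q are at least B, so B^ω(Q) is at most their product, which divides Q. -/
lemma card_primeFactors_cofactor_le (hp : 2 ≤ p) (hB : 1 < B) :
    ((cofactor p B).primeFactors.card : ℝ) ≤ Real.logb B (cofactor p B) := by
  have hQ : (0 : ℝ) < cofactor p B := by exact_mod_cast cofactor_pos hp
  rw [Real.le_logb_iff_rpow_le hB hQ, Real.rpow_natCast]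
  calc B ^ (cofactor p B).primeFactors.card
      ≤ ∏ q ∈ (cofactor p B).primeFactors, (q : ℝ) := by
        rw [← Finset.prod_const]
        exact Finset.prod_le_prod (fun _ _ => by linarith)
          fun q hq => le_of_mem_primeFactors_cofactor hp hq
    _ ≤ cofactor p B := by
        have h := Nat.le_of_dvd (cofactor_pos (B := B) hp) (Nat.prod_primeFactors_dvd _)
        rw [← Nat.cast_prod]
        exact Nat.cast_le.2 h

/-- Here 1 + 1/(Q-1) = Q/(Q-1), and φ(Q)/Q is a product of ω(Q) ≤ log_B Q factors 1 - 1/q, each at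
least 1 - 1/B. -/
lemma reportedProb_le_totient_div (hp : 2 ≤ p) (hB : 1 < B) (hQ : cofactor p B ≠ 1) :
    reportedProb B (cofactor p B) ≤
      ((cofactor p B).totient : ℝ) / ((cofactor p B : ℝ) - 1) := by
  unfold reportedProb
  rw [if_neg hQ]
  have hcard := card_primeFactors_cofactor_le hp hB
  have hle : ∀ q ∈ (cofactor p B).primeFactors, B ≤ q :=
    fun q hq => le_of_mem_primeFactors_cofactor hp hq
  have hQpos := cofactor_pos (B := B) hp
  set Q := cofactor p B
  have hQ1 : (1 : ℝ) < Q := by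
    have : 1 < Q := by omega
    exact_mod_cast this
  have hinv : 1 / B < 1 := by rw [div_lt_one (by linarith)]; exact hB
  have hinv0 : 0 < 1 / B := by positivity
  have htot : (Q.totient : ℝ) = Q * ∏ q ∈ Q.primeFactors, (1 - (q : ℝ)⁻¹) := by
    have := Nat.totient_eq_mul_prod_factors Q
    have h2 := congrArg (Rat.cast (K := ℝ)) this
    push_cast at h2
    exact h2
  have hprod : (1 - 1 / B) ^ Real.logb B Q ≤ ∏ q ∈ Q.primeFactors, (1 - (q : ℝ)⁻¹) := by
    calc (1 - 1 / B) ^ Real.logb B Q ≤ (1 - 1 / B) ^ (Q.primeFactors.card : ℝ) :=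
          Real.rpow_le_rpow_of_exponent_ge (by linarith) (by linarith) hcard
      _ = (1 - 1 / B) ^ Q.primeFactors.card := Real.rpow_natCast _ _
      _ ≤ _ := by
          rw [← Finset.prod_const]
          refine Finset.prod_le_prod (fun _ _ => by linarith) fun q hq => ?_
          rw [one_div]
          have := hle q hq
          gcongr
  have h1 : 1 + 1 / ((Q : ℝ) - 1) = Q / (Q - 1) := by
    have : (Q : ℝ) - 1 ≠ 0 := by linarith
    field_simp
    ring
  rw [h1, htot, mul_div_right_comm]
  have : 0 < (Q : ℝ) - 1 := by linarith
  gcongr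

lemma two_mul_cofactor_le (hp : 3 ≤ p) (hodd : Odd p) : 2 * cofactor p B ≤ p - 1 := by
  have h2 : 2 ∣ p - 1 := by
    obtain ⟨k, hk⟩ := hodd
    exact ⟨k, by omega⟩
  refine Nat.le_of_dvd (by omega) (Nat.Coprime.mul_dvd_of_dvd_of_dvd ?_ h2 (cofactor_dvd (by omega)))
  exact (Nat.coprime_two_left).2 (odd_cofactor (by omega))

/-- Since Q is odd, 2Q divides p - 1 and Q ≤ h. Passing from h to Q enlarges the power, and it
enlarges the first factor strictly because Q - 1 < h. -/
lemma one_sub_lt_reportedProb (hp : 5 ≤ p) (hpp : p.Prime) (hε : 0 < ε)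
    (hB : IsFactorBound p ε B) : 1 - ε < reportedProb B (cofactor p B) := by
  unfold reportedProb
  split_ifs with hQ
  · linarith
  have hB1 := hB.1
  have hQh := two_mul_cofactor_le (B := B) (by omega : 3 ≤ p) (hpp.odd_of_ne_two (by omega))
  have hQpos := cofactor_pos (B := B) (by omega : 2 ≤ p)
  set Q := cofactor p B
  have hQ1 : (1 : ℝ) < Q := by
    have : 1 < Q := by omega
    exact_mod_cast this
  have hQh' : (Q : ℝ) ≤ ((p : ℝ) - 1) / 2 := by
    have : ((2 * Q : ℕ) : ℝ) ≤ ((p - 1 : ℕ) : ℝ) := by exact_mod_cast hQh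
    rw [Nat.cast_sub (by omega)] at this
    push_cast at this
    linarith
  have hinv : 1 / B < 1 := by rw [div_lt_one (by linarith)]; exact hB1
  have hinv0 : 0 < 1 / B := by positivity
  rw [← (isFactorBound_iff.1 hB).2]
  unfold boundFun
  set h := ((p : ℝ) - 1) / 2
  have h1 : (1 - 1 / B) ^ Real.logb B h ≤ (1 - 1 / B) ^ Real.logb B Q :=
    Real.rpow_le_rpow_of_exponent_ge (by linarith) (by linarith)
      (Real.logb_le_logb_of_le hB1 (by linarith) hQh')
  have h2 : 1 / h < 1 / ((Q : ℝ) - 1) := one_div_lt_one_div_of_lt (by linarith) (by linarith)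
  have h3 : 0 < (1 - 1 / B) ^ Real.logb B h := Real.rpow_pos_of_pos (by linarith) _
  have h4 : 0 < 1 / h := one_div_pos.2 (by linarith)
  calc _ < (1 + 1 / ((Q : ℝ) - 1)) * (1 - 1 / B) ^ Real.logb B h := by gcongr
    _ ≤ _ := by gcongr

/-- Correctness follows from the two output probabilities. -/
lemma correct_of_outputProb (hp : 5 ≤ p) (hpp : p.Prime) (hε : 0 < ε) (hB : IsFactorBound p ε B)
    {s : State p} (h1 : outputProb p B s {o | o.2 = reportedProb B (cofactor p B)} = 1)
    (h2 : cofactor p B = 1 → outputProb p B s {o | IsPrimitiveRoot o.1 (p - 1)} = 1)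
    (h3 : cofactor p B ≠ 1 →
      ENNReal.ofReal (((cofactor p B).totient : ℝ) / ((cofactor p B : ℝ) - 1)) ≤
        outputProb p B s {o | IsPrimitiveRoot o.1 (p - 1)}) :
    Correct p ε B s := by
  have hlt := one_sub_lt_reportedProb hp hpp hε hB
  have hle : ENNReal.ofReal (reportedProb B (cofactor p B)) ≤
      outputProb p B s {o | IsPrimitiveRoot o.1 (p - 1)} := by
    by_cases hQ : cofactor p B = 1
    · rw [h2 hQ, reportedProb, if_pos hQ, ENNReal.ofReal_one]
    · exact (ENNReal.ofReal_le_ofReal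
        (reportedProb_le_totient_div (by omega) hB.1 hQ)).trans (h3 hQ)
  have hpos : 0 < reportedProb B (cofactor p B) := by
    by_cases hQ : cofactor p B = 1
    · rw [reportedProb, if_pos hQ]; exact one_pos
    · have hQpos := cofactor_pos (B := B) (by omega : 2 ≤ p)
      have hQ1 : (1 : ℝ) < cofactor p B := by
        have : 1 < cofactor p B := by omega
        exact_mod_cast this
      have hinv : 1 / B < 1 := by rw [div_lt_one (by linarith [hB.1])]; exact hB.1
      rw [reportedProb, if_neg hQ]
      have : 0 < 1 / ((cofactor p B : ℝ) - 1) := one_div_pos.2 (by linarith)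
      exact mul_pos (by linarith) (Real.rpow_pos_of_pos (by linarith) _)
  exact ⟨h1, hlt, hle, ((ENNReal.ofReal_lt_ofReal_iff hpos).2 hlt).trans_le hle, h2, h3⟩

end reported

end ProbRoot

namespace ProbRoot

/-! ### Floyd's cycle finding for a random map -/

section randomMap

open Function

/-- The first `i ≥ 1` with `x_i = x_{2i}`, where `x_i` is the `i`-th iterate of `f` at `x`. -/
noncomputable def meetTime {α : Type} (f : α → α) (x : α) : ℕ :=
  sInf {i | 1 ≤ i ∧ f^[i] x = f^[2 * i] x}

/-- The first `k` elements of the orbit of `x` are distinct. -/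
def OrbitInj {α : Type} (f : α → α) (x : α) (k : ℕ) : Prop :=
  ∀ i < k, ∀ j < k, f^[i] x = f^[j] x → i = j

variable {α : Type}

lemma OrbitInj.mono {f : α → α} {x : α} {k l : ℕ} (h : OrbitInj f x k) (hl : l ≤ k) :
    OrbitInj f x l := fun i hi j hj => h i (hi.trans_le hl) j (hj.trans_le hl)

/-- The orbit has the shape of the letter rho with tail length l and cycle length m. The equation
x_i = x_{2i} holds exactly if i ≥ l and m ∣ i, so the meeting time is the least positive multiple of
m that is at least l; it cannot exceed l + m, the number of distinct iterates. -/
lemma exists_tail_cycle [Finite α] (f : α → α) (x : α) :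
    ∃ l m : ℕ, 0 < m ∧ OrbitInj f x (l + m) ∧ f^[l + m] x = f^[l] x ∧
      1 ≤ meetTime f x ∧ f^[meetTime f x] x = f^[2 * meetTime f x] x ∧
      m ∣ meetTime f x ∧ l ≤ meetTime f x ∧ meetTime f x ≤ l + m := by
  classical
  have hper : ∀ a b, a < b → f^[a] x = f^[b] x → IsPeriodicPt f (b - a) (f^[a] x) := by
    intro a b hab h
    rw [IsPeriodicPt, IsFixedPt, ← iterate_add_apply, Nat.sub_add_cancel hab.le, h]
  have hex : ∃ l, f^[l] x ∈ periodicPts f := by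
    obtain ⟨a, b, hab, h⟩ := Finite.exists_ne_map_eq_of_infinite fun i => f^[i] x
    rcases lt_or_gt_of_ne hab with h1 | h1
    · exact ⟨a, mk_mem_periodicPts (by omega) (hper a b h1 h)⟩
    · exact ⟨b, mk_mem_periodicPts (by omega) (hper b a h1 h.symm)⟩
  set l := Nat.find hex with hl
  have hlp : f^[l] x ∈ periodicPts f := Nat.find_spec hex
  set m := minimalPeriod f (f^[l] x) with hm
  have hm0 : 0 < m := minimalPeriod_pos_of_mem_periodicPts hlp
  have hmin : ∀ i, f^[i] x ∈ periodicPts f → l ≤ i := fun i hi => Nat.find_min' hex hi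
  have hmp : ∀ i, l ≤ i → minimalPeriod f (f^[i] x) = m := by
    intro i hi
    rw [hm, ← minimalPeriod_apply_iterate hlp (i - l), ← iterate_add_apply, Nat.sub_add_cancel hi]
  have hiff : ∀ i, l ≤ i → m ∣ i → f^[i] x = f^[2 * i] x := by
    intro i hi hd
    have : IsPeriodicPt f i (f^[i] x) := by
      exact isPeriodicPt_iff_minimalPeriod_dvd.2 (by rwa [hmp i hi])
    rw [two_mul, iterate_add_apply, this.eq]
  have hne : {i | 1 ≤ i ∧ f^[i] x = f^[2 * i] x}.Nonempty := by
    refine ⟨m * (l + 1), by nlinarith, hiff _ (by nlinarith) (dvd_mul_right _ _)⟩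
  obtain ⟨hT1, hT⟩ := Nat.sInf_mem hne
  change 1 ≤ meetTime f x at hT1
  change f^[meetTime f x] x = f^[2 * meetTime f x] x at hT
  have hTper : IsPeriodicPt f (meetTime f x) (f^[meetTime f x] x) := by
    rw [IsPeriodicPt, IsFixedPt, ← iterate_add_apply, ← two_mul, hT]
  have hlT : l ≤ meetTime f x := hmin _ (mk_mem_periodicPts (by omega) hTper)
  have hmT : m ∣ meetTime f x := by
    rw [← hmp _ hlT]; exact hTper.minimalPeriod_dvd
  refine ⟨l, m, hm0, ?_, ?_, hT1, hT, hmT, hlT, ?_⟩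
  · have key : ∀ a b, a < b → b < l + m → f^[a] x ≠ f^[b] x := by
      intro a b hab hb h
      have h1 := hper a b hab h
      have h2 := hmin a (mk_mem_periodicPts (by omega) h1)
      have h3 := h1.minimalPeriod_dvd
      rw [hmp a h2] at h3
      have := Nat.le_of_dvd (by omega) h3
      omega
    intro i hi j hj hij
    by_contra hne
    rcases lt_or_gt_of_ne hne with h | h
    · exact key i j h hj hij
    · exact key j i h hi hij.symm
  · rw [add_comm, iterate_add_apply]
    exact (isPeriodicPt_minimalPeriod f (f^[l] x)).eq
  · by_contra hlt
    -- If the meeting time exceeded l + m, subtracting one period would give an earlier meeting.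
    have h1 : meetTime f x - m ∈ {i | 1 ≤ i ∧ f^[i] x = f^[2 * i] x} := by
      refine ⟨by omega, hiff _ (by omega) ?_⟩
      exact Nat.dvd_sub hmT dvd_rfl
    have h2 : meetTime f x ≤ meetTime f x - m := Nat.sInf_le h1
    omega

lemma meetTime_le_card [Fintype α] (f : α → α) (x : α) : meetTime f x ≤ Fintype.card α := by
  obtain ⟨l, m, -, hA, -, -, -, -, -, hT⟩ := exists_tail_cycle f x
  have hA' := hA.mono hT
  have := Fintype.card_le_of_injective (fun i : Fin (meetTime f x) => f^[(i : ℕ)] x)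
    (fun i j hij => Fin.ext (hA' i i.2 j j.2 hij))
  simpa using this

/-- The value of f at x_k is first used to form x_{k+1}, because x_0, …, x_{k-1} differ from x_k.
Redirecting f there leaves the orbit up to x_k intact. -/
lemma iterate_update_of_orbitInj [DecidableEq α] {f : α → α} {x : α} {k : ℕ}
    (h : OrbitInj f x (k + 1)) (v : α) :
    ∀ i ≤ k, (update f (f^[k] x) v)^[i] x = f^[i] x := by
  intro i
  induction i with
  | zero => intro _; rfl
  | succ i ih =>
    intro hi
    rw [iterate_succ_apply', ih (by omega), iterate_succ_apply', update_of_ne]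
    intro heq
    have := h i (by omega) k (by omega) heq
    omega

lemma orbitInj_update [DecidableEq α] {f : α → α} {x : α} {k : ℕ}
    (h : OrbitInj f x (k + 1)) (v : α) : OrbitInj (update f (f^[k] x) v) x (k + 1) := by
  intro i hi j hj hij
  rw [iterate_update_of_orbitInj h v i (by omega), iterate_update_of_orbitInj h v j (by omega)] at hij
  exact h i hi j hj hij

variable [Fintype α] [DecidableEq α]

open scoped Classical in
/-- The number of pairs `(f, x)` for which the first `k` elements of the orbit are distinct. -/
noncomputable def orbitCount (α : Type) [Fintype α] [DecidableEq α] (k : ℕ) : ℕ :=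
  (Finset.univ.filter fun w : (α → α) × α => OrbitInj w.1 w.2 k).card

/-- Given that the first `k + 1` elements of the orbit are distinct, the next one is uniformly
distributed. -/
lemma card_mul_card_orbit_closes (k j : ℕ) (hj : j ≤ k) [DecidablePred fun w : (α → α) × α =>
      OrbitInj w.1 w.2 (k + 1) ∧ w.1^[k + 1] w.2 = w.1^[j] w.2] :
    Fintype.card α * (Finset.univ.filter fun w : (α → α) × α =>
      OrbitInj w.1 w.2 (k + 1) ∧ w.1^[k + 1] w.2 = w.1^[j] w.2).card = orbitCount α (k + 1) := by
  classical
  rw [mul_comm, ← Finset.card_univ, ← Finset.card_product]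
  unfold orbitCount
  -- Forward: a pair whose orbit closes at x_j, together with any v, is redirected to f(x_k) = v.
  -- Backward: the value at x_k is remembered as v and replaced by x_j.
  refine Finset.card_nbij' (fun z => (update z.1.1 (z.1.1^[k] z.1.2) z.2, z.1.2))
    (fun w => ((update w.1 (w.1^[k] w.2) (w.1^[j] w.2), w.2), w.1^[k + 1] w.2)) ?_ ?_ ?_ ?_
  · rintro ⟨⟨f, x⟩, v⟩ hz
    simp only [Finset.coe_product, Finset.coe_filter, Finset.mem_univ, true_and, Finset.coe_univ,
      Set.mem_prod, Set.mem_ofPred_eq, Set.mem_univ, and_true] at hz ⊢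
    exact orbitInj_update hz.1 v
  · rintro ⟨f, x⟩ hw
    simp only [Finset.coe_product, Finset.coe_filter, Finset.mem_univ, true_and, Finset.coe_univ,
      Set.mem_prod, Set.mem_ofPred_eq, Set.mem_univ, and_true] at hw ⊢
    refine ⟨orbitInj_update hw _, ?_⟩
    rw [iterate_succ_apply', iterate_update_of_orbitInj hw _ k le_rfl, update_self,
      iterate_update_of_orbitInj hw _ j hj]
  · rintro ⟨⟨f, x⟩, v⟩ hz
    simp only [Finset.coe_product, Finset.coe_filter, Finset.mem_univ, true_and, Finset.coe_univ,
      Set.mem_prod, Set.mem_ofPred_eq, Set.mem_univ, and_true] at hz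
    simp only [Prod.mk.injEq, and_true]
    rw [iterate_succ_apply', iterate_update_of_orbitInj hz.1 _ k le_rfl,
      iterate_update_of_orbitInj hz.1 _ j hj, update_self, update_idem]
    refine ⟨?_, rfl⟩
    rw [update_eq_self_iff, ← hz.2, iterate_succ_apply']
  · rintro ⟨f, x⟩ hw
    simp only [Finset.coe_filter, Finset.mem_univ, true_and, Set.mem_ofPred_eq] at hw
    simp only [Prod.mk.injEq, and_true]
    rw [iterate_update_of_orbitInj hw _ k le_rfl, update_idem, update_eq_self_iff,
      iterate_succ_apply']

lemma orbitCount_le (k : ℕ) : orbitCount α k ≤ Fintype.card ((α → α) × α) :=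
  Finset.card_le_univ _

lemma orbitCount_antitone : Antitone (orbitCount α) := by
  classical
  intro k l hkl
  refine Finset.card_le_card fun w hw => ?_
  rw [Finset.mem_filter] at hw ⊢
  exact ⟨hw.1, hw.2.mono hkl⟩

/-- If x_0, …, x_k are distinct, then x_{k+1} either hits one of these k + 1 points, each with
conditional probability 1/N, or the orbit has k + 2 distinct elements. -/
lemma orbitCount_succ_le (k : ℕ) :
    (k + 1) * orbitCount α (k + 1) + Fintype.card α * orbitCount α (k + 2) ≤
      Fintype.card α * orbitCount α (k + 1) := by
  classical
  set S : ℕ → Finset ((α → α) × α) := fun j => Finset.univ.filter fun w : (α → α) × α =>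
      OrbitInj w.1 w.2 (k + 1) ∧ w.1^[k + 1] w.2 = w.1^[j] w.2 with hS
  set A := Finset.univ.filter fun w : (α → α) × α => OrbitInj w.1 w.2 (k + 2) with hA
  have h1 : ∀ j ∈ Finset.range (k + 1), Fintype.card α * (S j).card = orbitCount α (k + 1) :=
    fun j hj => card_mul_card_orbit_closes k j (by simpa [Nat.lt_succ_iff] using hj)
  have hdisj : Set.PairwiseDisjoint (Finset.range (k + 1) : Set ℕ) S := by
    intro i hi j hj hij
    rw [Function.onFun, Finset.disjoint_left]
    intro w hw hw'
    rw [hS, Finset.mem_filter] at hw hw'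
    rw [Finset.coe_range, Set.mem_Iio] at hi hj
    exact hij (hw.2.1 i hi j hj (hw.2.2.symm.trans hw'.2.2))
  have hdisj2 : Disjoint ((Finset.range (k + 1)).biUnion S) A := by
    rw [Finset.disjoint_left]
    intro w hw hw'
    rw [Finset.mem_biUnion] at hw
    obtain ⟨j, hj, hw⟩ := hw
    rw [hS, Finset.mem_filter] at hw
    rw [hA, Finset.mem_filter] at hw'
    rw [Finset.mem_range] at hj
    have := hw'.2 (k + 1) (by omega) j (by omega) hw.2.2
    omega
  have hsub : ((Finset.range (k + 1)).biUnion S) ∪ A ⊆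
      Finset.univ.filter fun w : (α → α) × α => OrbitInj w.1 w.2 (k + 1) := by
    intro w hw
    rw [Finset.mem_union, Finset.mem_biUnion] at hw
    rw [Finset.mem_filter]
    refine ⟨Finset.mem_univ _, ?_⟩
    rcases hw with ⟨j, _, hw⟩ | hw
    · exact (Finset.mem_filter.1 hw).2.1
    · exact (Finset.mem_filter.1 hw).2.mono (by omega)
  have h2 := Finset.card_le_card hsub
  rw [Finset.card_union_of_disjoint hdisj2, Finset.card_biUnion hdisj] at h2
  have h3 := Nat.mul_le_mul_left (Fintype.card α) h2
  rw [mul_add, Finset.mul_sum, Finset.sum_congr rfl h1, Finset.sum_const, Finset.card_range,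
    smul_eq_mul] at h3
  exact h3

/-- The expected value of the meeting time is at most `2 √N`. -/
lemma sum_meetTime_le [Nonempty α] :
    ∑ w : (α → α) × α, (meetTime w.1 w.2 : ℝ) ≤
      2 * √(Fintype.card α) * Fintype.card ((α → α) × α) := by
  classical
  set N := Fintype.card α with hN
  set M := Fintype.card ((α → α) × α) with hM
  have hN0 : 0 < N := Fintype.card_pos
  have h1 : ∑ w : (α → α) × α, meetTime w.1 w.2 ≤ ∑ t ∈ Finset.range N, orbitCount α (t + 1) := by
    have : ∀ w : (α → α) × α, meetTime w.1 w.2 ≤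
        ∑ t ∈ Finset.range N, if OrbitInj w.1 w.2 (t + 1) then 1 else 0 := by
      intro w
      obtain ⟨l, m, -, hA, -, -, -, -, -, hT⟩ := exists_tail_cycle w.1 w.2
      rw [← Finset.sum_filter, Finset.sum_const, smul_eq_mul, mul_one]
      conv_lhs => rw [← Finset.card_range (meetTime w.1 w.2)]
      refine Finset.card_le_card fun t ht => ?_
      have h3 := meetTime_le_card w.1 w.2
      rw [Finset.mem_range] at ht
      rw [Finset.mem_filter, Finset.mem_range]
      exact ⟨by omega, hA.mono (by omega)⟩
    refine (Finset.sum_le_sum fun w _ => this w).trans ?_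
    rw [Finset.sum_comm]
    refine Finset.sum_le_sum fun t _ => ?_
    rw [← Finset.sum_filter, Finset.sum_const, smul_eq_mul, mul_one, orbitCount]
  have hsN : (0 : ℝ) < √N := Real.sqrt_pos.2 (by exact_mod_cast hN0)
  have hss : √(N : ℝ) * √N = N := Real.mul_self_sqrt (by positivity)
  -- With A_k = `orbitCount α k`: for small t the trivial bound M suffices. Once t + 1 ≥ √N, the
  -- inequality (t+1) A_{t+1} ≤ N (A_{t+1} - A_{t+2}) gives A_{t+1} ≤ √N (A_{t+1} - A_{t+2}), which
  -- telescopes. Each part contributes at most √N · M.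
  have h2 : ∀ t ∈ Finset.range N, (orbitCount α (t + 1) : ℝ) ≤
      (if t < Nat.sqrt N then (M : ℝ) else 0) +
        √N * ((orbitCount α (t + 1) : ℝ) - orbitCount α (t + 2)) := by
    intro t _
    have hanti : (orbitCount α (t + 2) : ℝ) ≤ orbitCount α (t + 1) := by
      exact_mod_cast orbitCount_antitone (α := α) (by omega : t + 1 ≤ t + 2)
    split_ifs with ht
    · have h3 : (orbitCount α (t + 1) : ℝ) ≤ M := by exact_mod_cast orbitCount_le (α := α) (t + 1)
      have h4 : 0 ≤ √N * ((orbitCount α (t + 1) : ℝ) - orbitCount α (t + 2)) :=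
        mul_nonneg hsN.le (by linarith)
      linarith
    · have h3 : √(N : ℝ) ≤ t + 1 := by
        have h4 : N < (t + 1) * (t + 1) := by
          have := Nat.lt_succ_sqrt N
          refine this.trans_le (Nat.mul_le_mul ?_ ?_) <;> omega
        rw [Real.sqrt_le_left (by positivity)]
        have h5 : (N : ℝ) ≤ (t + 1) * (t + 1) := by exact_mod_cast h4.le
        nlinarith
      have h4 : ((t : ℝ) + 1) * orbitCount α (t + 1) + N * orbitCount α (t + 2) ≤
          N * orbitCount α (t + 1) := by exact_mod_cast orbitCount_succ_le (α := α) t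
      have h5 : √(N : ℝ) * orbitCount α (t + 1) ≤
          √N * (√N * ((orbitCount α (t + 1) : ℝ) - orbitCount α (t + 2))) := by
        rw [← mul_assoc, hss]
        have : √(N : ℝ) * orbitCount α (t + 1) ≤ ((t : ℝ) + 1) * orbitCount α (t + 1) := by gcongr
        linarith
      rw [zero_add]
      exact le_of_mul_le_mul_left h5 hsN
  have h3 : ∑ t ∈ Finset.range N, (if t < Nat.sqrt N then (M : ℝ) else 0) ≤ √N * M := by
    rw [← Finset.sum_filter, Finset.sum_const, nsmul_eq_mul]
    gcongr
    calc (((Finset.range N).filter fun t => t < Nat.sqrt N).card : ℝ)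
        ≤ ((Finset.range (Nat.sqrt N)).card : ℝ) := by
          refine Nat.cast_le.2 (Finset.card_le_card fun t ht => ?_)
          rw [Finset.mem_filter] at ht
          exact Finset.mem_range.2 ht.2
      _ = (Nat.sqrt N : ℝ) := by rw [Finset.card_range]
      _ ≤ √N := Real.nat_sqrt_le_real_sqrt
  have h4 : ∑ t ∈ Finset.range N, ((orbitCount α (t + 1) : ℝ) - orbitCount α (t + 2)) ≤ M := by
    have := Finset.sum_range_sub' (fun t => (orbitCount α (t + 1) : ℝ)) N
    rw [show (∑ t ∈ Finset.range N, ((orbitCount α (t + 1) : ℝ) - orbitCount α (t + 2))) = _ from this]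
    have h5 : (orbitCount α (0 + 1) : ℝ) ≤ M := by exact_mod_cast orbitCount_le (α := α) (0 + 1)
    have h6 : (0 : ℝ) ≤ orbitCount α (N + 1) := by positivity
    linarith
  calc ∑ w : (α → α) × α, (meetTime w.1 w.2 : ℝ)
      ≤ ∑ t ∈ Finset.range N, (orbitCount α (t + 1) : ℝ) := by exact_mod_cast h1
    _ ≤ _ := Finset.sum_le_sum h2
    _ ≤ √N * M + √N * M := by
        rw [Finset.sum_add_distrib, ← Finset.mul_sum]
        gcongr
    _ = _ := by ring

open scoped Classical in
-- Meeting time t forces a cycle length m ∣ t and a tail length l with t - m ≤ l ≤ t. Each pair (l,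
-- m) has probability at most 1/N, and m + 1 values of l are possible.
lemma card_mul_card_meetTime_eq_le (t : ℕ) (ht : t ≠ 0) :
    Fintype.card α * (Finset.univ.filter fun w : (α → α) × α => meetTime w.1 w.2 = t).card ≤
      (∑ m ∈ t.divisors, (m + 1)) * Fintype.card ((α → α) × α) := by
  set S : ℕ → ℕ → Finset ((α → α) × α) := fun m l => Finset.univ.filter fun w : (α → α) × α =>
      OrbitInj w.1 w.2 (l + m) ∧ w.1^[l + m] w.2 = w.1^[l] w.2 with hS
  have hcard : ∀ m ∈ t.divisors, ∀ l, Fintype.card α * (S m l).card ≤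
      Fintype.card ((α → α) × α) := by
    intro m hm l
    obtain ⟨k, rfl⟩ := Nat.exists_eq_succ_of_ne_zero (Nat.pos_of_mem_divisors hm).ne'
    refine le_trans (le_of_eq ?_) (orbitCount_le (α := α) (l + k + 1))
    exact card_mul_card_orbit_closes (l + k) l (by omega)
  have hsub : (Finset.univ.filter fun w : (α → α) × α => meetTime w.1 w.2 = t) ⊆
      t.divisors.biUnion fun m => (Finset.Icc (t - m) t).biUnion fun l => S m l := by
    intro w hw
    rw [Finset.mem_filter] at hw
    obtain ⟨l, m, hm, hA, hc, -, -, hmT, hlT, hT⟩ := exists_tail_cycle w.1 w.2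
    rw [hw.2] at hmT hlT hT
    rw [Finset.mem_biUnion]
    refine ⟨m, Nat.mem_divisors.2 ⟨hmT, ht⟩, Finset.mem_biUnion.2 ⟨l, ?_, ?_⟩⟩
    · exact Finset.mem_Icc.2 ⟨by omega, hlT⟩
    · exact Finset.mem_filter.2 ⟨Finset.mem_univ _, hA, hc⟩
  calc _ ≤ Fintype.card α * ∑ m ∈ t.divisors, ∑ l ∈ Finset.Icc (t - m) t, (S m l).card := by
        gcongr
        refine (Finset.card_le_card hsub).trans (Finset.card_biUnion_le.trans ?_)
        exact Finset.sum_le_sum fun m _ => Finset.card_biUnion_le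
    _ ≤ ∑ m ∈ t.divisors, (m + 1) * Fintype.card ((α → α) × α) := by
        rw [Finset.mul_sum]
        refine Finset.sum_le_sum fun m hm => ?_
        rw [Finset.mul_sum]
        refine (Finset.sum_le_sum fun l _ => hcard m hm l).trans ?_
        rw [Finset.sum_const, Nat.card_Icc, smul_eq_mul]
        gcongr
        omega
    _ = _ := by rw [Finset.sum_mul]

/-- The divisor sum is the sum of t/m over divisors m, hence at most t times a harmonic number, and
1 + log t ≤ 2√t. -/
lemma sum_divisors_le (t : ℕ) : ((∑ m ∈ t.divisors, m : ℕ) : ℝ) ≤ 2 * (t * √t) := by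
  rcases Nat.eq_zero_or_pos t with rfl | ht
  · simp
  have ht' : (0 : ℝ) < t := by exact_mod_cast ht
  have h1 : ((∑ m ∈ t.divisors, m : ℕ) : ℝ) = ∑ m ∈ t.divisors, (t : ℝ) / m := by
    rw [← Nat.sum_div_divisors t (fun d => d)]
    push_cast
    refine Finset.sum_congr rfl fun m hm => ?_
    exact Nat.cast_div (Nat.dvd_of_mem_divisors hm) (by exact_mod_cast (Nat.pos_of_mem_divisors hm).ne')
  have h2 : ∑ m ∈ t.divisors, (t : ℝ) / m ≤ t * ∑ m ∈ Finset.Icc 1 t, ((m : ℝ))⁻¹ := by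
    rw [Finset.mul_sum]
    simp_rw [div_eq_mul_inv]
    refine Finset.sum_le_sum_of_subset_of_nonneg ?_ fun _ _ _ => by positivity
    intro m hm
    exact Finset.mem_Icc.2 ⟨Nat.pos_of_mem_divisors hm, Nat.divisor_le hm⟩
  have h3 := harmonic_le_one_add_log t
  rw [harmonic_eq_sum_Icc] at h3
  push_cast at h3
  have h4 : Real.log t ≤ 2 * √t - 2 := by
    have h5 : Real.log t = 2 * Real.log √t := by rw [Real.log_sqrt ht'.le]; ring
    have := Real.log_le_sub_one_of_pos (Real.sqrt_pos.2 ht')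
    linarith
  rw [h1]
  calc _ ≤ _ := h2
    _ ≤ t * (2 * √t) := by gcongr; linarith
    _ = _ := by ring

open scoped Classical in
/-- Each value is taken by the meeting time with small probability. -/
lemma card_meetTime_eq_le [Nonempty α] (t : ℕ) :
    ((Finset.univ.filter fun w : (α → α) × α => meetTime w.1 w.2 = t).card : ℝ) ≤
      4 * (Fintype.card α : ℝ) ^ (-(1 / 10) : ℝ) * Fintype.card ((α → α) × α) := by
  set S := Finset.univ.filter fun w : (α → α) × α => meetTime w.1 w.2 = t with hS
  have hN0 : (0 : ℝ) < Fintype.card α := by exact_mod_cast Fintype.card_pos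
  rcases Nat.eq_zero_or_pos t with rfl | ht
  · have : S = ∅ := by
      rw [hS, Finset.filter_eq_empty_iff]
      intro w _ h
      obtain ⟨l, m, -, -, -, h1, -⟩ := exists_tail_cycle w.1 w.2
      omega
    rw [this]
    simp only [Finset.card_empty, Nat.cast_zero]
    positivity
  have ht' : (0 : ℝ) < t := by exact_mod_cast ht
  set N : ℝ := (Fintype.card α : ℝ) with hN
  set M : ℝ := (Fintype.card ((α → α) × α) : ℝ) with hM
  -- The threshold balances two bounds. Below it the divisor sum gives a probability of order
  -- t^(3/2)/N ≤ N^(-1/10); above it Markov's inequality with mean 2√N gives 2 N^(1/2 - 3/5).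
  rcases le_or_gt (t : ℝ) (N ^ (3 / 5 : ℝ)) with h | h
  · have h1 : N * S.card ≤ 4 * (t * √t) * M := by
      have h2 : N * S.card ≤ ((∑ m ∈ t.divisors, (m + 1) : ℕ) : ℝ) * M := by
        have := card_mul_card_meetTime_eq_le (α := α) t ht.ne'
        rw [hN, hM]
        exact_mod_cast this
      refine h2.trans ?_
      gcongr
      have h3 : ∑ m ∈ t.divisors, (m + 1) ≤ 2 * ∑ m ∈ t.divisors, m := by
        rw [Finset.mul_sum]
        refine Finset.sum_le_sum fun m hm => ?_
        have := Nat.pos_of_mem_divisors hm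
        omega
      have h4 : ((∑ m ∈ t.divisors, (m + 1) : ℕ) : ℝ) ≤ 2 * ((∑ m ∈ t.divisors, m : ℕ) : ℝ) := by
        exact_mod_cast h3
      linarith [sum_divisors_le t]
    have h2 : t * √t ≤ N ^ (9 / 10 : ℝ) := by
      calc t * √t ≤ N ^ (3 / 5 : ℝ) * √(N ^ (3 / 5 : ℝ)) := by gcongr
        _ = N ^ (9 / 10 : ℝ) := by
          rw [Real.sqrt_eq_rpow, ← Real.rpow_mul hN0.le, ← Real.rpow_add hN0]
          norm_num
    have h3 : N * (N ^ (-(1 / 10) : ℝ)) = N ^ (9 / 10 : ℝ) := by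
      conv_lhs => rw [← Real.rpow_one N, ← Real.rpow_mul hN0.le, ← Real.rpow_add hN0]
      norm_num
    refine le_of_mul_le_mul_left (h1.trans ?_) hN0
    calc 4 * (t * √t) * M ≤ 4 * N ^ (9 / 10 : ℝ) * M := by gcongr
      _ = _ := by rw [← h3]; ring
  · have h1 : t * (S.card : ℝ) ≤ 2 * √N * M := by
      refine le_trans ?_ (sum_meetTime_le (α := α))
      calc t * (S.card : ℝ) = ∑ w ∈ S, (meetTime w.1 w.2 : ℝ) := by
            rw [Finset.sum_congr rfl fun w hw => by rw [(Finset.mem_filter.1 hw).2],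
              Finset.sum_const, nsmul_eq_mul, mul_comm]
        _ ≤ _ := Finset.sum_le_sum_of_subset_of_nonneg (Finset.subset_univ _)
            fun _ _ _ => by positivity
    refine le_of_mul_le_mul_left (h1.trans ?_) ht'
    have h2 : √N = N ^ (3 / 5 : ℝ) * N ^ (-(1 / 10) : ℝ) := by
      rw [Real.sqrt_eq_rpow, ← Real.rpow_add hN0]
      norm_num
    rw [h2]
    calc _ ≤ 2 * (t * N ^ (-(1 / 10) : ℝ)) * M := by gcongr
      _ ≤ 4 * (t * N ^ (-(1 / 10) : ℝ)) * M := by gcongr; norm_num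
      _ = _ := by ring

open scoped Classical in
-- A starting value fixed by f has meeting time 1, and this has probability 1/N.
lemma card_le_card_meetTime_eq_one [Nonempty α] :
    Fintype.card ((α → α) × α) ≤
      Fintype.card α * (Finset.univ.filter fun w : (α → α) × α => meetTime w.1 w.2 = 1).card := by
  have h1 := card_mul_card_orbit_closes (α := α) 0 0 le_rfl
  have h2 : orbitCount α 1 = Fintype.card ((α → α) × α) := by
    unfold orbitCount
    rw [Finset.filter_true_of_mem, Finset.card_univ]
    intro w _ i hi j hj _
    omega
  rw [zero_add, h2] at h1
  rw [← h1]
  refine Nat.mul_le_mul_left _ (Finset.card_le_card fun w hw => ?_)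
  rw [Finset.mem_filter] at hw ⊢
  refine ⟨hw.1, le_antisymm (Nat.sInf_le ⟨le_rfl, ?_⟩) ?_⟩
  · have h3 : w.1 w.2 = w.2 := hw.2.2
    change w.1 w.2 = w.1 (w.1 w.2)
    rw [h3, h3]
  · obtain ⟨l, m, -, -, -, h3, -⟩ := exists_tail_cycle w.1 w.2
    exact h3

open scoped Classical in
lemma three_mul_card_meetTime_eq_one_le (h3 : 3 ≤ Fintype.card α) :
    3 * (Finset.univ.filter fun w : (α → α) × α => meetTime w.1 w.2 = 1).card ≤
      2 * Fintype.card ((α → α) × α) := by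
  have := card_mul_card_meetTime_eq_le (α := α) 1 one_ne_zero
  rw [Nat.divisors_one, Finset.sum_singleton] at this
  exact (Nat.mul_le_mul_right _ h3).trans this

/-- A uniform upper bound below `1` for the probability of equal meeting times. -/
noncomputable def meetBound : ℝ := 1 - (1 / 3) * (1 / 8 ^ 10)

lemma meetBound_lt_one : meetBound < 1 := by unfold meetBound; norm_num

lemma meetBound_pos : 0 < meetBound := by unfold meetBound; norm_num

variable {β : Type} [Fintype β] [DecidableEq β]

open scoped Classical in
-- With the second pair fixed, the first must hit a prescribed meeting time.
lemma card_meetTime_eq_meetTime_le [Nonempty α] :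
    ((Finset.univ.filter fun w : ((α → α) × α) × ((β → β) × β) =>
      meetTime w.1.1 w.1.2 = meetTime w.2.1 w.2.2).card : ℝ) ≤
      4 * (Fintype.card α : ℝ) ^ (-(1 / 10) : ℝ) *
        Fintype.card (((α → α) × α) × ((β → β) × β)) := by
  rw [Finset.card_filter, ← Finset.univ_product_univ, Finset.sum_product_right]
  push_cast
  calc _ ≤ ∑ _w : (β → β) × β,
        4 * (Fintype.card α : ℝ) ^ (-(1 / 10) : ℝ) * Fintype.card ((α → α) × α) := by
        refine Finset.sum_le_sum fun w _ => ?_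
        have h := card_meetTime_eq_le (α := α) (meetTime w.1 w.2)
        rw [Finset.card_filter] at h
        push_cast at h
        exact h
    _ = _ := by
        rw [Finset.sum_const, nsmul_eq_mul, Finset.card_univ,
          Fintype.card_prod ((α → α) × α) ((β → β) × β)]
        push_cast
        ring

open scoped Classical in
-- The meeting times differ if the first is 1, of probability at least 8^(-10), and the second is
-- not 1, of probability at least 1/3. This explains `meetBound`.
lemma card_meetTime_eq_meetTime_le_of_card_le [Nonempty α] [Nonempty β]
    (hα : Fintype.card α ≤ 8 ^ 10) (hβ : 3 ≤ Fintype.card β) :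
    ((Finset.univ.filter fun w : ((α → α) × α) × ((β → β) × β) =>
      meetTime w.1.1 w.1.2 = meetTime w.2.1 w.2.2).card : ℝ) ≤
      meetBound * Fintype.card (((α → α) × α) × ((β → β) × β)) := by
  set A := Finset.univ.filter fun w : (α → α) × α => meetTime w.1 w.2 = 1 with hA
  set D := Finset.univ.filter fun w : (β → β) × β => ¬ meetTime w.1 w.2 = 1 with hD
  set M := Fintype.card ((α → α) × α) with hM
  set M' := Fintype.card ((β → β) × β) with hM'
  have h1 : M ≤ 8 ^ 10 * A.card :=
    card_le_card_meetTime_eq_one.trans (Nat.mul_le_mul_right _ hα)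
  have h2 : M' ≤ 3 * D.card := by
    have h3 := three_mul_card_meetTime_eq_one_le hβ
    have h4 := Finset.card_filter_add_card_filter_not (s := (Finset.univ : Finset ((β → β) × β)))
      (fun w => meetTime w.1 w.2 = 1)
    rw [Finset.card_univ] at h4
    change 3 * _ ≤ 2 * M' at h3
    change _ + D.card = M' at h4
    omega
  have h3 : A.card * D.card ≤ (Finset.univ.filter fun w : ((α → α) × α) × ((β → β) × β) =>
      ¬ meetTime w.1.1 w.1.2 = meetTime w.2.1 w.2.2).card := by
    rw [← Finset.card_product]
    refine Finset.card_le_card fun w hw => ?_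
    rw [Finset.mem_product, hA, hD, Finset.mem_filter, Finset.mem_filter] at hw
    rw [Finset.mem_filter]
    refine ⟨Finset.mem_univ _, ?_⟩
    rw [hw.1.2]
    exact fun h => hw.2.2 h.symm
  have h4 := Finset.card_filter_add_card_filter_not
    (s := (Finset.univ : Finset (((α → α) × α) × ((β → β) × β))))
    (fun w => meetTime w.1.1 w.1.2 = meetTime w.2.1 w.2.2)
  rw [Finset.card_univ, Fintype.card_prod ((α → α) × α) ((β → β) × β)] at h4
  rw [Fintype.card_prod ((α → α) × α) ((β → β) × β)]
  have h5 : M * M' ≤ 8 ^ 10 * 3 * (A.card * D.card) := by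
    calc M * M' ≤ (8 ^ 10 * A.card) * (3 * D.card) := Nat.mul_le_mul h1 h2
      _ = _ := by ring
  have h4' : ((Finset.univ.filter fun w : ((α → α) × α) × ((β → β) × β) =>
      meetTime w.1.1 w.1.2 = meetTime w.2.1 w.2.2).card : ℝ) + (Finset.univ.filter
      fun w : ((α → α) × α) × ((β → β) × β) =>
      ¬ meetTime w.1.1 w.1.2 = meetTime w.2.1 w.2.2).card = M * M' := by exact_mod_cast h4
  have h5' : (M : ℝ) * M' ≤ 8 ^ 10 * 3 * (A.card * D.card) := by exact_mod_cast h5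
  have h3' : (A.card : ℝ) * D.card ≤ (Finset.univ.filter
      fun w : ((α → α) × α) × ((β → β) × β) =>
      ¬ meetTime w.1.1 w.1.2 = meetTime w.2.1 w.2.2).card := by exact_mod_cast h3
  unfold meetBound
  push_cast
  change _ ≤ _ * ((M : ℝ) * M')
  linarith

open scoped Classical in
/-- The probability of equal meeting times is bounded away from `1`. -/
lemma card_meetTime_eq_meetTime_le_meetBound [Nonempty α] [Nonempty β]
    (hβ : 3 ≤ Fintype.card β) :
    ((Finset.univ.filter fun w : ((α → α) × α) × ((β → β) × β) =>
      meetTime w.1.1 w.1.2 = meetTime w.2.1 w.2.2).card : ℝ) ≤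
      meetBound * Fintype.card (((α → α) × α) × ((β → β) × β)) := by
  -- At N = 8^10 the bound 4 N^(-1/10) has come down to 1/2, so from there on it lies below
  -- `meetBound`.
  have aux : ∀ N : ℕ, 8 ^ 10 ≤ N → 4 * (N : ℝ) ^ (-(1 / 10) : ℝ) ≤ meetBound := by
    intro N hN
    have h1 : ((8 : ℝ) ^ 10) ^ (-(1 / 10) : ℝ) = 1 / 8 := by
      rw [← Real.rpow_natCast, ← Real.rpow_mul (by norm_num)]
      norm_num
    have h2 : (N : ℝ) ^ (-(1 / 10) : ℝ) ≤ ((8 : ℝ) ^ 10) ^ (-(1 / 10) : ℝ) :=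
      Real.rpow_le_rpow_of_nonpos (by norm_num) (by exact_mod_cast hN) (by norm_num)
    rw [h1] at h2
    unfold meetBound
    have : (1 : ℝ) / 2 ≤ 1 - 1 / 3 * (1 / 8 ^ 10) := by norm_num
    linarith
  rcases le_total (Fintype.card α) (8 ^ 10) with h | h
  · exact card_meetTime_eq_meetTime_le_of_card_le h hβ
  · refine card_meetTime_eq_meetTime_le.trans ?_
    gcongr
    exact aux _ h

end randomMap

end ProbRoot

namespace ProbRoot

open scoped ENNReal

/-! ### Compatible maps are independent random maps modulo the prime factors -/

section compatible

open Function

/-- The first `i ≥ 1` with `x_i ≡ x_{2i}` modulo `q`. -/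
noncomputable def detTime {n : ℕ} (f : Fin n → Fin n) (x : Fin n) (q : ℕ) : ℕ :=
  sInf {i | 1 ≤ i ∧ (f^[i] x : ℕ) ≡ (f^[2 * i] x : ℕ) [MOD q]}

/-- The map induced by a compatible map on the residues modulo `q`. -/
noncomputable def redMap {n : ℕ} (q : ℕ) (f : Fin n → Fin n) (z : ZMod q) : ZMod q :=
  -- For q ∣ n with q, n ≠ 0 one has z.val < q ≤ n, so the default 0 does not occur in the
  -- applications.
  if h : z.val < n then ((f ⟨z.val, h⟩ : ℕ) : ZMod q) else 0

variable {n q r : ℕ}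

lemma mem_compatibleMaps {f : Fin n → Fin n} :
    f ∈ compatibleMaps n ↔ ∀ d : ℕ, d ∣ n → ∀ a b : Fin n,
      (a : ℕ) ≡ (b : ℕ) [MOD d] → (f a : ℕ) ≡ (f b : ℕ) [MOD d] := by
  classical
  unfold compatibleMaps
  rw [Finset.mem_filter]
  simp

lemma redMap_natCast [NeZero q] (hn : n ≠ 0) (hq : q ∣ n) {f : Fin n → Fin n}
    (hf : f ∈ compatibleMaps n) (a : Fin n) :
    redMap q f ((a : ℕ) : ZMod q) = ((f a : ℕ) : ZMod q) := by
  have hlt : ((a : ℕ) : ZMod q).val < n :=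
    (ZMod.val_lt _).trans_le (Nat.le_of_dvd (Nat.pos_of_ne_zero hn) hq)
  rw [redMap, dif_pos hlt, ZMod.natCast_eq_natCast_iff]
  refine mem_compatibleMaps.1 hf q hq _ _ ?_
  change ((a : ℕ) : ZMod q).val ≡ (a : ℕ) [MOD q]
  rw [ZMod.val_natCast]
  exact Nat.mod_modEq _ _

lemma redMap_iterate [NeZero q] (hn : n ≠ 0) (hq : q ∣ n) {f : Fin n → Fin n}
    (hf : f ∈ compatibleMaps n) (x : Fin n) (i : ℕ) :
    (redMap q f)^[i] ((x : ℕ) : ZMod q) = ((f^[i] x : ℕ) : ZMod q) := by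
  induction i with
  | zero => rfl
  | succ i ih => rw [iterate_succ_apply', ih, redMap_natCast hn hq hf, iterate_succ_apply']

/-- Compatibility makes reduction modulo q commute with iteration, so detecting q is Floyd's meeting
for the induced map. -/
lemma detTime_eq_meetTime [NeZero q] (hn : n ≠ 0) (hq : q ∣ n) {f : Fin n → Fin n}
    (hf : f ∈ compatibleMaps n) (x : Fin n) :
    detTime f x q = meetTime (redMap q f) ((x : ℕ) : ZMod q) := by
  unfold detTime meetTime
  simp_rw [redMap_iterate hn hq hf, ZMod.natCast_eq_natCast_iff]

lemma one_le_detTime [NeZero q] (hn : n ≠ 0) (hq : q ∣ n) {f : Fin n → Fin n}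
    (hf : f ∈ compatibleMaps n) (x : Fin n) : 1 ≤ detTime f x q := by
  rw [detTime_eq_meetTime hn hq hf]
  obtain ⟨l, m, -, -, -, h, -⟩ := exists_tail_cycle (redMap q f) ((x : ℕ) : ZMod q)
  exact h

lemma id_mem_compatibleMaps : id ∈ compatibleMaps n := mem_compatibleMaps.2 fun _ _ _ _ h => h

/-- Translation by a compatible map is what later compares the fibres of the reduction. -/
lemma add_mem_compatibleMaps [NeZero n] {f g : Fin n → Fin n} (hf : f ∈ compatibleMaps n)
    (hg : g ∈ compatibleMaps n) : f + g ∈ compatibleMaps n := by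
  rw [mem_compatibleMaps] at *
  intro d hd a b hab
  rw [Pi.add_apply, Pi.add_apply, Fin.val_add, Fin.val_add]
  have h1 : ∀ m, m % n ≡ m [MOD d] := fun m => (Nat.mod_modEq m n).of_dvd hd
  exact ((h1 _).trans ((hf d hd a b hab).add (hg d hd a b hab))).trans (h1 _).symm

lemma redMap_add [NeZero n] (hq : q ∣ n) [NeZero q] (f g : Fin n → Fin n) :
    redMap q (f + g) = redMap q f + redMap q g := by
  ext z
  have hlt : z.val < n := (ZMod.val_lt _).trans_le (Nat.le_of_dvd (NeZero.pos n) hq)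
  rw [Pi.add_apply, redMap, redMap, redMap, dif_pos hlt, dif_pos hlt, dif_pos hlt, Pi.add_apply,
    Fin.val_add, ← Nat.cast_add, ZMod.natCast_eq_natCast_iff]
  exact (Nat.mod_modEq _ n).of_dvd hq

/-- The reduction of a map and a starting value modulo `q`. -/
noncomputable def redPair (q : ℕ) (w : (Fin n → Fin n) × Fin n) : (ZMod q → ZMod q) × ZMod q :=
  (redMap q w.1, ((w.2 : ℕ) : ZMod q))

lemma redPair_add [NeZero n] (hq : q ∣ n) [NeZero q] (v w : (Fin n → Fin n) × Fin n) :
    redPair q (v + w) = redPair q v + redPair q w := by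
  unfold redPair
  refine Prod.ext (redMap_add hq _ _) ?_
  simp only [Prod.snd_add, Fin.val_add]
  rw [← Nat.cast_add, ZMod.natCast_eq_natCast_iff]
  exact (Nat.mod_modEq _ n).of_dvd hq

/-- Take e ≡ 1 modulo q and e ≡ 0 modulo the part of n prime to q. Then a ↦ e F(a) is compatible for
every F on ℤ/q: if q ∣ d, congruent arguments have equal residues modulo q; if q ∤ d, then d divides
that part and e vanishes modulo d. -/
lemma exists_idempotent (hq : q.Prime) (hn : n ≠ 0) :
    ∃ e : ℕ, e ≡ 1 [MOD q] ∧ (∀ r : ℕ, r.Prime → r ≠ q → r ∣ n → e ≡ 0 [MOD r]) ∧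
      ∀ F : ZMod q → ZMod q, ∀ d, d ∣ n → ∀ a b : ℕ, a ≡ b [MOD d] →
        e * (F a).val ≡ e * (F b).val [MOD d] := by
  set A := n / q ^ n.factorization q with hA
  have hcop : Nat.Coprime q A := Nat.coprime_ordCompl hq hn
  have hAn : q ^ n.factorization q * A = n := Nat.ordProj_mul_ordCompl_eq_self n q
  obtain ⟨e, he1, he2⟩ := Nat.chineseRemainder hcop 1 0
  have hdA : ∀ d, d ∣ n → ¬ q ∣ d → d ∣ A := by
    intro d hd hqd
    rw [← hAn] at hd
    refine Nat.Coprime.dvd_of_dvd_mul_left ?_ hd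
    exact Nat.Coprime.pow_right _ (((Nat.Prime.coprime_iff_not_dvd hq).2 hqd).symm)
  refine ⟨e, he1, ?_, ?_⟩
  · intro r hr hrq hrn
    exact he2.of_dvd (hdA r hrn fun h => hrq ((Nat.prime_dvd_prime_iff_eq hq hr).1 h).symm)
  · intro F d hd a b hab
    by_cases hqd : q ∣ d
    · rw [(ZMod.natCast_eq_natCast_iff a b q).2 (hab.of_dvd hqd)]
    · have h0 : e ≡ 0 [MOD d] := he2.of_dvd (hdA d hd hqd)
      have h1 := h0.mul_right (F a).val
      have h2 := h0.mul_right (F b).val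
      rw [zero_mul] at h1 h2
      exact h1.trans h2.symm

/-- With the two multipliers e and e' the map e F(a) + e' G(a) reduces to F modulo q and to G modulo
r. -/
lemma exists_redPair_eq (hq : q.Prime) (hr : r.Prime) (hqr : q ≠ r) (hn : n ≠ 0) (hqn : q ∣ n)
    (hrn : r ∣ n) (u : (ZMod q → ZMod q) × ZMod q) (v : (ZMod r → ZMod r) × ZMod r) :
    ∃ w ∈ compatibleMaps n ×ˢ (Finset.univ : Finset (Fin n)), redPair q w = u ∧ redPair r w = v := by
  have : NeZero n := ⟨hn⟩
  have : NeZero q := ⟨hq.ne_zero⟩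
  have : NeZero r := ⟨hr.ne_zero⟩
  obtain ⟨e, he1, he0, he⟩ := exists_idempotent hq hn
  obtain ⟨e', he1', he0', he'⟩ := exists_idempotent hr hn
  obtain ⟨x, hx, hx'⟩ := Nat.chineseRemainder ((Nat.coprime_primes hq hr).2 hqr) u.2.val v.2.val
  set f : Fin n → Fin n := fun a =>
    Fin.ofNat n (e * (u.1 ((a : ℕ) : ZMod q)).val + e' * (v.1 ((a : ℕ) : ZMod r)).val) with hf
  have hval : ∀ m, ((Fin.ofNat n m : Fin n) : ℕ) = m % n := fun m => rfl
  refine ⟨(f, Fin.ofNat n x), ?_, ?_, ?_⟩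
  · rw [Finset.mem_product]
    refine ⟨mem_compatibleMaps.2 ?_, Finset.mem_univ _⟩
    intro d hd a b hab
    change (Fin.ofNat n _ : Fin n).val ≡ (Fin.ofNat n _ : Fin n).val [MOD d]
    rw [hval, hval]
    have h1 : ∀ m, m % n ≡ m [MOD d] := fun m => (Nat.mod_modEq m n).of_dvd hd
    exact ((h1 _).trans ((he u.1 d hd a b hab).add (he' v.1 d hd a b hab))).trans (h1 _).symm
  · refine Prod.ext ?_ ?_
    · ext z
      have hlt : z.val < n := (ZMod.val_lt _).trans_le (Nat.le_of_dvd (NeZero.pos n) hqn)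
      simp only [redPair, redMap]
      rw [dif_pos hlt]
      simp only [hf]
      rw [hval, (ZMod.natCast_eq_natCast_iff _ _ q).2 ((Nat.mod_modEq _ n).of_dvd hqn)]
      push_cast
      rw [ZMod.natCast_zmod_val, ZMod.natCast_zmod_val]
      have h1 : (e : ZMod q) = (1 : ℕ) := (ZMod.natCast_eq_natCast_iff _ _ q).2 he1
      have h2 : (e' : ZMod q) = (0 : ℕ) :=
        (ZMod.natCast_eq_natCast_iff _ _ q).2 (he0' q hq hqr hqn)
      rw [h1, h2]
      simp
    · simp only [redPair]
      rw [hval, (ZMod.natCast_eq_natCast_iff _ _ q).2 ((Nat.mod_modEq _ n).of_dvd hqn),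
        (ZMod.natCast_eq_natCast_iff _ _ q).2 hx, ZMod.natCast_zmod_val]
  · refine Prod.ext ?_ ?_
    · ext z
      have hlt : z.val < n := (ZMod.val_lt _).trans_le (Nat.le_of_dvd (NeZero.pos n) hrn)
      simp only [redPair, redMap]
      rw [dif_pos hlt]
      simp only [hf]
      rw [hval, (ZMod.natCast_eq_natCast_iff _ _ r).2 ((Nat.mod_modEq _ n).of_dvd hrn)]
      push_cast
      rw [ZMod.natCast_zmod_val, ZMod.natCast_zmod_val]
      have h1 : (e' : ZMod r) = (1 : ℕ) := (ZMod.natCast_eq_natCast_iff _ _ r).2 he1'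
      have h2 : (e : ZMod r) = (0 : ℕ) :=
        (ZMod.natCast_eq_natCast_iff _ _ r).2 (he0 r hr hqr.symm hrn)
      rw [h1, h2]
      simp
    · simp only [redPair]
      rw [hval, (ZMod.natCast_eq_natCast_iff _ _ r).2 ((Nat.mod_modEq _ n).of_dvd hrn),
        (ZMod.natCast_eq_natCast_iff _ _ r).2 hx', ZMod.natCast_zmod_val]

/-- A uniformly random compatible map and starting value induce independent, uniformly random
maps and starting values modulo two distinct prime factors. -/
lemma card_mul_sum_redPair (hq : q.Prime) (hr : r.Prime) (hqr : q ≠ r) (hn : n ≠ 0) (hqn : q ∣ n)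
    (hrn : r ∣ n) [Fintype (ZMod q)] [Fintype (ZMod r)]
    (F : ((ZMod q → ZMod q) × ZMod q) × ((ZMod r → ZMod r) × ZMod r) → ℝ) :
    (Fintype.card (((ZMod q → ZMod q) × ZMod q) × ((ZMod r → ZMod r) × ZMod r)) : ℝ) *
      ∑ w ∈ compatibleMaps n ×ˢ (Finset.univ : Finset (Fin n)), F (redPair q w, redPair r w) =
    ((compatibleMaps n ×ˢ (Finset.univ : Finset (Fin n))).card : ℝ) * ∑ u, F u := by
  classical
  have : NeZero n := ⟨hn⟩
  have : NeZero q := ⟨hq.ne_zero⟩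
  have : NeZero r := ⟨hr.ne_zero⟩
  set Ω := compatibleMaps n ×ˢ (Finset.univ : Finset (Fin n)) with hΩ
  set π : (Fin n → Fin n) × Fin n →
    ((ZMod q → ZMod q) × ZMod q) × ((ZMod r → ZMod r) × ZMod r) :=
    fun w => (redPair q w, redPair r w) with hπ
  -- Adding a preimage d of v - u maps the fibre over u injectively into the fibre over v. Hence all
  -- fibres have the same size and the reduction is uniform.
  have hle : ∀ u v, (Ω.filter fun w => π w = u).card ≤ (Ω.filter fun w => π w = v).card := by
    intro u v
    obtain ⟨d, hd, hd1, hd2⟩ := exists_redPair_eq hq hr hqr hn hqn hrn (v - u).1 (v - u).2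
    refine Finset.card_le_card_of_injOn (fun w => w + d) ?_ (fun _ _ _ _ h => add_right_cancel h)
    intro w hw
    rw [Finset.mem_coe, Finset.mem_filter, hΩ, Finset.mem_product] at hw ⊢
    rw [Finset.mem_product] at hd
    refine ⟨⟨add_mem_compatibleMaps hw.1.1 hd.1, Finset.mem_univ _⟩, ?_⟩
    rw [← hw.2] at hd1 hd2
    simp only [hπ]
    rw [redPair_add hqn, redPair_add hrn, hd1, hd2]
    simp [hπ]
  have heq : ∀ u v, (Ω.filter fun w => π w = u).card = (Ω.filter fun w => π w = v).card :=
    fun u v => le_antisymm (hle u v) (hle v u)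
  have hfib : ∀ G : ((ZMod q → ZMod q) × ZMod q) × ((ZMod r → ZMod r) × ZMod r) → ℝ,
      ∑ w ∈ Ω, G (π w) = ∑ u, ((Ω.filter fun w => π w = u).card : ℝ) * G u := by
    intro G
    rw [← Finset.sum_fiberwise (s := Ω) (g := π)]
    refine Finset.sum_congr rfl fun u _ => ?_
    rw [Finset.sum_congr rfl fun w hw => by rw [(Finset.mem_filter.1 hw).2], Finset.sum_const,
      nsmul_eq_mul]
  set c := (Ω.filter fun w => π w = 0).card with hc
  have h1 : ∑ w ∈ Ω, F (π w) = c * ∑ u, F u := by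
    rw [hfib, Finset.mul_sum]
    exact Finset.sum_congr rfl fun u _ => by rw [heq u 0]
  have h2 : (Ω.card : ℝ) = c * Fintype.card
      (((ZMod q → ZMod q) × ZMod q) × ((ZMod r → ZMod r) × ZMod r)) := by
    have := hfib fun _ => 1
    rw [Finset.sum_const, nsmul_eq_mul, mul_one] at this
    rw [this, Finset.sum_congr rfl fun u _ => by rw [heq u 0, mul_one], Finset.sum_const,
      nsmul_eq_mul, Finset.card_univ, mul_comm]
  change _ * ∑ w ∈ Ω, F (π w) = _
  rw [h1, h2]
  ring

lemma compatible_nonempty (hn : n ≠ 0) :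
    (compatibleMaps n ×ˢ (Finset.univ : Finset (Fin n))).Nonempty :=
  ⟨(id, ⟨0, Nat.pos_of_ne_zero hn⟩), Finset.mem_product.2 ⟨id_mem_compatibleMaps, Finset.mem_univ _⟩⟩

/-- The expected detection time of a prime `q`. -/
lemma mean_detTime_le (hq : q.Prime) (hr : r.Prime) (hqr : q ≠ r) (hn : n ≠ 0) (hqn : q ∣ n)
    (hrn : r ∣ n) :
    ((compatibleMaps n ×ˢ (Finset.univ : Finset (Fin n))).card : ℝ≥0∞)⁻¹ *
      ∑ w ∈ compatibleMaps n ×ˢ (Finset.univ : Finset (Fin n)), (detTime w.1 w.2 q : ℝ≥0∞) ≤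
    ENNReal.ofReal (2 * √q) := by
  classical
  have : NeZero q := ⟨hq.ne_zero⟩
  have : NeZero r := ⟨hr.ne_zero⟩
  have hcard0 := (compatible_nonempty hn).card_pos
  set Ω := compatibleMaps n ×ˢ (Finset.univ : Finset (Fin n)) with hΩ
  have h1 := card_mul_sum_redPair hq hr hqr hn hqn hrn fun u => (meetTime u.1.1 u.1.2 : ℝ)
  have h2 : ∑ w ∈ Ω, (meetTime (redPair q w).1 (redPair q w).2 : ℝ) =
      ∑ w ∈ Ω, (detTime w.1 w.2 q : ℝ) := by
    refine Finset.sum_congr rfl fun w hw => ?_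
    rw [hΩ, Finset.mem_product] at hw
    rw [detTime_eq_meetTime hn hqn hw.1]
    rfl
  rw [h2] at h1
  have h3 := sum_meetTime_le (α := ZMod q)
  rw [ZMod.card] at h3
  have h5 : ∑ u : ((ZMod q → ZMod q) × ZMod q) × ((ZMod r → ZMod r) × ZMod r),
      (meetTime u.1.1 u.1.2 : ℝ) = Fintype.card ((ZMod r → ZMod r) × ZMod r) *
        ∑ u : (ZMod q → ZMod q) × ZMod q, (meetTime u.1 u.2 : ℝ) := by
    rw [← Finset.univ_product_univ, Finset.sum_product_right]
    simp only [Finset.sum_const, nsmul_eq_mul, Finset.card_univ]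
  rw [h5] at h1
  rw [Fintype.card_prod ((ZMod q → ZMod q) × ZMod q)] at h1
  set M := Fintype.card ((ZMod q → ZMod q) × ZMod q)
  set M' := Fintype.card ((ZMod r → ZMod r) × ZMod r)
  have hM : (0 : ℝ) < M := by exact_mod_cast Fintype.card_pos
  have hM' : (0 : ℝ) < M' := by exact_mod_cast Fintype.card_pos
  have hΩ0 : (0 : ℝ) < Ω.card := by exact_mod_cast hcard0
  have h4 : ∑ w ∈ Ω, (detTime w.1 w.2 q : ℝ) ≤ Ω.card * (2 * √q) := by
    refine le_of_mul_le_mul_left (a := (M : ℝ) * M') ?_ (by positivity)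
    push_cast at h1
    rw [h1]
    calc _ ≤ (Ω.card : ℝ) * (M' * (2 * √q * M)) := by gcongr
      _ = _ := by ring
  rw [ENNReal.inv_mul_le_iff (by exact_mod_cast hcard0.ne') (ENNReal.natCast_ne_top _)]
  rw [← ENNReal.ofReal_natCast Ω.card, ← ENNReal.ofReal_mul (by positivity)]
  refine le_trans (le_of_eq ?_) (ENNReal.ofReal_le_ofReal h4)
  rw [ENNReal.ofReal_sum_of_nonneg fun _ _ => by positivity]
  simp

/-- The bound for the probability that a prime `q` is detected together with a given other one. -/
noncomputable def togetherBound (q : ℕ) : ℝ := min meetBound (4 * (q : ℝ) ^ (-(1 / 10) : ℝ))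

/-- The probability that two primes are detected at the same time. -/
lemma mean_detTime_eq_le (hq : q.Prime) (hr : r.Prime) (hqr : q ≠ r) (hr2 : r ≠ 2)
    (hn : n ≠ 0) (hqn : q ∣ n) (hrn : r ∣ n) :
    ((compatibleMaps n ×ˢ (Finset.univ : Finset (Fin n))).card : ℝ≥0∞)⁻¹ *
      ∑ w ∈ compatibleMaps n ×ˢ (Finset.univ : Finset (Fin n)),
        (if detTime w.1 w.2 r = detTime w.1 w.2 q then 1 else 0 : ℝ≥0∞) ≤
    ENNReal.ofReal (togetherBound q) := by
  classical
  have : NeZero q := ⟨hq.ne_zero⟩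
  have : NeZero r := ⟨hr.ne_zero⟩
  have hr3 : 3 ≤ Fintype.card (ZMod r) := by
    rw [ZMod.card]
    have := hr.two_le
    omega
  have hcard0 := (compatible_nonempty hn).card_pos
  set Ω := compatibleMaps n ×ˢ (Finset.univ : Finset (Fin n)) with hΩ
  have h1 := card_mul_sum_redPair hq hr hqr hn hqn hrn fun u =>
    if meetTime u.1.1 u.1.2 = meetTime u.2.1 u.2.2 then 1 else 0
  have h2 : (∑ w ∈ Ω, if meetTime (redPair q w).1 (redPair q w).2 =
      meetTime (redPair r w).1 (redPair r w).2 then (1 : ℝ) else 0) =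
      ∑ w ∈ Ω, if detTime w.1 w.2 r = detTime w.1 w.2 q then (1 : ℝ) else 0 := by
    refine Finset.sum_congr rfl fun w hw => ?_
    rw [hΩ, Finset.mem_product] at hw
    rw [detTime_eq_meetTime hn hqn hw.1, detTime_eq_meetTime hn hrn hw.1]
    exact if_congr eq_comm rfl rfl
  rw [h2] at h1
  have h3 : (∑ u : ((ZMod q → ZMod q) × ZMod q) × ((ZMod r → ZMod r) × ZMod r),
      if meetTime u.1.1 u.1.2 = meetTime u.2.1 u.2.2 then (1 : ℝ) else 0) ≤ togetherBound q *
        Fintype.card (((ZMod q → ZMod q) × ZMod q) × ((ZMod r → ZMod r) × ZMod r)) := by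
    have h4 := card_meetTime_eq_meetTime_le (α := ZMod q) (β := ZMod r)
    have h5 := card_meetTime_eq_meetTime_le_meetBound (α := ZMod q) (β := ZMod r) hr3
    rw [Finset.card_filter] at h4 h5
    push_cast at h4 h5
    rw [ZMod.card] at h4
    unfold togetherBound
    rw [min_mul_of_nonneg _ _ (by positivity)]
    refine le_min ?_ ?_
    · convert h5
    · convert h4
  set M := Fintype.card (((ZMod q → ZMod q) × ZMod q) × ((ZMod r → ZMod r) × ZMod r))
  have hM : (0 : ℝ) < M := by exact_mod_cast Fintype.card_pos
  have hΩ0 : (0 : ℝ) < Ω.card := by exact_mod_cast hcard0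
  have h4 : (∑ w ∈ Ω, if detTime w.1 w.2 r = detTime w.1 w.2 q then (1 : ℝ) else 0) ≤
      Ω.card * togetherBound q := by
    refine le_of_mul_le_mul_left (a := (M : ℝ)) ?_ hM
    rw [h1]
    calc _ ≤ (Ω.card : ℝ) * (togetherBound q * M) := by gcongr
      _ = _ := by ring
  rw [ENNReal.inv_mul_le_iff (by exact_mod_cast hcard0.ne') (ENNReal.natCast_ne_top _)]
  rw [← ENNReal.ofReal_natCast Ω.card, ← ENNReal.ofReal_mul (by positivity)]
  refine le_trans (le_of_eq ?_) (ENNReal.ofReal_le_ofReal h4)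
  rw [ENNReal.ofReal_sum_of_nonneg fun _ _ => by split_ifs <;> norm_num]
  refine Finset.sum_congr rfl fun w _ => ?_
  split_ifs <;> simp

end compatible

end ProbRoot

namespace ProbRoot

open scoped ENNReal
open State

/-! ### Splitting off detected primes -/

section strip

variable {m g : ℕ}

lemma strip_dvd : strip m g ∣ m := Nat.div_dvd_of_dvd (Nat.gcd_dvd_left _ _)

lemma strip_ne_zero (hm : m ≠ 0) : strip m g ≠ 0 := ne_zero_of_dvd_ne_zero hm strip_dvd

/-- The exponent of q in m is less than the binary length of m, so the power g^size contains q at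
least as often as m whenever q ∣ g. -/
lemma factorization_strip (hm : m ≠ 0) (hg : g ≠ 0) (q : ℕ) :
    (strip m g).factorization q = if q ∣ g then 0 else m.factorization q := by
  by_cases hq : q.Prime
  swap
  · simp [Nat.factorization_eq_zero_of_not_prime _ hq]
  have hgs : g ^ m.size ≠ 0 := pow_ne_zero _ hg
  unfold strip
  rw [Nat.factorization_div (Nat.gcd_dvd_left _ _), Nat.factorization_gcd hm hgs,
    Finsupp.tsub_apply, Finsupp.inf_apply, Nat.factorization_pow, Finsupp.smul_apply, smul_eq_mul]
  split_ifs with h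
  · have h1 : m.factorization q < m.size :=
      Nat.lt_size.2 ((Nat.pow_le_pow_left hq.two_le _).trans
        (Nat.le_of_dvd (Nat.pos_of_ne_zero hm) (Nat.ordProj_dvd m q)))
    have h2 := hq.factorization_pos_of_dvd hg h
    have h3 : m.size ≤ m.size * g.factorization q := Nat.le_mul_of_pos_right _ h2
    rw [min_eq_left (by omega), Nat.sub_self]
  · rw [Nat.factorization_eq_zero_of_not_dvd h]
    simp

lemma primeFactors_strip (hm : m ≠ 0) (hg : g ≠ 0) :
    (strip m g).primeFactors = m.primeFactors \ g.primeFactors := by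
  ext q
  rw [← Nat.support_factorization, Finsupp.mem_support_iff, factorization_strip hm hg,
    Finset.mem_sdiff, ← Nat.support_factorization m, Finsupp.mem_support_iff]
  by_cases hq : q.Prime
  · split_ifs with h
    · simp [hq, h, hg]
    · simp [h]
  · simp [Nat.factorization_eq_zero_of_not_prime _ hq]

lemma coprime_strip (hm : m ≠ 0) (hg : g ≠ 0) : Nat.Coprime (strip m g) g := by
  rw [← Nat.disjoint_primeFactors (strip_ne_zero hm) hg, primeFactors_strip hm hg]
  exact Finset.sdiff_disjoint

end strip

/-! ### The invariant of the partial factorization -/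

section invariant

variable {p : ℕ} {B : ℝ}

/-- The invariant of the partial factorization: the numbers of `W` are pairwise coprime odd
divisors of `p - 1`, and the primes to be split off are those of `ps` and those dividing a number
of `W`. -/
structure SplitInv (p : ℕ) (B : ℝ) (W ps : List ℕ) (Q : ℕ) : Prop where
  dvd : ∀ n ∈ W, n ∣ p - 1
  odd : ∀ n ∈ W, ¬ 2 ∣ n
  coprime : W.Pairwise Nat.Coprime
  nodup : ps.Nodup
  two_mem : 2 ∈ ps
  mem_small : ∀ q ∈ ps, q ∈ smallPrimes p B
  not_dvd : ∀ q ∈ ps, ∀ n ∈ W, ¬ q ∣ n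
  cover : ∀ q ∈ smallPrimes p B, q ∈ ps ∨ ∃ n ∈ W, q ∣ n
  eq_div : Q = (p - 1) / ∏ q ∈ ps.toFinset, q ^ (p - 1).factorization q

lemma mem_smallPrimes {q : ℕ} :
    q ∈ smallPrimes p B ↔ q ∈ (p - 1).primeFactors ∧ (q = 2 ∨ (q : ℝ) < B) := by
  unfold smallPrimes
  rw [Finset.mem_filter]

variable {W ps : List ℕ} {Q n m g : ℕ}

lemma SplitInv.init (hp : 3 ≤ p) (hodd : Odd p) :
    SplitInv p B [(p - 1) / 2 ^ (p - 1).factorization 2] [2]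
      ((p - 1) / 2 ^ (p - 1).factorization 2) := by
  have h0 : p - 1 ≠ 0 := by omega
  have h2 : 2 ∣ p - 1 := by
    obtain ⟨k, hk⟩ := hodd
    exact ⟨k, by omega⟩
  have hnd := Nat.not_dvd_ordCompl Nat.prime_two h0
  refine ⟨?_, ?_, List.pairwise_singleton _ _, List.nodup_singleton _, List.mem_singleton_self _,
    ?_, ?_, ?_, ?_⟩
  · simpa using Nat.ordCompl_dvd (p - 1) 2
  · simpa using hnd
  · simp only [List.mem_singleton, forall_eq]
    exact mem_smallPrimes.2 ⟨Nat.mem_primeFactors.2 ⟨Nat.prime_two, h2, h0⟩, Or.inl rfl⟩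
  · simpa using hnd
  · intro q hq
    have hq' := (mem_smallPrimes.1 hq).1
    have hqp := Nat.prime_of_mem_primeFactors hq'
    by_cases h : q = 2
    · left; simp [h]
    · right
      refine ⟨_, List.mem_singleton_self _, ?_⟩
      have h1 : q ∣ 2 ^ (p - 1).factorization 2 * ((p - 1) / 2 ^ (p - 1).factorization 2) := by
        rw [Nat.ordProj_mul_ordCompl_eq_self]
        exact Nat.dvd_of_mem_primeFactors hq'
      rcases hqp.dvd_mul.1 h1 with h3 | h3
      · exact absurd ((Nat.prime_dvd_prime_iff_eq hqp Nat.prime_two).1 (hqp.dvd_of_dvd_pow h3)) h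
      · exact h3
  · simp

/-- A discarded number is odd and has no prime below B, so it contained no prime still to be found.
-/
lemma SplitInv.discard (h : SplitInv p B (n :: W) ps Q) (hn : ¬ HasSmallFactor B n) :
    SplitInv p B W ps Q := by
  refine ⟨fun k hk => h.dvd k (List.mem_cons_of_mem _ hk),
    fun k hk => h.odd k (List.mem_cons_of_mem _ hk), (List.pairwise_cons.1 h.coprime).2, h.nodup,
    h.two_mem, h.mem_small, fun q hq k hk => h.not_dvd q hq k (List.mem_cons_of_mem _ hk), ?_,
    h.eq_div⟩
  intro q hq
  rcases h.cover q hq with h1 | ⟨k, hk, hqk⟩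
  · exact Or.inl h1
  · rcases List.mem_cons.1 hk with rfl | hk
    · exfalso
      obtain ⟨h2, h3⟩ := mem_smallPrimes.1 hq
      rcases h3 with rfl | h3
      · exact h.odd k List.mem_cons_self hqk
      · exact hn ⟨q, Nat.prime_of_mem_primeFactors h2, hqk, h3⟩
    · exact Or.inr ⟨k, hk, hqk⟩

lemma minFac_eq_of_isPrimePow (hn : IsPrimePow n) {q : ℕ} (hq : q.Prime) (hqn : q ∣ n) :
    q = n.minFac := by
  rw [isPrimePow_iff_card_primeFactors_eq_one, Finset.card_eq_one] at hn
  obtain ⟨r, hr⟩ := hn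
  have hn0 : n ≠ 0 := by
    rintro rfl
    simp at hr
  have hn1 : n ≠ 1 := by
    rintro rfl
    simp at hr
  have h1 : q ∈ n.primeFactors := Nat.mem_primeFactors.2 ⟨hq, hqn, hn0⟩
  have h2 : n.minFac ∈ n.primeFactors :=
    Nat.mem_primeFactors.2 ⟨Nat.minFac_prime hn1, Nat.minFac_dvd n, hn0⟩
  rw [hr, Finset.mem_singleton] at h1 h2
  rw [h1, h2]

lemma minFac_lt_of_isPrimePow (hn : IsPrimePow n) (hs : HasSmallFactor B n) :
    (n.minFac : ℝ) < B := by
  obtain ⟨q, hq, hqn, hqB⟩ := hs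
  rwa [← minFac_eq_of_isPrimePow hn hq hqn]

lemma SplitInv.primePow (hp : 2 ≤ p) (h : SplitInv p B (n :: W) ps Q) (hs : HasSmallFactor B n)
    (hn : IsPrimePow n) :
    SplitInv p B W (n.minFac :: ps) (Q / n.minFac ^ (p - 1).factorization n.minFac) := by
  have hnp := h.dvd n List.mem_cons_self
  have hqp : n.minFac.Prime := Nat.minFac_prime hn.one_lt.ne'
  have hqn := Nat.minFac_dvd n
  have hqps : n.minFac ∉ ps := fun hq => h.not_dvd _ hq n List.mem_cons_self hqn
  have hcop := List.pairwise_cons.1 h.coprime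
  refine ⟨fun k hk => h.dvd k (List.mem_cons_of_mem _ hk),
    fun k hk => h.odd k (List.mem_cons_of_mem _ hk), hcop.2, List.nodup_cons.2 ⟨hqps, h.nodup⟩,
    List.mem_cons_of_mem _ h.two_mem, ?_, ?_, ?_, ?_⟩
  · intro q hq
    rcases List.mem_cons.1 hq with rfl | hq
    · exact mem_smallPrimes.2 ⟨Nat.mem_primeFactors.2 ⟨hqp, hqn.trans hnp, by omega⟩,
        Or.inr (minFac_lt_of_isPrimePow hn hs)⟩
    · exact h.mem_small q hq
  · intro q hq k hk
    rcases List.mem_cons.1 hq with rfl | hq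
    · intro hqk
      exact Nat.not_coprime_of_dvd_of_dvd hqp.one_lt hqn hqk (hcop.1 k hk)
    · exact h.not_dvd q hq k (List.mem_cons_of_mem _ hk)
  · intro q hq
    rcases h.cover q hq with h1 | ⟨k, hk, hqk⟩
    · exact Or.inl (List.mem_cons_of_mem _ h1)
    · rcases List.mem_cons.1 hk with rfl | hk
      · left
        rw [minFac_eq_of_isPrimePow hn
          (Nat.prime_of_mem_primeFactors (mem_smallPrimes.1 hq).1) hqk]
        exact List.mem_cons_self
      · exact Or.inr ⟨k, hk, hqk⟩
  · rw [h.eq_div, Nat.div_div_eq_div_mul, List.toFinset_cons, Finset.prod_insert, mul_comm]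
    rwa [List.mem_toFinset]

/-- Every prime of m divides g or survives in `strip m g`, and these two are coprime; divisors of m
inherit the remaining conditions. -/
lemma SplitInv.split (hp : 2 ≤ p) (h : SplitInv p B (m :: W) ps Q) (hg : g ∣ m) :
    SplitInv p B (strip m g :: g :: W) ps Q := by
  have hm := h.dvd m List.mem_cons_self
  have hm0 : m ≠ 0 := ne_zero_of_dvd_ne_zero (by omega) hm
  have hg0 : g ≠ 0 := ne_zero_of_dvd_ne_zero hm0 hg
  have hcop := List.pairwise_cons.1 h.coprime
  have aux : ∀ P : ℕ → Prop, (∀ k, k ∣ m → P k) → (∀ k ∈ W, P k) →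
      ∀ k ∈ strip m g :: g :: W, P k := by
    intro P h1 h2 k hk
    rcases List.mem_cons.1 hk with rfl | hk
    · exact h1 _ strip_dvd
    rcases List.mem_cons.1 hk with rfl | hk
    · exact h1 _ hg
    · exact h2 _ hk
  refine ⟨aux _ (fun k hk => hk.trans hm) fun k hk => h.dvd k (List.mem_cons_of_mem _ hk),
    aux _ (fun k hk h2 => h.odd m List.mem_cons_self (h2.trans hk))
      fun k hk => h.odd k (List.mem_cons_of_mem _ hk), ?_, h.nodup,
    h.two_mem, h.mem_small, fun q hq => aux _
      (fun k hk h2 => h.not_dvd q hq m List.mem_cons_self (h2.trans hk))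
      fun k hk => h.not_dvd q hq k (List.mem_cons_of_mem _ hk), ?_, h.eq_div⟩
  · rw [List.pairwise_cons, List.pairwise_cons]
    refine ⟨?_, fun k hk => (hcop.1 k hk).coprime_dvd_left hg, hcop.2⟩
    intro k hk
    rcases List.mem_cons.1 hk with rfl | hk
    · exact coprime_strip hm0 hg0
    · exact (hcop.1 k hk).coprime_dvd_left strip_dvd
  · intro q hq
    rcases h.cover q hq with h1 | ⟨k, hk, hqk⟩
    · exact Or.inl h1
    · right
      rcases List.mem_cons.1 hk with rfl | hk
      · by_cases hqg : q ∣ g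
        · exact ⟨g, by simp, hqg⟩
        · refine ⟨strip k g, by simp, ?_⟩
          have hqp := Nat.prime_of_mem_primeFactors (mem_smallPrimes.1 hq).1
          have : q ∈ (strip k g).primeFactors := by
            rw [primeFactors_strip hm0 hg0, Finset.mem_sdiff, Nat.mem_primeFactors,
              Nat.mem_primeFactors]
            tauto
          exact Nat.dvd_of_mem_primeFactors this
      · exact ⟨k, by simp [hk], hqk⟩

lemma SplitInv.final (h : SplitInv p B [] ps Q) :
    ps.toFinset = smallPrimes p B ∧ Q = cofactor p B := by
  have h1 : ps.toFinset = smallPrimes p B := by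
    ext q
    rw [List.mem_toFinset]
    refine ⟨h.mem_small q, fun hq => ?_⟩
    rcases h.cover q hq with h1 | ⟨k, hk, -⟩
    · exact h1
    · simp at hk
  refine ⟨h1, ?_⟩
  rw [h.eq_div, h1, cofactor]

end invariant

/-! ### The cost of the random draws -/

section pickCost

/-- Halving the exponent lowers its binary length by one at the price of at most two
multiplications. -/
lemma powMults_le (e : ℕ) : powMults e ≤ 2 * e.size := by
  induction e using Nat.strong_induction_on with
  | _ e ih =>
    cases e with
    | zero => simp [powMults]
    | succ e =>
      rw [powMults]
      have h1 := ih ((e + 1) / 2) (by omega)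
      have h2 : ((e + 1) / 2).size + 1 ≤ (e + 1).size := by
        rw [Nat.succ_le_iff, Nat.lt_size]
        have h3 : ((e + 1) / 2).size = 0 ∨ 0 < ((e + 1) / 2).size := Nat.eq_zero_or_pos _
        rcases h3 with h3 | h3
        · rw [h3]; simp
        · obtain ⟨k, hk⟩ := Nat.exists_eq_succ_of_ne_zero h3.ne'
          have h4 : 2 ^ k ≤ (e + 1) / 2 := Nat.lt_size.1 (by omega)
          rw [hk, pow_succ]
          omega
      omega

lemma powMults_le_of_le {e k : ℕ} (h : e ≤ k) : powMults e ≤ 2 * k.size :=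
  (powMults_le e).trans (Nat.mul_le_mul_left _ (Nat.size_le_size h))

/-- The states in which the partial factorization is not yet complete. -/
def IsSplitting {p : ℕ} : State p → Prop
  | init => True
  | split _ _ _ => True
  | loop _ _ _ _ _ _ _ _ => True
  | _ => False

open scoped Classical in
/-- The number of operations, increased by one during the partial factorization. -/
noncomputable def chargedCost (p : ℕ) (B : ℝ) (s : State p) : ℝ≥0∞ :=
  opCount p B s + if IsSplitting s then 1 else 0

variable {p : ℕ} {B : ℝ}

lemma opCount_le_chargedCost (s : State p) : (opCount p B s : ℝ≥0∞) ≤ chargedCost p B s :=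
  le_self_add

/-- The surcharge also counts steps of zero cost, so a finite cost bound proves that the partial
factorization ends almost surely. -/
lemma one_le_chargedCost {s : State p} (hs : IsSplitting s) : 1 ≤ chargedCost p B s := by
  unfold chargedCost
  rw [if_pos hs]
  exact le_add_self

lemma chargedCost_of_isSplitting {s : State p} (hs : IsSplitting s) :
    chargedCost p B s = opCount p B s + 1 := by
  unfold chargedCost
  rw [if_pos hs]

lemma chargedCost_of_not_isSplitting {s : State p} (hs : ¬ IsSplitting s) :
    chargedCost p B s = opCount p B s := by
  unfold chargedCost
  rw [if_neg hs, add_zero]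

lemma inv_card_mul_sum_add {α : Type} {s : Finset α} (hs : s.Nonempty) (K : ℝ≥0∞)
    (u : α → ℝ≥0∞) :
    (s.card : ℝ≥0∞)⁻¹ * ∑ a ∈ s, (K + u a) = K + (s.card : ℝ≥0∞)⁻¹ * ∑ a ∈ s, u a := by
  rw [Finset.sum_add_distrib, mul_add, Finset.sum_const, nsmul_eq_mul, ← mul_assoc,
    ENNReal.inv_mul_cancel (by simpa using hs.card_pos.ne') (ENNReal.natCast_ne_top _), one_mul]

/-- If at most half of the draws fail and a restart is charged 2D, restarts cost D on average: a
round of cost D then has total cost 2D. -/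
lemma inv_card_mul_sum_ite_le {α : Type} {s : Finset α} (hs : s.Nonempty) (D : ℝ≥0∞)
    (bad : α → Prop) [DecidablePred bad] (h : 2 * (s.filter bad).card ≤ s.card) :
    (s.card : ℝ≥0∞)⁻¹ * ∑ a ∈ s, (if bad a then 2 * D else 0) ≤ D := by
  rw [← Finset.sum_filter, Finset.sum_const, nsmul_eq_mul,
    ENNReal.inv_mul_le_iff (by simpa using hs.card_pos.ne') (ENNReal.natCast_ne_top _), ← mul_assoc]
  gcongr
  rw [mul_comm]
  exact_mod_cast h

lemma costUpTo_done_eq_zero (T : ℕ) (g : ZMod p) (c : ℝ) :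
    costUpTo p B (chargedCost p B) T (done g c) = 0 := by
  induction T with
  | zero => exact costUpTo_zero _ _
  | succ T ih =>
    rw [costUpTo_succ, step, mean_pure, ih, chargedCost_of_not_isSplitting (s := done g c) id, opCount]
    simp

variable [hp : Fact p.Prime]

/-- Exactly the fraction 1/q ≤ 1/2 of the draws is rejected. -/
lemma two_mul_card_filter_pow_eq_one_le {q : ℕ} (hq : q ∣ p - 1) (hq2 : 2 ≤ q)
    [DecidablePred fun b : ℕ => (b : ZMod p) ^ ((p - 1) / q) = 1] :
    2 * ((Finset.Icc 1 (p - 1)).filter fun b : ℕ => (b : ZMod p) ^ ((p - 1) / q) = 1).card ≤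
      (Finset.Icc 1 (p - 1)).card := by
  have h1 := card_filter_pow_ne_one hq
  have h2 := Finset.card_filter_add_card_filter_not (s := Finset.Icc 1 (p - 1))
    (fun b : ℕ => (b : ZMod p) ^ ((p - 1) / q) = 1)
  rw [Nat.card_Icc, Nat.add_sub_cancel] at h2 ⊢
  have h3 : (p - 1) / q * (q - 1) + (p - 1) / q = p - 1 := by
    obtain ⟨q', rfl⟩ := Nat.exists_eq_succ_of_ne_zero (by omega : q ≠ 0)
    rw [Nat.succ_sub_one, ← Nat.mul_succ, Nat.div_mul_cancel hq]
  have h4 : (p - 1) / q ≤ (p - 1) / q * (q - 1) := Nat.le_mul_of_pos_right _ (by omega)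
  have h5 : ((Finset.Icc 1 (p - 1)).filter fun b : ℕ => ¬ (b : ZMod p) ^ ((p - 1) / q) = 1).card
    = (p - 1) / q * (q - 1) := by convert h1
  omega

lemma costUpTo_pickLast_le {Q : ℕ} (hQ : Q ∣ p - 1) (hQ2 : 2 ≤ Q) (T : ℕ) :
    (∀ a, costUpTo p B (chargedCost p B) T (pickLast a Q) ≤ 2 * ((2 * p.size + 2 : ℕ) : ℝ≥0∞)) ∧
    (∀ b a, costUpTo p B (chargedCost p B) T (testLast b a Q) ≤ ((2 * p.size + 1 : ℕ) : ℝ≥0∞) +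
      if b ^ ((p - 1) / Q) = 1 then 2 * ((2 * p.size + 2 : ℕ) : ℝ≥0∞) else 0) := by
  classical
  induction T with
  | zero =>
    refine ⟨fun a => ?_, fun b a => ?_⟩ <;> rw [costUpTo_zero] <;> exact zero_le
  | succ T ih =>
    refine ⟨fun a => ?_, fun b a => ?_⟩
    · rw [costUpTo_succ, step, mean_draw Icc_one_pred_nonempty,
        chargedCost_of_not_isSplitting (s := pickLast a Q) id, opCount]
      refine (add_le_add le_rfl (mul_le_mul_right (Finset.sum_le_sum fun (b : ℕ) _ => ih.2 (b : ZMod p) a) _)).trans ?_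
      rw [inv_card_mul_sum_add Icc_one_pred_nonempty]
      refine (add_le_add le_rfl (add_le_add le_rfl (inv_card_mul_sum_ite_le Icc_one_pred_nonempty _ _
        (two_mul_card_filter_pow_eq_one_le hQ hQ2)))).trans (le_of_eq ?_)
      push_cast
      ring
    · have hpm : powMults ((p - 1) / Q) ≤ 2 * p.size :=
        powMults_le_of_le ((Nat.div_le_self _ _).trans (Nat.sub_le _ _))
      rw [costUpTo_succ, step, chargedCost_of_not_isSplitting (s := testLast b a Q) id, opCount]
      by_cases h : b ^ ((p - 1) / Q) = 1
      · rw [if_pos h, if_pos h, if_pos h, mean_pure]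
        refine add_le_add ?_ (ih.1 a)
        exact_mod_cast (by omega)
      · rw [if_neg h, if_neg h, if_neg h, mean_pure, costUpTo_done_eq_zero, add_zero, add_zero]
        exact_mod_cast (by omega)

/-- The expected cost of the random draws. -/
lemma costUpTo_pick_le {Q : ℕ} (hQ : Q ∣ p - 1) (hQ2 : Q ≠ 2) (T : ℕ) :
    (∀ ps a, (∀ q ∈ ps, q.Prime ∧ q ∣ p - 1) →
      costUpTo p B (chargedCost p B) T (pick ps a Q) ≤
        2 * ((4 * p.size + 2 : ℕ) : ℝ≥0∞) * (ps.length + 1)) ∧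
    (∀ q ps α a, (∀ r ∈ ps, r.Prime ∧ r ∣ p - 1) →
      costUpTo p B (chargedCost p B) T (test α (q :: ps) a Q) ≤
        2 * ((4 * p.size + 2 : ℕ) : ℝ≥0∞) * (ps.length + 1) + ((4 * p.size + 1 : ℕ) : ℝ≥0∞) +
      if α ^ ((p - 1) / q) = 1 then
        -- The value ∞ makes the claim vacuous when a failed test concerns an inadmissible q, so
        -- that no hypothesis on q is needed here.
        (if q.Prime ∧ q ∣ p - 1 then 2 * ((4 * p.size + 2 : ℕ) : ℝ≥0∞) else ∞) else 0) := by
  classical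
  have hp2 := hp.out.two_le
  induction T with
  | zero =>
    refine ⟨fun a => ?_, fun b a => ?_⟩ <;> intros <;> rw [costUpTo_zero] <;> exact zero_le
  | succ T ih =>
    refine ⟨fun ps a hps => ?_, fun q ps α a hps => ?_⟩
    · cases ps with
      | nil =>
        rw [costUpTo_succ, step, chargedCost_of_not_isSplitting (s := pick [] a Q) id, opCount]
        by_cases h : Q = 1
        · rw [if_pos h, mean_pure, costUpTo_done_eq_zero]
          simp
        · have hQ0 : Q ≠ 0 := by
            rintro rfl
            have := Nat.eq_zero_of_zero_dvd hQ
            omega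
          rw [if_neg h, mean_pure, Nat.cast_zero, zero_add]
          refine ((costUpTo_pickLast_le hQ (by omega) T).1 a).trans ?_
          simp only [List.length_nil, Nat.cast_zero, zero_add, mul_one]
          gcongr
          omega
      | cons q ps =>
        obtain ⟨hq, hqd⟩ := hps q List.mem_cons_self
        have hps' : ∀ r ∈ ps, r.Prime ∧ r ∣ p - 1 := fun r hr => hps r (List.mem_cons_of_mem _ hr)
        rw [costUpTo_succ, step, mean_draw Icc_one_pred_nonempty,
          chargedCost_of_not_isSplitting (s := pick (q :: ps) a Q) id, opCount]
        refine (add_le_add le_rfl (mul_le_mul_right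
          (Finset.sum_le_sum fun (b : ℕ) _ => ih.2 q ps (b : ZMod p) a hps') _)).trans ?_
        simp only [hq, hqd, and_self, if_true]
        rw [inv_card_mul_sum_add Icc_one_pred_nonempty]
        refine (add_le_add le_rfl (add_le_add le_rfl (inv_card_mul_sum_ite_le Icc_one_pred_nonempty
          _ _ (two_mul_card_filter_pow_eq_one_le hqd hq.two_le)))).trans (le_of_eq ?_)
        push_cast [List.length_cons]
        ring
    · have hpm : powMults ((p - 1) / q) ≤ 2 * p.size :=
        powMults_le_of_le ((Nat.div_le_self _ _).trans (Nat.sub_le _ _))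
      have hpm' : powMults ((p - 1) / q ^ (p - 1).factorization q) ≤ 2 * p.size :=
        powMults_le_of_le ((Nat.div_le_self _ _).trans (Nat.sub_le _ _))
      rw [costUpTo_succ, step, chargedCost_of_not_isSplitting (s := test α (q :: ps) a Q) id, opCount]
      by_cases h : α ^ ((p - 1) / q) = 1
      · rw [if_pos h, if_pos h, if_pos h, mean_pure]
        by_cases hq : q.Prime ∧ q ∣ p - 1
        · rw [if_pos hq]
          have h1 := ih.1 (q :: ps) a (by
            intro r hr
            rcases List.mem_cons.1 hr with rfl | hr
            · exact hq
            · exact hps r hr)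
          refine (add_le_add (?_ : _ ≤ ((4 * p.size + 1 : ℕ) : ℝ≥0∞)) h1).trans (le_of_eq ?_)
          · exact_mod_cast (by omega)
          · push_cast [List.length_cons]
            ring
        · rw [if_neg hq]
          simp
      · rw [if_neg h, if_neg h, if_neg h, mean_pure, add_zero, add_comm]
        refine add_le_add (ih.1 ps _ hps) ?_
        exact_mod_cast (by omega)

end pickCost

end ProbRoot

namespace ProbRoot

open scoped ENNReal
open State

/-! ### The expected cost of the partial factorization -/

section potential

open scoped Classical in
/-- The prime factors of `n` below `B`. -/
noncomputable def smallFactors (B : ℝ) (n : ℕ) : Finset ℕ :=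
  n.primeFactors.filter fun q => (q : ℝ) < B

/-- The weight with which a prime `q` that is one of `k` prime factors of a number counts. -/
noncomputable def growth (q k : ℕ) : ℝ≥0∞ :=
  -- The first term is the run now due if q has company; the second charges γ = τ/(1 - μ) further
  -- runs for each of the k - 1 companions.
  (if 1 < k then 1 else 0) +
    ENNReal.ofReal (togetherBound q / (1 - meetBound)) * ((k - 1 : ℕ) : ℝ≥0∞)

/-- The number of operations charged to the detection of a factor. -/
def hitCost (p : ℕ) : ℕ := 2 * p.size.size + 4

/-- The expected number of operations of a run charged to the prime `q`. -/
noncomputable def runCost (p q : ℕ) : ℝ≥0∞ :=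
  -- Five units per loop (four operations and the surcharge) times the mean detection time 2√q; then
  -- a constant for leaving the run, and the possible hits.
  ENNReal.ofReal (10 * √q) + 3 + (p - 1).primeFactors.card * hitCost p

/-- The expected number of operations charged to the prime `q`, one of `k` prime factors of a number
of the list. -/
noncomputable def primeCost (p q k : ℕ) : ℝ≥0∞ :=
  (p - 1).factorization q + runCost p q * growth q k

/-- The expected number of operations charged to a number of the list. -/
noncomputable def itemCost (p : ℕ) (B : ℝ) (n : ℕ) : ℝ≥0∞ :=
  2 + ∑ q ∈ smallFactors B n, primeCost p q n.primeFactors.card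

/-- The number of prime factors of `m` detected together with `q`. -/
noncomputable def together {n : ℕ} (f : Fin n → Fin n) (x : Fin n) (m q : ℕ) : ℕ :=
  (m.primeFactors.filter fun r => detTime f x r = detTime f x q).card

/-- The expected number of operations charged to the rest of a run after `i` loops. -/
noncomputable def loopCost (p : ℕ) (B : ℝ) {n : ℕ} (f : Fin n → Fin n) (x : Fin n) (i m : ℕ) :
    ℝ≥0∞ :=
  -- The 1 pays for leaving the loop. The remaining loops are bounded by the sum, rather than the
  -- maximum, of the remaining detection times. Each hit removes a prime from m, and each small
  -- prime will be listed along with precisely the primes detected in the same loop.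
  1 + 5 * ∑ q ∈ smallFactors B m, ((detTime f x q - i : ℕ) : ℝ≥0∞) +
    m.primeFactors.card * hitCost p + ∑ q ∈ smallFactors B m, primeCost p q (together f x m q)

variable {p : ℕ} {B : ℝ} {m n g : ℕ}

lemma mem_smallFactors {q : ℕ} : q ∈ smallFactors B n ↔ q ∈ n.primeFactors ∧ (q : ℝ) < B := by
  unfold smallFactors
  rw [Finset.mem_filter]

lemma hasSmallFactor_iff (hn : n ≠ 0) : HasSmallFactor B n ↔ (smallFactors B n).Nonempty := by
  constructor
  · rintro ⟨q, hq, hqn, hqB⟩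
    exact ⟨q, mem_smallFactors.2 ⟨Nat.mem_primeFactors.2 ⟨hq, hqn, hn⟩, hqB⟩⟩
  · rintro ⟨q, hq⟩
    obtain ⟨h1, h2⟩ := mem_smallFactors.1 hq
    exact ⟨q, Nat.prime_of_mem_primeFactors h1, Nat.dvd_of_mem_primeFactors h1, h2⟩

lemma togetherBound_nonneg (q : ℕ) : 0 ≤ togetherBound q :=
  le_min meetBound_pos.le (by positivity)

lemma growth_le (q k : ℕ) :
    growth q k ≤ ENNReal.ofReal (1 + togetherBound q / (1 - meetBound)) * ((k - 1 : ℕ) : ℝ≥0∞) := by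
  have h0 := togetherBound_nonneg q
  have h1 : 0 < 1 - meetBound := by linarith [meetBound_lt_one]
  rw [ENNReal.ofReal_add zero_le_one (by positivity), ENNReal.ofReal_one, add_mul, one_mul]
  refine add_le_add ?_ le_rfl
  split_ifs with h
  · have : 1 ≤ k - 1 := by omega
    exact_mod_cast this
  · exact zero_le

/-- As a sum of indicators over the other primes, the number of companions has an expectation
computable from pairs. -/
lemma together_sub_one {q : ℕ} {f : Fin n → Fin n} {x : Fin n} (hq : q ∈ m.primeFactors) :
    together f x m q - 1 =
      ∑ r ∈ m.primeFactors.erase q, if detTime f x r = detTime f x q then 1 else 0 := by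
  unfold together
  rw [← Finset.card_filter, Finset.filter_erase, Finset.card_erase_of_mem]
  exact Finset.mem_filter.2 ⟨hq, rfl⟩

/-- The expected weight of a prime after a run is at most the increment of its weight. -/
lemma mean_growth_le {q : ℕ} (hn : n ≠ 0) (hodd : ¬ 2 ∣ n) (hq : q ∈ n.primeFactors) :
    ((compatibleMaps n ×ˢ (Finset.univ : Finset (Fin n))).card : ℝ≥0∞)⁻¹ *
      ∑ w ∈ compatibleMaps n ×ˢ (Finset.univ : Finset (Fin n)), growth q (together w.1 w.2 n q) ≤
    ENNReal.ofReal (togetherBound q / (1 - meetBound)) *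
      ((n.primeFactors.card - 1 : ℕ) : ℝ≥0∞) := by
  set Ω := compatibleMaps n ×ˢ (Finset.univ : Finset (Fin n)) with hΩ
  set c := ENNReal.ofReal (1 + togetherBound q / (1 - meetBound)) with hc
  have h0 := togetherBound_nonneg q
  have h1 : 0 < 1 - meetBound := by linarith [meetBound_lt_one]
  have hqp := Nat.prime_of_mem_primeFactors hq
  calc (Ω.card : ℝ≥0∞)⁻¹ * ∑ w ∈ Ω, growth q (together w.1 w.2 n q)
      ≤ (Ω.card : ℝ≥0∞)⁻¹ * ∑ w ∈ Ω, c * ∑ r ∈ n.primeFactors.erase q,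
          (if detTime w.1 w.2 r = detTime w.1 w.2 q then 1 else 0 : ℝ≥0∞) := by
        refine mul_le_mul_right (Finset.sum_le_sum fun w _ => (growth_le _ _).trans (le_of_eq ?_)) _
        rw [together_sub_one hq]
        push_cast
        rfl
    _ = c * ∑ r ∈ n.primeFactors.erase q, (Ω.card : ℝ≥0∞)⁻¹ * ∑ w ∈ Ω,
          (if detTime w.1 w.2 r = detTime w.1 w.2 q then 1 else 0 : ℝ≥0∞) := by
        rw [← Finset.mul_sum, ← Finset.mul_sum, Finset.sum_comm]
        ring
    _ ≤ c * ∑ r ∈ n.primeFactors.erase q, ENNReal.ofReal (togetherBound q) := by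
        refine mul_le_mul_right (Finset.sum_le_sum fun r hr => ?_) _
        rw [Finset.mem_erase] at hr
        have hrp := Nat.prime_of_mem_primeFactors hr.2
        refine mean_detTime_eq_le hqp hrp hr.1.symm ?_ hn (Nat.dvd_of_mem_primeFactors hq)
          (Nat.dvd_of_mem_primeFactors hr.2)
        rintro rfl
        exact hodd (Nat.dvd_of_mem_primeFactors hr.2)
    _ = c * ENNReal.ofReal (togetherBound q) * ((n.primeFactors.card - 1 : ℕ) : ℝ≥0∞) := by
        rw [Finset.sum_const, Finset.card_erase_of_mem hq, nsmul_eq_mul]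
        ring
    _ ≤ _ := by
        refine mul_le_mul_left ?_ _
        rw [hc, ← ENNReal.ofReal_mul (by positivity)]
        refine ENNReal.ofReal_le_ofReal ?_
        -- With γ = τ/(1 - μ), the required (1 + γ)τ ≤ γ reduces to τ(1 - μ + τ) ≤ τ, that is, to τ
        -- ≤ μ.
        have h2 : togetherBound q ≤ meetBound := min_le_left _ _
        rw [le_div_iff₀ h1]
        have h3 : (1 + togetherBound q / (1 - meetBound)) * togetherBound q * (1 - meetBound) =
          (1 - meetBound + togetherBound q) * togetherBound q := by field_simp
        rw [h3]
        nlinarith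

/-- A run, with the treatment of the numbers that it puts on the list, costs in expectation no more
than is charged to the number on which it is performed. -/
lemma mean_loopCost_le (hp : 2 ≤ p) (hnp : n ∣ p - 1) (hodd : ¬ 2 ∣ n) (hs : HasSmallFactor B n)
    (hpp : ¬ IsPrimePow n) :
    2 + ((compatibleMaps n ×ˢ (Finset.univ : Finset (Fin n))).card : ℝ≥0∞)⁻¹ *
      ∑ w ∈ compatibleMaps n ×ˢ (Finset.univ : Finset (Fin n)), loopCost p B w.1 w.2 0 n ≤
    itemCost p B n := by
  have hn : n ≠ 0 := ne_zero_of_dvd_ne_zero (by omega) hnp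
  have hne := (hasSmallFactor_iff hn).1 hs
  set Ω := compatibleMaps n ×ˢ (Finset.univ : Finset (Fin n)) with hΩ
  set S := smallFactors B n with hS
  have hSsub : ∀ q ∈ S, q ∈ n.primeFactors := fun q hq => (mem_smallFactors.1 hq).1
  have hω : 1 < n.primeFactors.card := by
    have h1 : n.primeFactors.card ≠ 1 := fun h => hpp (isPrimePow_iff_card_primeFactors_eq_one.2 h)
    obtain ⟨q, hq⟩ := hne
    have h2 : 0 < n.primeFactors.card := Finset.card_pos.2 ⟨q, hSsub q hq⟩
    omega
  have hωp : n.primeFactors.card ≤ (p - 1).primeFactors.card :=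
    Finset.card_le_card (Nat.primeFactors_mono hnp (by omega))
  set c := (Ω.card : ℝ≥0∞)⁻¹ with hc
  have hdet : ∀ q ∈ S, c * ∑ w ∈ Ω, (detTime w.1 w.2 q : ℝ≥0∞) ≤ ENNReal.ofReal (2 * √q) := by
    intro q hq
    -- As n is not a prime power, a second prime is available for the two-prime independence
    -- statement.
    obtain ⟨r, hr, hrq⟩ := Finset.exists_mem_ne hω q
    exact mean_detTime_le (Nat.prime_of_mem_primeFactors (hSsub q hq))
      (Nat.prime_of_mem_primeFactors hr) hrq.symm hn (Nat.dvd_of_mem_primeFactors (hSsub q hq))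
      (Nat.dvd_of_mem_primeFactors hr)
  have hΩne : Ω.Nonempty := compatible_nonempty hn
  calc 2 + c * ∑ w ∈ Ω, loopCost p B w.1 w.2 0 n
      = 2 + (1 + n.primeFactors.card * hitCost p + ∑ q ∈ S, ((p - 1).factorization q : ℝ≥0∞) +
          (5 * ∑ q ∈ S, c * ∑ w ∈ Ω, (detTime w.1 w.2 q : ℝ≥0∞) +
            ∑ q ∈ S, runCost p q * (c * ∑ w ∈ Ω, growth q (together w.1 w.2 n q)))) := by
        congr 1
        have h1 : ∀ w : (Fin n → Fin n) × Fin n, loopCost p B w.1 w.2 0 n =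
            (1 + n.primeFactors.card * hitCost p + ∑ q ∈ S, ((p - 1).factorization q : ℝ≥0∞)) +
            (5 * ∑ q ∈ S, (detTime w.1 w.2 q : ℝ≥0∞) +
              ∑ q ∈ S, runCost p q * growth q (together w.1 w.2 n q)) := by
          intro w
          unfold loopCost primeCost
          rw [Finset.sum_add_distrib]
          simp only [Nat.sub_zero]
          ring
        simp_rw [h1]
        rw [inv_card_mul_sum_add hΩne, Finset.sum_add_distrib, mul_add, ← Finset.mul_sum,
          Finset.sum_comm, Finset.sum_comm (s := Ω)]
        congr 2
        · rw [← Finset.mul_sum]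
          ring
        · rw [Finset.mul_sum]
          refine Finset.sum_congr rfl fun q _ => ?_
          rw [← Finset.mul_sum]
          ring
    _ ≤ 2 + (1 + n.primeFactors.card * hitCost p + ∑ q ∈ S, ((p - 1).factorization q : ℝ≥0∞) +
          (5 * ∑ q ∈ S, ENNReal.ofReal (2 * √q) +
            ∑ q ∈ S, runCost p q * (ENNReal.ofReal (togetherBound q / (1 - meetBound)) *
              ((n.primeFactors.card - 1 : ℕ) : ℝ≥0∞)))) := by
        exact add_le_add le_rfl (add_le_add le_rfl (add_le_add
          (mul_le_mul_right (Finset.sum_le_sum fun q hq => hdet q hq) _)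
          (Finset.sum_le_sum fun q hq =>
            mul_le_mul_right (mean_growth_le hn hodd (hSsub q hq)) _)))
    _ ≤ 2 + (∑ q ∈ S, ((p - 1).factorization q : ℝ≥0∞) + (∑ q ∈ S, runCost p q +
            ∑ q ∈ S, runCost p q * (ENNReal.ofReal (togetherBound q / (1 - meetBound)) *
              ((n.primeFactors.card - 1 : ℕ) : ℝ≥0∞)))) := by
        -- The exit step and the hits are paid once, by any single small prime of n; such a prime
        -- exists.
        have h1 : 1 + n.primeFactors.card * (hitCost p : ℝ≥0∞) + 5 * ∑ q ∈ S, ENNReal.ofReal (2 * √q)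
            ≤ ∑ q ∈ S, runCost p q := by
          unfold runCost
          rw [Finset.sum_add_distrib, Finset.sum_add_distrib, Finset.mul_sum]
          obtain ⟨q₀, hq₀⟩ := hne
          have h2 : (n.primeFactors.card : ℝ≥0∞) * hitCost p ≤
              ∑ _q ∈ S, ((p - 1).primeFactors.card : ℝ≥0∞) * hitCost p := by
            refine le_trans ?_ (Finset.single_le_sum (f := fun _ =>
              ((p - 1).primeFactors.card : ℝ≥0∞) * hitCost p) (fun _ _ => zero_le) hq₀)
            gcongr
          have h3 : (1 : ℝ≥0∞) ≤ ∑ _q ∈ S, 3 := by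
            refine le_trans ?_ (Finset.single_le_sum (f := fun _ => (3 : ℝ≥0∞))
              (fun _ _ => zero_le) hq₀)
            norm_num
          have h4 : ∑ q ∈ S, 5 * ENNReal.ofReal (2 * √(q : ℝ)) =
              ∑ q ∈ S, ENNReal.ofReal (10 * √(q : ℝ)) := by
            refine Finset.sum_congr rfl fun q _ => ?_
            rw [show (5 : ℝ≥0∞) = ENNReal.ofReal 5 by simp, ← ENNReal.ofReal_mul (by norm_num)]
            congr 1
            ring
          rw [h4, add_comm]
          refine (add_le_add le_rfl (add_le_add h3 h2)).trans (le_of_eq ?_)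
          ring
        refine add_le_add le_rfl ?_
        rw [add_comm (1 + _ : ℝ≥0∞), add_assoc, ← add_assoc (1 + _ : ℝ≥0∞)]
        exact add_le_add le_rfl (add_le_add h1 le_rfl)
    _ = itemCost p B n := by
        unfold itemCost primeCost growth
        rw [if_pos hω, Finset.sum_add_distrib, ← Finset.sum_add_distrib (s := S) (f := runCost p)]
        simp_rw [mul_add, mul_one]
        rfl

/-- No prime of m has been detected so far, so one more loop lowers the remaining time of some small
prime by 1, which releases the 5 units spent. -/
lemma loopCost_succ_le {f : Fin n → Fin n} {x : Fin n} {i : ℕ} (hs : (smallFactors B m).Nonempty)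
    (hlt : ∀ r ∈ m.primeFactors, i < detTime f x r) :
    5 + loopCost p B f x (i + 1) m ≤ loopCost p B f x i m := by
  have h1 : 1 + ∑ q ∈ smallFactors B m, ((detTime f x q - (i + 1) : ℕ) : ℝ≥0∞) ≤
      ∑ q ∈ smallFactors B m, ((detTime f x q - i : ℕ) : ℝ≥0∞) := by
    obtain ⟨q₀, hq₀⟩ := hs
    have h2 : 1 + ∑ q ∈ smallFactors B m, (detTime f x q - (i + 1)) ≤
        ∑ q ∈ smallFactors B m, (detTime f x q - i) := by
      rw [add_comm, Nat.succ_le_iff]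
      refine Finset.sum_lt_sum (fun q _ => by omega) ⟨q₀, hq₀, ?_⟩
      have := hlt q₀ (mem_smallFactors.1 hq₀).1
      omega
    exact_mod_cast h2
  unfold loopCost
  calc _ = 1 + 5 * (1 + ∑ q ∈ smallFactors B m, ((detTime f x q - (i + 1) : ℕ) : ℝ≥0∞)) +
        m.primeFactors.card * hitCost p +
        ∑ q ∈ smallFactors B m, primeCost p q (together f x m q) := by ring
    _ ≤ _ := by gcongr

/-- The primes with detection time i + 1 move into g, where their number of primes equals the former
`together`; for the others `together` does not change. The removal of a prime from m releases one
`hitCost`. -/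
lemma loopCost_strip_le {f : Fin n → Fin n} {x : Fin n} {i : ℕ} (hs : (smallFactors B m).Nonempty)
    (hm : m ≠ 0) (hlt : ∀ r ∈ m.primeFactors, i < detTime f x r) (hg : g ∣ m) (hg1 : g ≠ 1)
    (hgp : ∀ r ∈ m.primeFactors, r ∣ g ↔ detTime f x r = i + 1) :
    5 + (2 * p.size.size + 2 : ℕ) + (loopCost p B f x (i + 1) (strip m g) + itemCost p B g) ≤
      loopCost p B f x i m := by
  have hg0 : g ≠ 0 := ne_zero_of_dvd_ne_zero hm hg
  have hpf := primeFactors_strip hm hg0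
  have hgsub : g.primeFactors ⊆ m.primeFactors := Nat.primeFactors_mono hg hm
  have hgmem : ∀ r ∈ m.primeFactors, r ∈ g.primeFactors ↔ detTime f x r = i + 1 := by
    intro r hr
    rw [← hgp r hr, Nat.mem_primeFactors]
    exact ⟨fun h => h.2.1, fun h => ⟨Nat.prime_of_mem_primeFactors hr, h, hg0⟩⟩
  have hsmall : smallFactors B (strip m g) = smallFactors B m \ smallFactors B g := by
    ext q
    rw [Finset.mem_sdiff, mem_smallFactors, mem_smallFactors, mem_smallFactors, hpf,
      Finset.mem_sdiff]
    tauto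
  have hsmallsub : smallFactors B g ⊆ smallFactors B m := by
    intro q hq
    rw [mem_smallFactors] at hq ⊢
    exact ⟨hgsub hq.1, hq.2⟩
  have hcard : (strip m g).primeFactors.card + 1 ≤ m.primeFactors.card := by
    have h1 : g.primeFactors.Nonempty := Nat.nonempty_primeFactors.2 (by omega)
    have h2 := h1.card_pos
    have h3 := Finset.card_sdiff_add_card_eq_card hgsub
    rw [hpf]
    omega
  have hdet : 1 + ∑ q ∈ smallFactors B (strip m g), ((detTime f x q - (i + 1) : ℕ) : ℝ≥0∞) ≤
      ∑ q ∈ smallFactors B m, ((detTime f x q - i : ℕ) : ℝ≥0∞) := by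
    obtain ⟨q₀, hq₀⟩ := hs
    have h2 : 1 + ∑ q ∈ smallFactors B m, (detTime f x q - (i + 1)) ≤
        ∑ q ∈ smallFactors B m, (detTime f x q - i) := by
      rw [add_comm, Nat.succ_le_iff]
      refine Finset.sum_lt_sum (fun q _ => by omega) ⟨q₀, hq₀, ?_⟩
      have := hlt q₀ (mem_smallFactors.1 hq₀).1
      omega
    have h3 : ∑ q ∈ smallFactors B (strip m g), (detTime f x q - (i + 1)) ≤
        ∑ q ∈ smallFactors B m, (detTime f x q - (i + 1)) :=
      Finset.sum_le_sum_of_subset (by rw [hsmall]; exact Finset.sdiff_subset)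
    exact_mod_cast (add_le_add le_rfl h3).trans h2
  have hsum : ∑ q ∈ smallFactors B (strip m g), primeCost p q (together f x (strip m g) q) +
      ∑ q ∈ smallFactors B g, primeCost p q g.primeFactors.card =
      ∑ q ∈ smallFactors B m, primeCost p q (together f x m q) := by
    rw [← Finset.sum_sdiff hsmallsub, ← hsmall]
    congr 1
    · refine Finset.sum_congr rfl fun q hq => ?_
      congr 1
      unfold together
      congr 1
      have hq' := (mem_smallFactors.1 hq).1
      rw [hpf, Finset.mem_sdiff] at hq'
      ext r
      rw [Finset.mem_filter, Finset.mem_filter, hpf, Finset.mem_sdiff]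
      constructor
      · rintro ⟨⟨h1, -⟩, h2⟩
        exact ⟨h1, h2⟩
      · rintro ⟨h1, h2⟩
        refine ⟨⟨h1, fun h3 => hq'.2 ?_⟩, h2⟩
        rw [hgmem q hq'.1, ← h2, ← hgmem r h1]
        exact h3
    · refine Finset.sum_congr rfl fun q hq => ?_
      congr 1
      unfold together
      congr 1
      have hq' := (mem_smallFactors.1 hq).1
      have hq1 := (hgmem q (hgsub hq')).1 hq'
      ext r
      rw [Finset.mem_filter, hq1]
      constructor
      · intro h
        exact ⟨hgsub h, (hgmem r (hgsub h)).1 h⟩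
      · rintro ⟨h1, h2⟩
        exact (hgmem r h1).2 h2
  have hcard' : ((strip m g).primeFactors.card : ℝ≥0∞) + 1 ≤ m.primeFactors.card := by
    exact_mod_cast hcard
  -- Besides the operations of the hit itself, `hitCost` contains the constant 2 in the `itemCost`
  -- of the new number g.
  have hhit : (hitCost p : ℝ≥0∞) = (2 * p.size.size + 2 : ℕ) + 2 := by
    unfold hitCost
    push_cast
    ring
  unfold loopCost itemCost
  calc _ = 1 + 5 * (1 + ∑ q ∈ smallFactors B (strip m g),
          ((detTime f x q - (i + 1) : ℕ) : ℝ≥0∞)) +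
        ((strip m g).primeFactors.card + 1) * hitCost p +
        (∑ q ∈ smallFactors B (strip m g), primeCost p q (together f x (strip m g) q) +
          ∑ q ∈ smallFactors B g, primeCost p q g.primeFactors.card) := by
        rw [add_mul, one_mul]
        nth_rw 3 [hhit]
        ring
    _ ≤ _ := by
        rw [hsum]
        gcongr

end potential

end ProbRoot

namespace ProbRoot

open scoped ENNReal
open State

/-! ### Total expected cost by the potential, and almost sure end of the partial factorization -/

section splitting

variable {p : ℕ} {B : ℝ}

lemma gcdDiff_dvd {n : ℕ} (x y : Fin n) (m : ℕ) : gcdDiff x y m ∣ m := Nat.gcd_dvd_right _ _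

lemma dvd_gcdDiff_iff {n : ℕ} {x y : Fin n} {m r : ℕ} (hr : r ∣ m) :
    r ∣ gcdDiff x y m ↔ (x : ℕ) ≡ (y : ℕ) [MOD r] := by
  unfold gcdDiff
  rw [Nat.dvd_gcd_iff, and_iff_left hr, ← Int.natCast_dvd, ← Nat.modEq_iff_dvd]
  exact ⟨Nat.ModEq.symm, Nat.ModEq.symm⟩

/-- A prime not detected in the first i loops divides the next gcd exactly if the next loop is its
detection time. -/
lemma dvd_gcdDiff_iff_detTime {n : ℕ} {f : Fin n → Fin n} {x : Fin n} {i m r : ℕ} (hr : r ∣ m)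
    (hi : i < detTime f x r) :
    r ∣ gcdDiff (f (f^[i] x)) (f (f (f^[2 * i] x))) m ↔ detTime f x r = i + 1 := by
  rw [dvd_gcdDiff_iff hr, ← Function.iterate_succ_apply' f i, ← Function.iterate_succ_apply' f,
    ← Function.iterate_succ_apply' f]
  constructor
  · intro h
    have h1 : detTime f x r ≤ i + 1 := Nat.sInf_le ⟨by omega, h⟩
    omega
  · intro h
    -- The infimum of an empty set of naturals is 0, so a positive detection time is attained.
    have h1 : {i | 1 ≤ i ∧ (f^[i] x : ℕ) ≡ (f^[2 * i] x : ℕ) [MOD r]}.Nonempty :=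
      Nat.nonempty_of_pos_sInf (by change 0 < detTime f x r; omega)
    have h2 := Nat.sInf_mem h1
    change 1 ≤ detTime f x r ∧ (f^[detTime f x r] x : ℕ) ≡ (f^[2 * detTime f x r] x : ℕ) [MOD r]
      at h2
    rw [h] at h2
    exact h2.2

/-- The expected number of operations charged to the numbers of the list `W`. -/
noncomputable def listCost (p : ℕ) (B : ℝ) (W : List ℕ) : ℝ≥0∞ := (W.map (itemCost p B)).sum

lemma listCost_cons (n : ℕ) (W : List ℕ) :
    listCost p B (n :: W) = itemCost p B n + listCost p B W := by
  unfold listCost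
  rw [List.map_cons, List.sum_cons]

/-- A bound for the expected number of operations once the partial factorization is known. -/
noncomputable def pickBound (p : ℕ) : ℝ≥0∞ :=
  2 * ((4 * p.size + 2 : ℕ) : ℝ≥0∞) * ((p - 1).primeFactors.card + 1)

lemma runCost_ne_top (q : ℕ) : runCost p q ≠ ∞ := by
  unfold runCost
  exact ENNReal.add_ne_top.2 ⟨ENNReal.add_ne_top.2 ⟨ENNReal.ofReal_ne_top, by simp⟩,
    ENNReal.mul_ne_top (ENNReal.natCast_ne_top _) (ENNReal.natCast_ne_top _)⟩

lemma growth_ne_top (q k : ℕ) : growth q k ≠ ∞ :=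
  ne_top_of_le_ne_top (ENNReal.mul_ne_top ENNReal.ofReal_ne_top (ENNReal.natCast_ne_top _))
    (growth_le q k)

lemma itemCost_ne_top (n : ℕ) : itemCost p B n ≠ ∞ := by
  unfold itemCost primeCost
  exact ENNReal.add_ne_top.2 ⟨by simp, ENNReal.sum_ne_top.2 fun q _ =>
    ENNReal.add_ne_top.2 ⟨ENNReal.natCast_ne_top _,
      ENNReal.mul_ne_top (runCost_ne_top q) (growth_ne_top q _)⟩⟩

lemma pickBound_ne_top : pickBound p ≠ ∞ := by
  unfold pickBound
  exact ENNReal.mul_ne_top (ENNReal.mul_ne_top (by simp) (ENNReal.natCast_ne_top _))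
    (ENNReal.add_ne_top.2 ⟨ENNReal.natCast_ne_top _, by simp⟩)

/-- A bound for the expected number of operations of the algorithm. -/
noncomputable def totalBound (p : ℕ) (B : ℝ) : ℝ≥0∞ :=
  (p - 1).factorization 2 + 2 + (itemCost p B ((p - 1) / 2 ^ (p - 1).factorization 2) +
    (pickBound p + 1))

lemma totalBound_ne_top : totalBound p B ≠ ∞ := by
  unfold totalBound
  exact ENNReal.add_ne_top.2 ⟨ENNReal.add_ne_top.2 ⟨ENNReal.natCast_ne_top _, by simp⟩,
    ENNReal.add_ne_top.2 ⟨itemCost_ne_top _, ENNReal.add_ne_top.2 ⟨pickBound_ne_top, by simp⟩⟩⟩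

/-- The states of the partial factorization in which the invariant holds. -/
def IsPartial (p : ℕ) (B : ℝ) : State p → Prop
  | init => True
  | split W ps Q => SplitInv p B W ps Q
  | loop _ _ _ _ m W ps Q => SplitInv p B (m :: W) ps Q
  | _ => False

lemma IsPartial.isSplitting {s : State p} (hs : IsPartial p B s) : IsSplitting s := by
  cases s <;> trivial

variable [hp : Fact p.Prime]

lemma costUpTo_pick_le_pickBound {ps : List ℕ} {Q : ℕ} (h : SplitInv p B [] ps Q) (T : ℕ) :
    costUpTo p B (chargedCost p B) T (pick ps 1 Q) ≤ pickBound p := by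
  have hp2 := hp.out.two_le
  have hsub : ∀ q ∈ ps, q ∈ (p - 1).primeFactors := fun q hq => smallPrimes_subset (h.mem_small q hq)
  have hlen : ps.length ≤ (p - 1).primeFactors.card := by
    rw [← List.toFinset_card_of_nodup h.nodup]
    exact Finset.card_le_card fun q hq => hsub q (List.mem_toFinset.1 hq)
  rw [h.final.2]
  have h2 : cofactor p B ≠ 2 := by
    intro h2
    have := odd_cofactor (B := B) hp2
    rw [h2] at this
    exact absurd this (by decide)
  refine ((costUpTo_pick_le (cofactor_dvd hp2) h2 T).1 ps 1 fun q hq =>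
    ⟨Nat.prime_of_mem_primeFactors (hsub q hq), Nat.dvd_of_mem_primeFactors (hsub q hq)⟩).trans ?_
  unfold pickBound
  gcongr

/-- The potential argument: the listed numbers, the current run and the later draws pay for each
transition. In a loop, i recovers the iterates as f^i(x) and f^(2i)(x), and the assumption on m says
that all primes detected up to loop i have been removed. -/
lemma costUpTo_split_le (T : ℕ) :
    (∀ W ps Q, SplitInv p B W ps Q → costUpTo p B (chargedCost p B) T (split W ps Q) ≤
      listCost p B W + (pickBound p + 1)) ∧
    (∀ (n : ℕ) (f : Fin n → Fin n) (x : Fin n) (i m : ℕ) (W ps : List ℕ) (Q : ℕ),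
      SplitInv p B (m :: W) ps Q → (∀ r ∈ m.primeFactors, i < detTime f x r) →
      costUpTo p B (chargedCost p B) T (loop n f (f^[i] x) (f^[2 * i] x) m W ps Q) ≤
        loopCost p B f x i m + (listCost p B W + (pickBound p + 1))) := by
  classical
  have hp2 := hp.out.two_le
  induction T with
  | zero =>
    refine ⟨fun W ps Q _ => ?_, fun n f x i m W ps Q _ _ => ?_⟩ <;> rw [costUpTo_zero] <;>
      exact zero_le
  | succ T ih =>
    refine ⟨fun W ps Q h => ?_, fun n f x i m W ps Q h hi => ?_⟩
    · rw [costUpTo_succ, chargedCost_of_isSplitting (s := split W ps Q) trivial]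
      cases W with
      | nil =>
        rw [step, mean_pure, opCount]
        refine (add_le_add le_rfl (costUpTo_pick_le_pickBound h T)).trans (le_of_eq ?_)
        simp [listCost, add_comm]
      | cons n W =>
        have hn := h.dvd n List.mem_cons_self
        rw [step, opCount, listCost_cons, add_assoc (itemCost p B n)]
        by_cases hs : HasSmallFactor B n
        swap
        · rw [if_pos hs, mean_pure, if_neg fun h => hs h.1]
          refine add_le_add ?_ (ih.1 _ _ _ (h.discard hs))
          unfold itemCost
          refine le_trans (le_of_eq ?_) le_self_add
          norm_num
        rw [if_neg (not_not.2 hs)]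
        by_cases hpp : IsPrimePow n
        · rw [if_pos hpp, mean_pure, if_pos ⟨hs, hpp⟩]
          refine add_le_add ?_ (ih.1 _ _ _ (h.primePow hp2 hs hpp))
          have hmem : n.minFac ∈ smallFactors B n := mem_smallFactors.2
            ⟨Nat.mem_primeFactors.2 ⟨Nat.minFac_prime hpp.one_lt.ne', Nat.minFac_dvd n,
              hpp.ne_zero⟩, minFac_lt_of_isPrimePow hpp hs⟩
          unfold itemCost
          refine le_trans ?_ (add_le_add le_rfl (Finset.single_le_sum (f := fun q =>
            primeCost p q n.primeFactors.card) (fun _ _ => zero_le) hmem))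
          refine le_trans (le_of_eq ?_) (add_le_add le_rfl le_self_add)
          push_cast
          ring
        · have hn0 : n ≠ 0 := ne_zero_of_dvd_ne_zero (by omega) hn
          have hodd := h.odd n List.mem_cons_self
          rw [if_neg hpp, mean_draw (compatible_nonempty hn0), if_neg fun h => hpp h.2]
          refine le_trans (add_le_add le_rfl (mul_le_mul_right (Finset.sum_le_sum (g := fun w =>
            listCost p B W + (pickBound p + 1) + loopCost p B w.1 w.2 0 n) fun w hw => ?_) _))
            (le_trans ?_ (add_le_add (mean_loopCost_le hp2 hn hodd hs hpp) le_rfl))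
          · rw [add_comm (_ + _)]
            refine ih.2 n w.1 w.2 0 n W ps Q h fun r hr => ?_
            have : NeZero r := ⟨(Nat.prime_of_mem_primeFactors hr).ne_zero⟩
            exact one_le_detTime hn0 (Nat.dvd_of_mem_primeFactors hr) (Finset.mem_product.1 hw).1 _
          · rw [inv_card_mul_sum_add (compatible_nonempty hn0)]
            refine le_of_eq ?_
            push_cast
            ring
    · rw [costUpTo_succ, chargedCost_of_isSplitting (s := loop n f (f^[i] x) (f^[2 * i] x) m W ps Q) trivial]
      have hm := h.dvd m List.mem_cons_self
      have hm0 : m ≠ 0 := ne_zero_of_dvd_ne_zero (by omega) hm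
      rw [step, opCount]
      by_cases hs : HasSmallFactor B m
      swap
      · rw [if_pos hs, if_pos hs, mean_pure]
        refine add_le_add ?_ (ih.1 _ _ _ (h.discard hs))
        unfold loopCost
        rw [Nat.cast_zero, zero_add, add_assoc, add_assoc]
        exact le_self_add
      rw [if_neg (not_not.2 hs), if_neg (not_not.2 hs)]
      have hne := (hasSmallFactor_iff hm0).1 hs
      have hg : ∀ r ∈ m.primeFactors, r ∣ gcdDiff (f (f^[i] x)) (f (f (f^[2 * i] x))) m ↔
          detTime f x r = i + 1 := fun r hr =>
        dvd_gcdDiff_iff_detTime (Nat.dvd_of_mem_primeFactors hr) (hi r hr)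
      have hx : f (f^[i] x) = f^[i + 1] x := (Function.iterate_succ_apply' f i x).symm
      have hy : f (f (f^[2 * i] x)) = f^[2 * (i + 1)] x := by
        rw [← Function.iterate_succ_apply' f, ← Function.iterate_succ_apply' f]
        rfl
      have hgm := gcdDiff_dvd (f (f^[i] x)) (f (f (f^[2 * i] x))) m
      by_cases hg1 : gcdDiff (f (f^[i] x)) (f (f (f^[2 * i] x))) m = 1
      · rw [if_pos hg1]
        simp only [hg1, if_true, mean_pure]
        rw [hx, hy]
        refine (add_le_add le_rfl (ih.2 n f x (i + 1) m W ps Q h fun r hr => ?_)).trans ?_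
        · have h1 := hi r hr
          have h2 : ¬ detTime f x r = i + 1 := by
            rw [← hg r hr, hg1]
            exact (Nat.prime_of_mem_primeFactors hr).not_dvd_one
          omega
        · rw [← add_assoc]
          refine add_le_add (le_trans (le_of_eq ?_) (loopCost_succ_le hne hi)) le_rfl
          norm_num
      · rw [if_neg hg1]
        simp only [hg1, if_false, mean_pure]
        set g := gcdDiff (f (f^[i] x)) (f (f (f^[2 * i] x))) m with hgdef
        have hg0 : g ≠ 0 := ne_zero_of_dvd_ne_zero hm0 hgm
        rw [hx, hy]
        refine (add_le_add le_rfl (ih.2 n f x (i + 1) (strip m g) (g :: W) ps Q (h.split hp2 hgm)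
          fun r hr => ?_)).trans ?_
        · rw [primeFactors_strip hm0 hg0, Finset.mem_sdiff] at hr
          have h1 := hi r hr.1
          have h2 : ¬ detTime f x r = i + 1 := by
            rw [← hg r hr.1]
            exact fun h3 => hr.2 (Nat.mem_primeFactors.2
              ⟨Nat.prime_of_mem_primeFactors hr.1, h3, hg0⟩)
          omega
        · have hsz : powMults m.size ≤ 2 * p.size.size := by
            refine powMults_le_of_le (Nat.size_le_size ?_)
            exact (Nat.le_of_dvd (by omega) hm).trans (Nat.sub_le _ _)
          have h3 := loopCost_strip_le (p := p) hne hm0 hi hgm hg1 hg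
          rw [listCost_cons]
          calc _ ≤ 5 + ((2 * p.size.size + 2 : ℕ) : ℝ≥0∞) + (loopCost p B f x (i + 1) (strip m g) +
                (itemCost p B g + listCost p B W + (pickBound p + 1))) := by
                refine add_le_add ?_ le_rfl
                exact_mod_cast (by omega)
            _ = 5 + ((2 * p.size.size + 2 : ℕ) : ℝ≥0∞) + (loopCost p B f x (i + 1) (strip m g) +
                itemCost p B g) + (listCost p B W + (pickBound p + 1)) := by ring
            _ ≤ _ := add_le_add h3 le_rfl

lemma costUpTo_init_le (hp3 : 3 ≤ p) (T : ℕ) :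
    costUpTo p B (chargedCost p B) T init ≤ totalBound p B := by
  cases T with
  | zero => rw [costUpTo_zero]; exact zero_le
  | succ T =>
    rw [costUpTo_succ, chargedCost_of_isSplitting (s := init) trivial, step, mean_pure, opCount]
    have h := (costUpTo_split_le (B := B) T).1 _ _ _ (SplitInv.init hp3 (hp.out.odd_of_ne_two (by omega)))
    rw [listCost_cons, listCost, List.map_nil, List.sum_nil, add_zero] at h
    refine (add_le_add le_rfl h).trans (le_of_eq ?_)
    unfold totalBound
    push_cast
    ring

/-- The expected running time is bounded by the bound for the number of operations. -/
lemma expectedTime_le_totalBound (hp3 : 3 ≤ p) :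
    expectedTime p B ≤ totalBound p B * (p.size : ℝ≥0∞) ^ 2 :=
  expectedTime_le opCount_le_chargedCost (costUpTo_init_le hp3)

/-- By the invariant, the only exit from the partial factorization has the correct primes and
cofactor, whatever the random choices were. -/
lemma IsPartial.step (hp3 : 3 ≤ p) {s : State p} (hs : IsPartial p B s) :
    ∀ s' ∈ (step p B s).support, IsPartial p B s' ∨
      ∃ ps : List ℕ, ps.Nodup ∧ ps.toFinset = smallPrimes p B ∧ s' = pick ps 1 (cofactor p B) := by
  classical
  have hp2 := hp.out.two_le
  intro s' hs'
  cases s with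
  | init =>
    rw [ProbRoot.step, PMF.mem_support_pure_iff] at hs'
    subst hs'
    exact Or.inl (SplitInv.init hp3 (hp.out.odd_of_ne_two (by omega)))
  | split W ps Q =>
    have h : SplitInv p B W ps Q := hs
    cases W with
    | nil =>
      rw [ProbRoot.step, PMF.mem_support_pure_iff] at hs'
      exact Or.inr ⟨ps, h.nodup, h.final.1, by rw [hs', h.final.2]⟩
    | cons n W =>
      left
      rw [ProbRoot.step] at hs'
      split_ifs at hs' with h1 h2
      · rw [PMF.mem_support_pure_iff] at hs'
        subst hs'
        exact h.primePow hp2 h1 h2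
      · rw [support_draw (compatible_nonempty
          (ne_zero_of_dvd_ne_zero (by omega) (h.dvd n List.mem_cons_self)))] at hs'
        obtain ⟨w, -, rfl⟩ := hs'
        exact h
      · rw [PMF.mem_support_pure_iff] at hs'
        subst hs'
        exact h.discard h1
  | loop n f x y m W ps Q =>
    have h : SplitInv p B (m :: W) ps Q := hs
    left
    rw [ProbRoot.step] at hs'
    by_cases h1 : HasSmallFactor B m
    · rw [if_neg (not_not.2 h1)] at hs'
      by_cases h2 : gcdDiff (f x) (f (f y)) m = 1
      · simp only [h2, if_true, PMF.mem_support_pure_iff] at hs'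
        subst hs'
        exact h
      · simp only [h2, if_false, PMF.mem_support_pure_iff] at hs'
        subst hs'
        exact h.split hp2 (gcdDiff_dvd _ _ _)
    · rw [if_pos h1, PMF.mem_support_pure_iff] at hs'
      subst hs'
      exact h.discard h1
  | pick _ _ _ => exact hs.elim
  | test _ _ _ _ => exact hs.elim
  | pickLast _ _ => exact hs.elim
  | testLast _ _ _ => exact hs.elim
  | done _ _ => exact hs.elim

lemma le_outputProb_init (hp3 : 3 ≤ p) {E : Set (ZMod p × ℝ)} {K : ℝ≥0∞} (hK : K ≠ ∞)
    (h : ∀ ps : List ℕ, ps.Nodup → ps.toFinset = smallPrimes p B →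
      K ≤ outputProb p B (pick ps 1 (cofactor p B)) E) :
    K ≤ outputProb p B init E := by
  refine le_outputProb_of_phase (J := IsPartial p B) hK
    (fun s hs => one_le_chargedCost hs.isSplitting) (fun s hs s' hs' => ?_) trivial
    totalBound_ne_top (costUpTo_init_le hp3)
  rcases hs.step hp3 s' hs' with h1 | ⟨ps, h1, h2, rfl⟩
  · exact Or.inl h1
  · exact Or.inr (h ps h1 h2)

end splitting

/-! ### Correctness from both starting states -/

section correctness

variable {p : ℕ} {B : ℝ}

theorem correct_pick (hp5 : 5 ≤ p) (hpp : p.Prime) {ε : ℝ} (hε : 0 < ε) (hB : IsFactorBound p ε B)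
    {ps : List ℕ} (hnd : ps.Nodup) (hps : ps.toFinset = smallPrimes p B) :
    Correct p ε B (pick ps 1 (cofactor p B)) := by
  have : Fact p.Prime := ⟨hpp⟩
  obtain ⟨h1, h2, h3⟩ := outputProb_pick_smallPrimes hnd hps
  exact correct_of_outputProb hp5 hpp hε hB h1 h2 h3

theorem correct_init (hp5 : 5 ≤ p) (hpp : p.Prime) {ε : ℝ} (hε : 0 < ε)
    (hB : IsFactorBound p ε B) : Correct p ε B init := by
  have : Fact p.Prime := ⟨hpp⟩
  refine correct_of_outputProb hp5 hpp hε hB ?_ (fun hQ => ?_) (fun hQ => ?_)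
  · exact le_antisymm (outputProb_le_one _ _) (le_outputProb_init (by omega) ENNReal.one_ne_top
      fun ps hnd hps => (outputProb_pick_smallPrimes hnd hps).1.ge)
  · exact le_antisymm (outputProb_le_one _ _) (le_outputProb_init (by omega) ENNReal.one_ne_top
      fun ps hnd hps => ((outputProb_pick_smallPrimes hnd hps).2.1 hQ).ge)
  · exact le_outputProb_init (by omega) ENNReal.ofReal_ne_top
      fun ps hnd hps => (outputProb_pick_smallPrimes hnd hps).2.2 hQ

end correctness

end ProbRoot

namespace ProbRoot

/-! ### Sums over primes -/

section primeSums

open Finset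

/-- The primes `p ≤ x` with `p ≡ 1` modulo `q`. -/
def primesOneMod (q x : ℕ) : Finset ℕ := (Icc 1 x).filter fun p => p.Prime ∧ q ∣ p - 1

lemma mem_primesOneMod {q x p : ℕ} :
    p ∈ primesOneMod q x ↔ p ≤ x ∧ p.Prime ∧ q ∣ p - 1 := by
  unfold primesOneMod
  rw [mem_filter, mem_Icc]
  constructor
  · rintro ⟨⟨-, h⟩, h'⟩
    exact ⟨h, h'⟩
  · rintro ⟨h, h'⟩
    exact ⟨⟨h'.1.one_lt.le, h⟩, h'⟩

/-- With r inverse to q modulo M, each factor q(k+1) + 1 equals q(r + 1 + k). The product is q^n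
times a product of n consecutive integers, which n! divides. -/
lemma dvd_prod_mul_add_one {M q n : ℕ} (hM : M ∣ n.factorial) (hc : Nat.Coprime q M) :
    M ∣ ∏ k ∈ range n, (q * (k + 1) + 1) := by
  have hM0 : NeZero M := ⟨ne_zero_of_dvd_ne_zero n.factorial_ne_zero hM⟩
  rw [← ZMod.natCast_eq_zero_iff]
  set r := ((q : ZMod M)⁻¹).val with hr
  have hr1 : (q : ZMod M) * (r : ZMod M) = 1 := by
    rw [hr, ZMod.natCast_zmod_val]
    exact ZMod.coe_mul_inv_eq_one q hc
  have h1 : (((r + 1).ascFactorial n : ℕ) : ZMod M) = 0 := by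
    rw [ZMod.natCast_eq_zero_iff]
    exact hM.trans (Nat.factorial_dvd_ascFactorial _ _)
  rw [Nat.ascFactorial_eq_prod_range] at h1
  have h2 : ((∏ k ∈ range n, (q * (k + 1) + 1) : ℕ) : ZMod M) =
      (q : ZMod M) ^ n * ((∏ k ∈ range n, (r + 1 + k) : ℕ) : ZMod M) := by
    push_cast
    rw [← card_range n, ← prod_const, card_range, ← prod_mul_distrib]
    refine prod_congr rfl fun k _ => ?_
    rw [← hr1]
    ring
  rw [h2, h1, mul_zero]

/-- Let n = x/q, rounded down. The primes in question are among the factors q(k+1) + 1 with k < n,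
and exceeding n they are coprime to n!. So they divide the product along with the q-free part of n!.
-/
lemma prod_primesOneMod_mul_dvd {q x : ℕ} (hq : q.Prime) :
    (∏ p ∈ (primesOneMod q x).filter (fun p => x / q < p), p) *
      ((x / q).factorial / q ^ (x / q).factorial.factorization q) ∣
        ∏ k ∈ range (x / q), (q * (k + 1) + 1) := by
  set n := x / q with hn
  set M := n.factorial / q ^ n.factorial.factorization q with hM
  have hMn : M ∣ n.factorial := Nat.ordCompl_dvd _ _
  have hmem : ∀ p ∈ (primesOneMod q x).filter (fun p => n < p), p.Prime ∧ n < p ∧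
      ∃ k < n, p = q * (k + 1) + 1 := by
    intro p hp
    rw [mem_filter, mem_primesOneMod] at hp
    obtain ⟨⟨hpx, hpp, k, hk⟩, hnp⟩ := hp
    have hp2 := hpp.two_le
    refine ⟨hpp, hnp, k - 1, ?_, ?_⟩
    · have h1 : k ≤ n := by
        rw [hn, Nat.le_div_iff_mul_le hq.pos, mul_comm]
        omega
      have h2 : k ≠ 0 := by
        rintro rfl
        omega
      omega
    · have h2 : k ≠ 0 := by
        rintro rfl
        omega
      rw [Nat.sub_add_cancel (by omega)]
      omega
  refine Nat.Coprime.mul_dvd_of_dvd_of_dvd ?_ ?_ ?_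
  · refine Nat.Coprime.prod_left fun p hp => ?_
    obtain ⟨hpp, hnp, -⟩ := hmem p hp
    rw [hpp.coprime_iff_not_dvd]
    intro h
    have := (hpp.dvd_factorial).1 (h.trans hMn)
    omega
  · refine Finset.prod_primes_dvd _ (fun p hp => (hmem p hp).1.prime) fun p hp => ?_
    obtain ⟨-, -, k, hk, rfl⟩ := hmem p hp
    exact dvd_prod_of_mem (fun k => q * (k + 1) + 1) (mem_range.2 hk)
  · exact dvd_prod_mul_add_one hMn (Nat.coprime_ordCompl hq n.factorial_ne_zero)

/-- The whole product is at most q^n (n+1)!, and removing q from n! costs at most q^n. Hence the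
product of the primes is at most q^(2n) (n+1), and log(n+1) ≤ n ≤ 2n log q. -/
lemma sum_log_primesOneMod_filter_le {q x : ℕ} (hq : q.Prime) :
    ∑ p ∈ (primesOneMod q x).filter (fun p => x / q < p), Real.log p ≤
      4 * (x / q : ℕ) * Real.log q := by
  have hdvd := prod_primesOneMod_mul_dvd (x := x) hq
  set n := x / q with hn
  set v := n.factorial.factorization q with hv
  set P := ∏ p ∈ (primesOneMod q x).filter (fun p => n < p), p with hP
  have hpos : 0 < ∏ k ∈ range n, (q * (k + 1) + 1) := prod_pos fun _ _ => by positivity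
  have h1 := Nat.le_of_dvd hpos hdvd
  have hvn : v ≤ n := by
    have : Fact q.Prime := ⟨hq⟩
    have h2 := sub_one_mul_padicValNat_factorial (p := q) n
    rw [← Nat.factorization_def _ hq] at h2
    have h3 : v ≤ (q - 1) * v := Nat.le_mul_of_pos_left _ (by have := hq.two_le; omega)
    exact h3.trans (h2.le.trans (Nat.sub_le _ _))
  have h2 : ∏ k ∈ range n, (q * (k + 1) + 1) ≤ q ^ n * (n + 1).factorial := by
    have h3 : (n + 1).factorial = ∏ k ∈ range n, (k + 2) := by
      rw [← prod_range_add_one_eq_factorial, prod_range_succ', zero_add, mul_one]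
    rw [h3, ← card_range n, ← prod_const, card_range, ← prod_mul_distrib]
    refine prod_le_prod' fun k _ => ?_
    have := hq.two_le
    nlinarith
  have h3 : P * n.factorial ≤ q ^ (2 * n) * (n + 1).factorial := by
    calc P * n.factorial = P * (n.factorial / q ^ v) * q ^ v := by
          rw [mul_assoc, Nat.div_mul_cancel (Nat.ordProj_dvd _ _)]
      _ ≤ q ^ n * (n + 1).factorial * q ^ n :=
          Nat.mul_le_mul (h1.trans h2) (Nat.pow_le_pow_right hq.pos hvn)
      _ = _ := by ring
  have h4 : P ≤ q ^ (2 * n) * (n + 1) := by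
    rw [Nat.factorial_succ, ← mul_assoc] at h3
    exact Nat.le_of_mul_le_mul_right h3 n.factorial_pos
  have hprime : ∀ p ∈ (primesOneMod q x).filter (fun p => n < p), p.Prime := fun p hp =>
    (mem_primesOneMod.1 (mem_filter.1 hp).1).2.1
  have hP0 : 0 < P := prod_pos fun p hp => (hprime p hp).pos
  have h5 : ∑ p ∈ (primesOneMod q x).filter (fun p => n < p), Real.log p = Real.log P := by
    rw [hP]
    push_cast
    rw [Real.log_prod fun p hp => by exact_mod_cast (hprime p hp).ne_zero]
  rw [h5]
  have h6 : Real.log P ≤ Real.log ((q : ℝ) ^ (2 * n) * (n + 1)) := by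
    refine Real.log_le_log (by exact_mod_cast hP0) (by exact_mod_cast h4)
  have hq0 : (0 : ℝ) < q := by exact_mod_cast hq.pos
  rw [Real.log_mul (by positivity) (by positivity), Real.log_pow] at h6
  have h7 : Real.log ((n : ℝ) + 1) ≤ n := by
    have := Real.log_le_sub_one_of_pos (show (0 : ℝ) < n + 1 by positivity)
    linarith
  have h8 : (1 / 2 : ℝ) ≤ Real.log q := by
    have := Real.log_le_log (by norm_num) (show (2 : ℝ) ≤ q by exact_mod_cast hq.two_le)
    linarith [Real.log_two_gt_d9]
  have h9 : (0 : ℝ) ≤ n := by positivity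
  push_cast at h6
  nlinarith

/-- A bound of Brun–Titchmarsh type with a superfluous logarithm. -/
lemma sum_log_primesOneMod_le {q : ℕ} (hq : q.Prime) (x : ℕ) :
    ∑ p ∈ primesOneMod q x, Real.log p ≤ 8 * x * (Real.log q / q) := by
  have hq2 : (2 : ℝ) ≤ q := by exact_mod_cast hq.two_le
  have hlog : 0 ≤ Real.log q := Real.log_nonneg (by linarith)
  induction x using Nat.strong_induction_on with
  | _ x ih =>
    rcases Nat.eq_zero_or_pos x with rfl | hx
    · simp [primesOneMod]
    have hlt : x / q < x := Nat.div_lt_self hx hq.one_lt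
    have h1 : (primesOneMod q x).filter (fun p => ¬ x / q < p) = primesOneMod q (x / q) := by
      ext p
      rw [mem_filter, mem_primesOneMod, mem_primesOneMod]
      constructor
      · rintro ⟨h1, h2⟩
        exact ⟨by omega, h1.2⟩
      · rintro ⟨h1, h2⟩
        exact ⟨⟨by omega, h2⟩, by omega⟩
    rw [← sum_filter_add_sum_filter_not _ (fun p => x / q < p), h1]
    have h2 := sum_log_primesOneMod_filter_le (x := x) hq
    have h3 := ih _ hlt
    have h4 : ((x / q : ℕ) : ℝ) ≤ x / q := Nat.cast_div_le
    -- The primes up to x/q, covered by induction, cost no more than the others because 8/q ≤ 4.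
    have h5 : 8 * ((x / q : ℕ) : ℝ) * (Real.log q / q) ≤ 4 * ((x / q : ℕ) : ℝ) * Real.log q := by
      rw [mul_div_assoc', div_le_iff₀ (by linarith)]
      have h6 : 0 ≤ ((x / q : ℕ) : ℝ) * Real.log q := by positivity
      nlinarith
    have h6 : ((x / q : ℕ) : ℝ) * Real.log q ≤ x / q * Real.log q := by gcongr
    calc _ ≤ 8 * (((x / q : ℕ) : ℝ) * Real.log q) := by linarith
      _ ≤ 8 * (x / q * Real.log q) := by linarith
      _ = _ := by ring

/-- Dyadic induction. On (y/2, y] the sum is at most θ(y)/√(y/2) ≤ 2.78 √(y/2) by Chebyshev, and 7 +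
2.78 ≤ 7 · 1.4 ≤ 7√2 closes the induction. -/
lemma sum_log_div_sqrt_le (y : ℝ) (hy : 0 ≤ y) :
    ∑ q ∈ (Icc 1 ⌊y⌋₊).filter Nat.Prime, Real.log q / √q ≤ 7 * √y := by
  obtain ⟨k, hk⟩ := pow_unbounded_of_one_lt y (one_lt_two)
  induction k generalizing y with
  | zero =>
    have : ⌊y⌋₊ = 0 := Nat.floor_eq_zero.2 (by simpa using hk)
    rw [this]
    simp
  | succ k ih =>
    have h1 := ih (y / 2) (by positivity) (by rw [pow_succ] at hk; linarith)
    have hsub : (Icc 1 ⌊y / 2⌋₊).filter Nat.Prime ⊆ (Icc 1 ⌊y⌋₊).filter Nat.Prime :=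
      filter_subset_filter _ (Icc_subset_Icc_right (Nat.floor_le_floor (by linarith)))
    rw [← sum_sdiff hsub]
    have h2 : ∑ q ∈ (Icc 1 ⌊y⌋₊).filter Nat.Prime \ (Icc 1 ⌊y / 2⌋₊).filter Nat.Prime,
        Real.log q / √q ≤ ∑ q ∈ (Icc 1 ⌊y⌋₊).filter Nat.Prime, Real.log q / √(y / 2) := by
      have hnn : ∀ q ∈ (Icc 1 ⌊y⌋₊).filter Nat.Prime, 0 ≤ Real.log q / √(y / 2) := fun q _ =>
        div_nonneg (Real.log_natCast_nonneg q) (Real.sqrt_nonneg _)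
      refine le_trans (sum_le_sum fun q hq => ?_)
        (sum_le_sum_of_subset_of_nonneg sdiff_subset fun q hq _ => hnn q hq)
      rw [mem_sdiff, mem_filter, mem_filter, mem_Icc, mem_Icc] at hq
      have hq1 : 1 ≤ q := hq.1.1.1
      have hlt : y / 2 < q := by
        by_contra h
        exact hq.2 ⟨⟨hq1, Nat.le_floor (not_lt.1 h)⟩, hq.1.2⟩
      rcases hy.eq_or_lt with rfl | hy0
      · have h3 := hq.1.1.2
        simp at h3
        omega
      · refine div_le_div_of_nonneg_left (Real.log_natCast_nonneg q) (by positivity) ?_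
        exact Real.sqrt_le_sqrt hlt.le
    have h3 : ∑ q ∈ (Icc 1 ⌊y⌋₊).filter Nat.Prime, Real.log q / √(y / 2) =
        Chebyshev.theta y / √(y / 2) := by
      rw [← sum_div]
      congr 1
    have h4 := Chebyshev.theta_le_log4_mul_x hy
    have hlog4 : Real.log 4 ≤ 1.39 := by
      rw [show (4 : ℝ) = 2 ^ 2 by norm_num, Real.log_pow]
      have := Real.log_two_lt_d9
      push_cast
      linarith
    rcases hy.eq_or_lt with rfl | hy0
    · simp
    have hs : √y = √2 * √(y / 2) := by
      rw [← Real.sqrt_mul (by norm_num)]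
      congr 1
      ring
    have hsp : 0 < √(y / 2) := by positivity
    have h5 : Chebyshev.theta y / √(y / 2) ≤ 2.78 * √(y / 2) := by
      rw [div_le_iff₀ hsp, mul_assoc, Real.mul_self_sqrt (by positivity)]
      nlinarith
    have hs2 : (1.4 : ℝ) ≤ √2 := Real.le_sqrt_of_sq_le (by norm_num)
    rw [hs]
    nlinarith

/-- After interchanging the sums, q < b contributes √q · 8x log q / q, and the preceding sum over q
gives 8 · 7 = 56. -/
lemma sum_log_mul_sum_sqrt_le (x : ℕ) {b : ℝ} (hb : 0 ≤ b) :
    ∑ p ∈ (Icc 5 x).filter Nat.Prime, Real.log p * ∑ q ∈ smallFactors b (p - 1), √(q : ℝ) ≤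
      56 * x * √b := by
  classical
  set S := (Icc 1 ⌊b⌋₊).filter Nat.Prime with hS
  have hnn : ∀ p q : ℕ, 0 ≤ Real.log p * √(q : ℝ) := fun p q =>
    mul_nonneg (Real.log_natCast_nonneg p) (Real.sqrt_nonneg _)
  calc _ ≤ ∑ p ∈ (Icc 5 x).filter Nat.Prime, ∑ q ∈ S,
        if q ∣ p - 1 then Real.log p * √(q : ℝ) else 0 := by
        refine sum_le_sum fun p hp => ?_
        rw [mul_sum, ← sum_filter]
        refine sum_le_sum_of_subset_of_nonneg (fun q hq => ?_) fun q _ _ => hnn p q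
        rw [mem_smallFactors, Nat.mem_primeFactors] at hq
        rw [mem_filter, hS, mem_filter, mem_Icc]
        exact ⟨⟨⟨hq.1.1.one_lt.le, Nat.le_floor hq.2.le⟩, hq.1.1⟩, hq.1.2.1⟩
    _ = ∑ q ∈ S, ∑ p ∈ (Icc 5 x).filter Nat.Prime,
        if q ∣ p - 1 then Real.log p * √(q : ℝ) else 0 := sum_comm
    _ ≤ ∑ q ∈ S, √(q : ℝ) * (8 * x * (Real.log q / q)) := by
        refine sum_le_sum fun q hq => ?_
        rw [hS, mem_filter] at hq
        refine le_trans ?_ (mul_le_mul_of_nonneg_left (sum_log_primesOneMod_le hq.2 x)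
          (Real.sqrt_nonneg _))
        rw [mul_sum, ← sum_filter]
        simp_rw [mul_comm (√(q : ℝ))]
        refine sum_le_sum_of_subset_of_nonneg (fun p hp => ?_) fun p _ _ => hnn p q
        rw [mem_filter, mem_filter, mem_Icc] at hp
        exact mem_primesOneMod.2 ⟨hp.1.1.2, hp.1.2, hp.2⟩
    _ = 8 * x * ∑ q ∈ S, Real.log q / √(q : ℝ) := by
        rw [mul_sum]
        refine sum_congr rfl fun q hq => ?_
        rw [hS, mem_filter] at hq
        have hq0 : (0 : ℝ) < q := by exact_mod_cast hq.2.pos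
        have h1 : (q : ℝ) = √(q : ℝ) * √(q : ℝ) := (Real.mul_self_sqrt hq0.le).symm
        have h2 : 0 < √(q : ℝ) := Real.sqrt_pos.2 hq0
        nth_rw 3 [h1]
        field_simp
    _ ≤ 8 * x * (7 * √b) := by
        gcongr
        exact sum_log_div_sqrt_le b hb
    _ = _ := by ring

end primeSums

end ProbRoot

namespace ProbRoot

/-! ### The number of prime factors of shifted primes -/

section omega

open Finset

lemma two_pow_card_primeFactors_le {n : ℕ} (hn : n ≠ 0) :
    2 ^ n.primeFactors.card ≤ n.divisors.card := by
  rw [Nat.card_divisors hn, ← prod_const]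
  refine prod_le_prod' fun q hq => ?_
  have := (Nat.prime_of_mem_primeFactors hq).factorization_pos_of_dvd hn
    (Nat.dvd_of_mem_primeFactors hq)
  omega

lemma sum_card_divisors_le (x : ℕ) :
    ∑ n ∈ Ioc 0 x, (n.divisors.card : ℝ) ≤ x * (1 + Real.log x) := by
  have h1 := ArithmeticFunction.sum_Ioc_sigma0_eq_sum_div x
  simp only [ArithmeticFunction.sigma_zero_apply] at h1
  have h2 : ∑ n ∈ Ioc 0 x, (n.divisors.card : ℝ) = ∑ n ∈ Ioc 0 x, ((x / n : ℕ) : ℝ) := by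
    exact_mod_cast h1
  rw [h2]
  calc ∑ n ∈ Ioc 0 x, ((x / n : ℕ) : ℝ) ≤ ∑ n ∈ Ioc 0 x, (x : ℝ) * (n : ℝ)⁻¹ :=
        sum_le_sum fun n _ => Nat.cast_div_le.trans (le_of_eq (div_eq_mul_inv _ _))
    _ = x * (harmonic x : ℝ) := by
        rw [← mul_sum, harmonic_eq_sum_Icc]
        push_cast
        rfl
    _ ≤ _ := by
        gcongr
        exact harmonic_le_one_add_log x

lemma sum_two_pow_card_primeFactors_le (x : ℕ) :
    ∑ p ∈ (Icc 5 x).filter Nat.Prime, (2 : ℝ) ^ (p - 1).primeFactors.card ≤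
      x * (1 + Real.log x) := by
  refine le_trans ?_ (sum_card_divisors_le x)
  have h1 : ∑ p ∈ (Icc 5 x).filter Nat.Prime, (2 : ℝ) ^ (p - 1).primeFactors.card ≤
      ∑ p ∈ (Icc 5 x).filter Nat.Prime, ((p - 1).divisors.card : ℝ) := by
    refine sum_le_sum fun p hp => ?_
    rw [mem_filter, mem_Icc] at hp
    exact_mod_cast two_pow_card_primeFactors_le (n := p - 1) (by omega)
  refine h1.trans ?_
  have hinj : Set.InjOn (fun p : ℕ => p - 1) ((Icc 5 x).filter Nat.Prime : Finset ℕ) := by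
    intro a ha b hb hab
    rw [mem_coe, mem_filter, mem_Icc] at ha hb
    dsimp only at hab
    omega
  rw [← sum_image (f := fun n : ℕ => (n.divisors.card : ℝ)) hinj]
  refine sum_le_sum_of_subset_of_nonneg (fun n hn => ?_) fun _ _ _ => Nat.cast_nonneg _
  rw [mem_image] at hn
  obtain ⟨p, hp, rfl⟩ := hn
  rw [mem_filter, mem_Icc] at hp
  rw [mem_Ioc]
  omega

/-- Beyond t = 6 log X one has 2^t / X^2 ≥ e^(t/3), as log 2 ≥ 2/3, and t^k ≤ k! 3^k e^(t/3). So the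
mean of 2^ω controls every moment of ω. -/
lemma pow_le_add_two_pow {X : ℝ} (hX : 1 ≤ X) (t k : ℕ) :
    (t : ℝ) ^ k ≤ (6 * Real.log X) ^ k + k.factorial * 3 ^ k * (2 ^ t / X ^ 2) := by
  have hL : 0 ≤ Real.log X := Real.log_nonneg hX
  rcases le_total (t : ℝ) (6 * Real.log X) with h | h
  · have h1 : (t : ℝ) ^ k ≤ (6 * Real.log X) ^ k := pow_le_pow_left₀ (by positivity) h k
    have h2 : 0 ≤ (k.factorial : ℝ) * 3 ^ k * (2 ^ t / X ^ 2) := by positivity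
    linarith
  · have hl2 := Real.log_two_gt_d9
    have h1 := Real.pow_div_factorial_le_exp (x := (t : ℝ) / 3) (by positivity) k
    rw [div_le_iff₀ (by positivity), div_pow, div_le_iff₀ (by positivity)] at h1
    have h2 : Real.exp ((t : ℝ) / 3) ≤ 2 ^ t / X ^ 2 := by
      rw [le_div_iff₀ (by positivity)]
      have h3 : X ^ 2 = Real.exp (2 * Real.log X) := by
        rw [mul_comm, Real.exp_mul, Real.exp_log (by linarith)]
        norm_cast
      have h4 : (2 : ℝ) ^ t = Real.exp (t * Real.log 2) := by
        rw [mul_comm, Real.exp_mul, Real.exp_log (by norm_num), Real.rpow_natCast]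
      rw [h3, h4, ← Real.exp_add]
      refine Real.exp_le_exp.2 ?_
      nlinarith
    have h5 : 0 ≤ (6 * Real.log X) ^ k := by positivity
    calc (t : ℝ) ^ k ≤ Real.exp ((t : ℝ) / 3) * k.factorial * 3 ^ k := h1
      _ ≤ 2 ^ t / X ^ 2 * k.factorial * 3 ^ k := by gcongr
      _ ≤ _ := by nlinarith

lemma card_primes_le {x : ℕ} (hx : 2 ≤ x) :
    (((Icc 5 x).filter Nat.Prime).card : ℝ) ≤ 5 * x / Real.log x := by
  have hx' : (2 : ℝ) ≤ x := by exact_mod_cast hx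
  have hX : 0 < Real.log x := Real.log_pos (by linarith)
  have h1 := Chebyshev.pi_le_log4_mul_div (x := (x : ℝ)) (by linarith)
  have h2 : ((Icc 5 x).filter Nat.Prime).card ≤ Nat.primeCounting ⌊(x : ℝ)⌋₊ := by
    rw [Nat.floor_natCast, Nat.primeCounting, Nat.primeCounting', Nat.count_eq_card_filter_range]
    refine card_le_card fun p hp => ?_
    rw [mem_filter, mem_Icc] at hp
    rw [mem_filter, mem_range]
    exact ⟨by omega, hp.2⟩
  have hs : Real.log √x = Real.log x / 2 := Real.log_sqrt (by linarith)
  have hlog4 : Real.log 4 ≤ 1.39 := by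
    rw [show (4 : ℝ) = 2 ^ 2 by norm_num, Real.log_pow]
    have := Real.log_two_lt_d9
    push_cast
    linarith
  have h3 : Real.log x ≤ 2 * √x := by
    have := Real.log_le_sub_one_of_pos (show 0 < √(x : ℝ) by positivity)
    linarith
  have h4 : √(x : ℝ) * √x = x := Real.mul_self_sqrt (by linarith)
  have h5 : √(x : ℝ) ≤ 2 * x / Real.log x := by
    rw [le_div_iff₀ hX]
    nlinarith [Real.sqrt_nonneg (x : ℝ)]
  have h6 : Real.log 4 * x / Real.log √x ≤ 2.78 * x / Real.log x := by
    rw [hs, div_div_eq_mul_div]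
    refine div_le_div_of_nonneg_right ?_ hX.le
    nlinarith
  have h7 : (((Icc 5 x).filter Nat.Prime).card : ℝ) ≤ Nat.primeCounting ⌊(x : ℝ)⌋₊ := by
    exact_mod_cast h2
  calc _ ≤ 2.78 * x / Real.log x + 2 * x / Real.log x := by linarith
    _ = 4.78 * x / Real.log x := by ring
    _ ≤ _ := by gcongr; norm_num

/-- The constant in the bound for the `k`-th moment of the number of prime factors of shifted
primes. -/
noncomputable def momentBound (k : ℕ) : ℝ := 6 ^ k * 5 + k.factorial * 3 ^ k * 2 * (5 / 2) ^ k

lemma momentBound_pos (k : ℕ) : 0 < momentBound k := by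
  unfold momentBound
  positivity

lemma two_fifths_le_log_log {x : ℝ} (hx : 5 ≤ x) : 2 / 5 ≤ Real.log (Real.log x) := by
  have h1 : (1.6 : ℝ) ≤ Real.log x := by
    rw [Real.le_log_iff_exp_le (by linarith)]
    have h3 : Real.exp 1.6 ^ 5 ≤ 5 ^ 5 := by
      rw [← Real.exp_nat_mul, show ((5 : ℕ) : ℝ) * 1.6 = ((8 : ℕ) : ℝ) * 1 by norm_num,
        Real.exp_nat_mul]
      have := Real.exp_one_lt_d9
      calc Real.exp 1 ^ 8 ≤ 2.72 ^ 8 := by gcongr; linarith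
        _ ≤ _ := by norm_num
    exact (le_of_pow_le_pow_left₀ (by norm_num) (by norm_num) h3).trans hx
  rw [Real.le_log_iff_exp_le (by linarith)]
  have h3 : Real.exp (2 / 5) ^ 5 ≤ 1.6 ^ 5 := by
    rw [← Real.exp_nat_mul, show ((5 : ℕ) : ℝ) * (2 / 5) = ((2 : ℕ) : ℝ) * 1 by norm_num,
      Real.exp_nat_mul]
    have := Real.exp_one_lt_d9
    calc Real.exp 1 ^ 2 ≤ 2.72 ^ 2 := by gcongr; linarith
      _ ≤ _ := by norm_num
  exact (le_of_pow_le_pow_left₀ (by norm_num) (by norm_num) h3).trans h1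

lemma one_le_log {x : ℝ} (hx : 5 ≤ x) : 1 ≤ Real.log x := by
  rw [Real.le_log_iff_exp_le (by linarith)]
  linarith [Real.exp_one_lt_d9]

/-- With X = log x, the sum of 2^ω over p is at most x(1 + X), and division by X² brings it down to
the order x/X of the number of primes. As log log x ≥ 2/5, the factor (5/2)^k merges this with the
main term. -/
lemma sum_card_primeFactors_pow_le {x : ℕ} (hx : 5 ≤ x) (k : ℕ) :
    ∑ p ∈ (Icc 5 x).filter Nat.Prime, ((p - 1).primeFactors.card : ℝ) ^ k ≤
      momentBound k * Real.log (Real.log x) ^ k * x / Real.log x := by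
  have hx' : (5 : ℝ) ≤ x := by exact_mod_cast hx
  have hX := one_le_log hx'
  have hLL := two_fifths_le_log_log hx'
  set X := Real.log x with hXd
  set LL := Real.log X with hLLd
  have h1 : (1 : ℝ) ≤ (5 / 2) ^ k * LL ^ k := by
    rw [← mul_pow]
    exact one_le_pow₀ (by linarith)
  calc _ ≤ ∑ p ∈ (Icc 5 x).filter Nat.Prime, ((6 * LL) ^ k + k.factorial * 3 ^ k *
        (2 ^ (p - 1).primeFactors.card / X ^ 2)) :=
        sum_le_sum fun p _ => pow_le_add_two_pow hX _ k
    _ = ((Icc 5 x).filter Nat.Prime).card * (6 * LL) ^ k + k.factorial * 3 ^ k *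
        ((∑ p ∈ (Icc 5 x).filter Nat.Prime, (2 : ℝ) ^ (p - 1).primeFactors.card) / X ^ 2) := by
        rw [sum_add_distrib, sum_const, nsmul_eq_mul, ← mul_sum, sum_div]
    _ ≤ 5 * x / X * (6 * LL) ^ k + k.factorial * 3 ^ k * (x * (1 + X) / X ^ 2) := by
        gcongr
        · exact card_primes_le (by omega)
        · exact sum_two_pow_card_primeFactors_le x
    _ ≤ 5 * x / X * (6 * LL) ^ k + k.factorial * 3 ^ k * ((5 / 2) ^ k * LL ^ k * (2 * x / X)) := by
        have h2 : x * (1 + X) / X ^ 2 ≤ 2 * x / X := by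
          rw [div_le_div_iff₀ (by positivity) (by positivity)]
          nlinarith [mul_nonneg (show (0 : ℝ) ≤ x by linarith) (show 0 ≤ X * (X - 1) by nlinarith)]
        have h3 : 2 * x / X ≤ (5 / 2) ^ k * LL ^ k * (2 * x / X) :=
          le_mul_of_one_le_left (by positivity) h1
        gcongr
        exact h2.trans h3
    _ = _ := by
        unfold momentBound
        rw [mul_pow]
        ring

end omega

end ProbRoot

namespace ProbRoot

/-! ### A lower bound for the average order -/

section averageOrder

open Finset

/-- The order of magnitude of the running time for the prime `p`. -/
noncomputable def timeOrder (ε : ℝ) (p : ℕ) : ℝ :=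
  √(1 / ε) * Real.log p ^ (5 / 2 : ℝ) + Real.log p ^ 3 * Real.log (Real.log p)

lemma rpow_five_halves {y : ℝ} (hy : 0 ≤ y) : y ^ (5 / 2 : ℝ) = y ^ 2 * √y := by
  rw [Real.sqrt_eq_rpow, show (5 / 2 : ℝ) = (2 : ℕ) + 1 / 2 by norm_num,
    Real.rpow_add' hy (by norm_num), Real.rpow_natCast]

lemma timeOrder_nonneg {ε : ℝ} {p : ℕ} (hp : 5 ≤ p) : 0 ≤ timeOrder ε p := by
  have hp' : (5 : ℝ) ≤ p := by exact_mod_cast hp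
  have h1 := one_le_log hp'
  have h2 := two_fifths_le_log_log hp'
  unfold timeOrder
  positivity

lemma sqrt_add_one_le_timeOrder {ε : ℝ} {p : ℕ} (hp : 5 ≤ p) :
    2 / 5 * (√(1 / ε) + 1) ≤ timeOrder ε p := by
  have hp' : (5 : ℝ) ≤ p := by exact_mod_cast hp
  have h1 := one_le_log hp'
  have h2 := two_fifths_le_log_log hp'
  have h3 : (1 : ℝ) ≤ Real.log p ^ (5 / 2 : ℝ) := Real.one_le_rpow h1 (by norm_num)
  have h4 : (1 : ℝ) ≤ Real.log p ^ 3 := one_le_pow₀ h1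
  have h5 := Real.sqrt_nonneg (1 / ε)
  unfold timeOrder
  nlinarith

/-- Chebyshev's lower bound survives the removal of the primes up to √x; the remaining ones satisfy
log p ≥ (log x)/2. -/
lemma card_primes_gt_sqrt_ge {x : ℕ} (hx : 10 ^ 8 ≤ x) :
    x / (2 * Real.log x) ≤ (((Icc 5 x).filter Nat.Prime).filter fun p => x < p ^ 2).card := by
  have hx' : (10 : ℝ) ^ 8 ≤ x := by exact_mod_cast hx
  have hx0 : (0 : ℝ) < x := by linarith
  set r := √√(x : ℝ) with hr
  have hr2 : r ^ 2 = √x := Real.sq_sqrt (Real.sqrt_nonneg _)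
  have hr4 : r ^ 4 = x := by
    rw [show r ^ 4 = (r ^ 2) ^ 2 by ring, hr2, Real.sq_sqrt hx0.le]
  have hr100 : 100 ≤ r := by
    refine le_of_pow_le_pow_left₀ (n := 4) (by norm_num) (Real.sqrt_nonneg _) ?_
    rw [hr4]
    linarith
  have hlog : Real.log x ≤ 4 * r := by
    rw [← hr4, Real.log_pow]
    have := Real.log_le_sub_one_of_pos (show 0 < r by linarith)
    push_cast
    linarith
  have hX : 0 < Real.log x := Real.log_pos (by linarith)
  have hlog1 : Real.log (x + 1) ≤ 2 * Real.log x := by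
    rw [← Real.log_rpow hx0]
    refine Real.log_le_log (by linarith) ?_
    norm_cast
    nlinarith
  have hpi := Chebyshev.pi_ge x
  rw [div_le_iff₀ hX] at hpi
  have hcard : Nat.primeCounting x ≤
      (((Icc 5 x).filter Nat.Prime).filter fun p => x < p ^ 2).card + Nat.sqrt x := by
    rw [Nat.primeCounting, Nat.primeCounting', Nat.count_eq_card_filter_range]
    have hsub : (range (x + 1)).filter Nat.Prime ⊆
        ((Icc 5 x).filter Nat.Prime).filter (fun p => x < p ^ 2) ∪ Icc 1 (Nat.sqrt x) := by
      intro p hp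
      rw [mem_filter, mem_range] at hp
      rw [mem_union, mem_filter, mem_filter, mem_Icc, mem_Icc, Nat.le_sqrt']
      rcases lt_or_ge x (p ^ 2) with h | h
      · left
        refine ⟨⟨⟨?_, by omega⟩, hp.2⟩, h⟩
        by_contra h5
        have : p ^ 2 ≤ 4 ^ 2 := Nat.pow_le_pow_left (by omega) 2
        omega
      · exact Or.inr ⟨hp.2.one_lt.le, h⟩
    refine (card_le_card hsub).trans ((card_union_le _ _).trans ?_)
    rw [Nat.card_Icc, Nat.add_sub_cancel]
  have hcard' : (Nat.primeCounting x : ℝ) ≤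
      (((Icc 5 x).filter Nat.Prime).filter fun p => x < p ^ 2).card + √x := by
    have h1 : ((Nat.sqrt x : ℕ) : ℝ) ≤ √x := Real.nat_sqrt_le_real_sqrt
    have h2 : (Nat.primeCounting x : ℝ) ≤
      (((Icc 5 x).filter Nat.Prime).filter fun p => x < p ^ 2).card + (Nat.sqrt x : ℕ) := by
      exact_mod_cast hcard
    linarith
  rw [div_le_iff₀ (by positivity)]
  set N := ((((Icc 5 x).filter Nat.Prime).filter fun p => x < p ^ 2).card : ℝ) with hN
  have h1 : (x : ℝ) * Real.log 2 - Real.log (x + 1) ≤ (N + √x) * Real.log x :=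
    hpi.trans (mul_le_mul_of_nonneg_right hcard' hX.le)
  have hl2 := Real.log_two_gt_d9
  have h2 : √(x : ℝ) * Real.log x ≤ x / 25 := by
    rw [← hr2]
    calc r ^ 2 * Real.log x ≤ r ^ 2 * (4 * r) := by gcongr
      _ ≤ r ^ 4 / 25 := by nlinarith [pow_pos (show 0 < r by linarith) 3]
      _ = x / 25 := by rw [hr4]
  have h3 : 2 * Real.log x ≤ x / 25 := by
    refine le_trans (mul_le_mul_of_nonneg_right ?_ hX.le) h2
    rw [← hr2]
    nlinarith
  nlinarith

/-- A lower bound for the sum of the orders of magnitude. -/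
lemma le_sum_timeOrder {ε : ℝ} {x : ℕ} (hx : 5 ≤ x) :
    1 / 10 ^ 33 * (x * (Real.log x * √(Real.log x) * √(1 / ε) +
      Real.log x ^ 2 * Real.log (Real.log x))) ≤
    ∑ p ∈ (Icc 5 x).filter Nat.Prime, timeOrder ε p := by
  have hx' : (5 : ℝ) ≤ x := by exact_mod_cast hx
  have hX := one_le_log hx'
  have hLL := two_fifths_le_log_log hx'
  set X := Real.log x with hXd
  set LL := Real.log X with hLLd
  have hLLX : LL ≤ X := (Real.log_le_sub_one_of_pos (by linarith)).trans (by linarith)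
  have hS := Real.sqrt_nonneg (1 / ε)
  set S := √(1 / ε) with hSd
  have hnn : ∀ p ∈ (Icc 5 x).filter Nat.Prime, 0 ≤ timeOrder ε p := fun p hp =>
    timeOrder_nonneg (mem_Icc.1 (mem_filter.1 hp).1).1
  have hsX : √X ≤ X := (Real.sqrt_le_left (by linarith)).2 (by nlinarith)
  -- For small x the prime 5 alone suffices: x and log x are at most 10^8, so the left side is at
  -- most 1/10 of √(1/ε) + 1.
  rcases lt_or_ge x (10 ^ 8) with hlt | hge
  · have hlt' : (x : ℝ) ≤ 10 ^ 8 := by exact_mod_cast hlt.le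
    have hXx : X ≤ 10 ^ 8 := by
      have := Real.log_le_sub_one_of_pos (show (0 : ℝ) < x by linarith)
      linarith
    have h5 : (5 : ℕ) ∈ (Icc 5 x).filter Nat.Prime :=
      mem_filter.2 ⟨mem_Icc.2 ⟨le_rfl, hx⟩, by norm_num⟩
    refine le_trans ?_ ((sqrt_add_one_le_timeOrder le_rfl).trans (single_le_sum hnn h5))
    calc _ ≤ 1 / 10 ^ 33 * ((10 : ℝ) ^ 8 * (10 ^ 8 * 10 ^ 8 * S + (10 ^ 8) ^ 2 * 10 ^ 8)) := by
          gcongr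
          · exact hsX.trans hXx
          · exact hLLX.trans hXx
      _ ≤ _ := by nlinarith
  · have hcard := card_primes_gt_sqrt_ge hge
    have hX4 : 4 ≤ X := by
      rw [hXd, Real.le_log_iff_exp_le (by linarith)]
      have h1 : Real.exp 4 = Real.exp 1 ^ 4 := by rw [← Real.exp_nat_mul]; norm_num
      have h2 : Real.exp 1 ^ 4 ≤ 3 ^ 4 := by
        gcongr
        linarith [Real.exp_one_lt_d9]
      have h3 : (10 : ℝ) ^ 8 ≤ x := by exact_mod_cast hge
      rw [h1]
      linarith
    have hterm : ∀ p ∈ ((Icc 5 x).filter Nat.Prime).filter (fun p => x < p ^ 2),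
        S * (X ^ 2 / 4 * (√X / 2)) + X ^ 3 / 8 * (LL / 2) ≤ timeOrder ε p := by
      intro p hp
      rw [mem_filter, mem_filter, mem_Icc] at hp
      have hp5 : (5 : ℝ) ≤ p := by exact_mod_cast hp.1.1.1
      have hlp : X / 2 ≤ Real.log p := by
        have h1 : (x : ℝ) ≤ (p : ℝ) ^ 2 := by exact_mod_cast hp.2.le
        have h2 := Real.log_le_log (by linarith) h1
        rw [Real.log_pow] at h2
        push_cast at h2
        linarith
      have h2 : √X / 2 ≤ √(Real.log p) := by
        rw [div_le_iff₀ (by norm_num), Real.sqrt_le_iff]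
        refine ⟨by positivity, ?_⟩
        rw [mul_pow, Real.sq_sqrt (by linarith)]
        linarith
      have h3 : LL / 2 ≤ Real.log (Real.log p) := by
        have h4 : √X ≤ X / 2 := by
          rw [Real.sqrt_le_iff]
          exact ⟨by linarith, by nlinarith⟩
        have h5 : LL / 2 = Real.log √X := by rw [Real.log_sqrt (by linarith)]
        rw [h5]
        exact Real.log_le_log (Real.sqrt_pos.2 (by linarith)) (h4.trans hlp)
      have h4 : X ^ 2 / 4 ≤ Real.log p ^ 2 := by
        have := pow_le_pow_left₀ (by linarith) hlp 2
        linarith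
      have h5 : X ^ 3 / 8 ≤ Real.log p ^ 3 := by
        have := pow_le_pow_left₀ (by linarith) hlp 3
        linarith
      unfold timeOrder
      rw [rpow_five_halves (by linarith)]
      gcongr
    have hsum : ((((Icc 5 x).filter Nat.Prime).filter fun p => x < p ^ 2).card : ℝ) *
        (S * (X ^ 2 / 4 * (√X / 2)) + X ^ 3 / 8 * (LL / 2)) ≤
        ∑ p ∈ (Icc 5 x).filter Nat.Prime, timeOrder ε p := by
      rw [← nsmul_eq_mul, ← sum_const]
      exact (sum_le_sum hterm).trans
        (sum_le_sum_of_subset_of_nonneg (filter_subset _ _) fun p hp _ => hnn p hp)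
    have hK : 0 ≤ S * (X ^ 2 / 4 * (√X / 2)) + X ^ 3 / 8 * (LL / 2) := by positivity
    refine le_trans ?_ ((mul_le_mul_of_nonneg_right hcard hK).trans hsum)
    have h1 : x / (2 * X) * (S * (X ^ 2 / 4 * (√X / 2)) + X ^ 3 / 8 * (LL / 2)) =
        x * (X * √X * S / 16 + X ^ 2 * LL / 32) := by
      field_simp
      ring
    rw [h1]
    have h2 : 0 ≤ X * √X * S := by positivity
    have h3 : 0 ≤ X ^ 2 * LL := by positivity
    have hx0 : (0 : ℝ) ≤ x := by linarith
    calc _ = (x : ℝ) * (1 / 10 ^ 33 * (X * √X * S) + 1 / 10 ^ 33 * (X ^ 2 * LL)) := by ring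
      _ ≤ _ := by
        refine mul_le_mul_of_nonneg_left ?_ hx0
        linarith

end averageOrder

end ProbRoot

namespace ProbRoot

open scoped ENNReal

/-! ### The average running time -/

section averageTime

open Finset

/-- The constant in the decay of the weights of large primes. -/
noncomputable def growthBound : ℝ := 4 / (1 - meetBound)

lemma growthBound_pos : 0 < growthBound :=
  div_pos (by norm_num) (by linarith [meetBound_lt_one])

variable {p q k : ℕ} {B b : ℝ}

lemma togetherBound_div_le : togetherBound q / (1 - meetBound) ≤ growthBound := by
  have h1 : 0 < 1 - meetBound := by linarith [meetBound_lt_one]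
  have h2 : togetherBound q ≤ 4 := by
    have : togetherBound q ≤ meetBound := min_le_left _ _
    linarith [meetBound_lt_one]
  exact div_le_div_of_nonneg_right h2 h1.le

/-- The decay 4 q^(-1/10) of τ lowers √q to q^(2/5) for all runs after the first. -/
lemma sqrt_mul_togetherBound_div_le (hq : 0 < q) (hqb : (q : ℝ) ≤ b) :
    √q * (togetherBound q / (1 - meetBound)) ≤ growthBound * b ^ (2 / 5 : ℝ) := by
  have h1 : 0 < 1 - meetBound := by linarith [meetBound_lt_one]
  have hq0 : (0 : ℝ) < q := by exact_mod_cast hq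
  have h2 : togetherBound q ≤ 4 * (q : ℝ) ^ (-(1 / 10) : ℝ) := min_le_right _ _
  have h3 : √(q : ℝ) * (q : ℝ) ^ (-(1 / 10) : ℝ) = (q : ℝ) ^ (2 / 5 : ℝ) := by
    rw [Real.sqrt_eq_rpow, ← Real.rpow_add hq0]
    norm_num
  have h4 : (q : ℝ) ^ (2 / 5 : ℝ) ≤ b ^ (2 / 5 : ℝ) :=
    Real.rpow_le_rpow hq0.le hqb (by norm_num)
  calc √q * (togetherBound q / (1 - meetBound))
      ≤ √q * (4 * (q : ℝ) ^ (-(1 / 10) : ℝ) / (1 - meetBound)) := by gcongr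
    _ = growthBound * (√(q : ℝ) * (q : ℝ) ^ (-(1 / 10) : ℝ)) := by
        unfold growthBound
        ring
    _ ≤ _ := by
        rw [h3]
        exact mul_le_mul_of_nonneg_left h4 growthBound_pos.le

lemma growth_le_one_add {m : ℕ} (hk : k ≤ m) :
    growth q k ≤ ENNReal.ofReal (1 + togetherBound q / (1 - meetBound) * m) := by
  have h0 := togetherBound_nonneg q
  have h1 : 0 < 1 - meetBound := by linarith [meetBound_lt_one]
  rw [ENNReal.ofReal_add zero_le_one (by positivity), ENNReal.ofReal_one,
    ENNReal.ofReal_mul (by positivity), ENNReal.ofReal_natCast]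
  unfold growth
  refine add_le_add (by split_ifs <;> simp) (mul_le_mul_right ?_ _)
  exact_mod_cast (Nat.sub_le k 1).trans hk

lemma factorization_le_size : (p - 1).factorization q ≤ p.size := by
  rcases Nat.eq_zero_or_pos (p - 1) with h | h
  · simp [h]
  by_cases hq : q.Prime
  · have h1 : (p - 1).factorization q < (p - 1).size :=
      Nat.lt_size.2 ((Nat.pow_le_pow_left hq.two_le _).trans
        (Nat.le_of_dvd h (Nat.ordProj_dvd (p - 1) q)))
    exact h1.le.trans (Nat.size_le_size (Nat.sub_le _ _))
  · rw [Nat.factorization_eq_zero_of_not_prime _ hq]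
    exact Nat.zero_le _

/-- The term 10√q keeps a coefficient free of ω; powers of ω occur only next to b^(2/5) or to terms
without b. This avoids a factor log log p in the main term. -/
lemma primeCost_le (hk : k ≤ (p - 1).primeFactors.card) (hω : 1 ≤ (p - 1).primeFactors.card)
    (hq : 0 < q) (hqb : (q : ℝ) ≤ b) :
    primeCost p q k ≤ ENNReal.ofReal (p.size + 10 * √q +
      10 * growthBound * (p - 1).primeFactors.card * b ^ (2 / 5 : ℝ) +
        (3 + hitCost p) * (1 + growthBound) * (p - 1).primeFactors.card ^ 2) := by
  set ω := (p - 1).primeFactors.card with hωd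
  have h0 := togetherBound_nonneg q
  have h1 : 0 < 1 - meetBound := by linarith [meetBound_lt_one]
  have hω' : (1 : ℝ) ≤ ω := by exact_mod_cast hω
  have hrun : runCost p q = ENNReal.ofReal (10 * √q + 3 + ω * hitCost p) := by
    unfold runCost
    rw [ENNReal.ofReal_add (by positivity) (by positivity),
      ENNReal.ofReal_add (by positivity) (by positivity),
      ENNReal.ofReal_mul (p := (ω : ℝ)) (by positivity), ENNReal.ofReal_natCast,
      ENNReal.ofReal_natCast]
    simp [hωd]
  unfold primeCost
  rw [hrun]
  refine (add_le_add (Nat.cast_le.2 factorization_le_size)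
    (mul_le_mul_right (growth_le_one_add hk) _)).trans ?_
  set γ := togetherBound q / (1 - meetBound) with hγ
  have hγ0 : 0 ≤ γ := by positivity
  have hγ1 : γ ≤ growthBound := togetherBound_div_le
  have hγ2 : √q * γ ≤ growthBound * b ^ (2 / 5 : ℝ) := sqrt_mul_togetherBound_div_le hq hqb
  have hG := growthBound_pos
  rw [← ENNReal.ofReal_mul (by positivity), ← ENNReal.ofReal_natCast,
    ← ENNReal.ofReal_add (by positivity) (by positivity)]
  refine ENNReal.ofReal_le_ofReal ?_
  have hh : (0 : ℝ) ≤ hitCost p := Nat.cast_nonneg _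
  have h2 : (3 + ω * hitCost p : ℝ) ≤ ω * (3 + hitCost p) := by nlinarith
  have h3 : 1 + γ * ω ≤ (1 + growthBound) * ω := by nlinarith
  have h4 : (3 + ω * hitCost p : ℝ) * (1 + γ * ω) ≤
      ω * (3 + hitCost p) * ((1 + growthBound) * ω) := by gcongr
  have h5 : √q * γ * ω ≤ growthBound * b ^ (2 / 5 : ℝ) * ω := by gcongr
  nlinarith

/-- An explicit bound for the expected number of operations. -/
lemma totalBound_le (hp : 3 ≤ p) (hB : B ≤ b) (hb : 0 ≤ b) :
    totalBound p B ≤ ENNReal.ofReal (10 * ∑ q ∈ smallFactors b (p - 1), √(q : ℝ) +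
      10 * growthBound * b ^ (2 / 5 : ℝ) * (p - 1).primeFactors.card ^ 3 +
      31 * p.size * (p - 1).primeFactors.card +
      (3 + hitCost p) * (1 + growthBound) * (p - 1).primeFactors.card ^ 3) := by
  have hω : 1 ≤ (p - 1).primeFactors.card :=
    Finset.card_pos.2 (Nat.nonempty_primeFactors.2 (by omega))
  set n := (p - 1) / 2 ^ (p - 1).factorization 2 with hn
  have hnd : n ∣ p - 1 := Nat.ordCompl_dvd _ _
  have hsub : n.primeFactors ⊆ (p - 1).primeFactors := Nat.primeFactors_mono hnd (by omega)
  have hcard : n.primeFactors.card ≤ (p - 1).primeFactors.card := card_le_card hsub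
  set S := smallFactors b (p - 1) with hS
  have hSsub : smallFactors B n ⊆ S := by
    intro q hq
    rw [mem_smallFactors] at hq
    rw [hS, mem_smallFactors]
    exact ⟨hsub hq.1, hq.2.trans_le hB⟩
  have hScard : S.card ≤ (p - 1).primeFactors.card :=
    card_le_card fun q hq => (mem_smallFactors.1 hq).1
  set ω := (p - 1).primeFactors.card with hωd
  have hω' : (1 : ℝ) ≤ ω := by exact_mod_cast hω
  have hG := growthBound_pos
  set K : ℝ := p.size + 10 * growthBound * ω * b ^ (2 / 5 : ℝ) +
    (3 + hitCost p) * (1 + growthBound) * ω ^ 2 with hK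
  have hK0 : 0 ≤ K := by positivity
  have hitem : itemCost p B n ≤
      ENNReal.ofReal (2 + (10 * ∑ q ∈ S, √(q : ℝ) + ω * K)) := by
    unfold itemCost
    rw [ENNReal.ofReal_add (by norm_num) (by positivity)]
    refine add_le_add (by simp) ?_
    calc ∑ q ∈ smallFactors B n, primeCost p q n.primeFactors.card
        ≤ ∑ q ∈ smallFactors B n, ENNReal.ofReal (10 * √(q : ℝ) + K) := by
          refine sum_le_sum fun q hq => ?_
          have h1 := mem_smallFactors.1 (hSsub hq)
          refine (primeCost_le hcard hω (Nat.prime_of_mem_primeFactors h1.1).pos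
            h1.2.le).trans (ENNReal.ofReal_le_ofReal (le_of_eq ?_))
          rw [hK]
          ring
      _ ≤ ∑ q ∈ S, ENNReal.ofReal (10 * √(q : ℝ) + K) :=
          sum_le_sum_of_subset_of_nonneg hSsub fun _ _ _ => zero_le
      _ = ENNReal.ofReal (∑ q ∈ S, (10 * √(q : ℝ) + K)) :=
          (ENNReal.ofReal_sum_of_nonneg fun _ _ => by positivity).symm
      _ ≤ _ := by
          refine ENNReal.ofReal_le_ofReal ?_
          rw [sum_add_distrib, ← mul_sum, sum_const, nsmul_eq_mul]
          gcongr
  have hpick : pickBound p = ENNReal.ofReal (2 * (4 * p.size + 2) * (ω + 1)) := by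
    unfold pickBound
    rw [ENNReal.ofReal_mul (by positivity), ENNReal.ofReal_mul (by positivity),
      ENNReal.ofReal_add (by positivity) (by positivity),
      ENNReal.ofReal_add (by positivity) (by positivity), ENNReal.ofReal_mul (by positivity)]
    simp [hωd]
  unfold totalBound
  refine (add_le_add (add_le_add (Nat.cast_le.2 factorization_le_size) le_rfl)
    (add_le_add hitem le_rfl)).trans ?_
  rw [hpick, ← ENNReal.ofReal_natCast, show (2 : ℝ≥0∞) = ENNReal.ofReal 2 by simp,
    ← ENNReal.ofReal_one, ← ENNReal.ofReal_add (by positivity) (by positivity),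
    ← ENNReal.ofReal_add (by positivity) (by positivity),
    ← ENNReal.ofReal_add (by positivity) (by positivity),
    ← ENNReal.ofReal_add (by positivity) (by positivity)]
  refine ENNReal.ofReal_le_ofReal ?_
  have hs : (1 : ℝ) ≤ p.size := by
    have : 0 < p.size := Nat.size_pos.2 (by omega)
    exact_mod_cast this
  have h1 : (1 : ℝ) ≤ p.size * ω := one_le_mul_of_one_le_of_one_le hs hω'
  have h2 : (p.size : ℝ) ≤ p.size * ω := le_mul_of_one_le_right (by positivity) hω'
  have h3 : (ω : ℝ) ≤ p.size * ω := le_mul_of_one_le_left (by positivity) hs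
  have h4 : (ω : ℝ) ^ 2 ≤ ω ^ 3 := pow_le_pow_right₀ hω' (by norm_num)
  have h5 : 0 ≤ 10 * growthBound * b ^ (2 / 5 : ℝ) := by positivity
  have h6 := mul_le_mul_of_nonneg_left h4 h5
  rw [hK]
  linarith

lemma size_le_three_mul_log {n : ℕ} (hn : 2 ≤ n) : (n.size : ℝ) ≤ 3 * Real.log n := by
  have hn' : (2 : ℝ) ≤ n := by exact_mod_cast hn
  have h0 : 0 < n.size := Nat.size_pos.2 (by omega)
  have h1 : 2 ^ (n.size - 1) ≤ n := Nat.lt_size.1 (by omega)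
  have h2 : (2 : ℝ) ^ (n.size - 1) ≤ n := by exact_mod_cast h1
  have h3 := Real.log_le_log (by positivity) h2
  rw [Real.log_pow, Nat.cast_sub h0, Nat.cast_one] at h3
  have h4 := Real.log_le_log (by norm_num) hn'
  have h5 := Real.log_two_gt_d9
  nlinarith

lemma hitCost_le {x : ℕ} (hp : 5 ≤ p) (hpx : p ≤ x) :
    (hitCost p : ℝ) ≤ 34 * Real.log (Real.log x) := by
  have hx' : (5 : ℝ) ≤ x := by exact_mod_cast hp.trans hpx
  have hp' : (5 : ℝ) ≤ p := by exact_mod_cast hp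
  have hLL := two_fifths_le_log_log hx'
  have hX := one_le_log hx'
  have h1 : 2 ≤ p.size := by
    have : 2 < p.size := Nat.lt_size.2 (by omega)
    omega
  have h2 : (p.size : ℝ) ≤ 3 * Real.log x :=
    (size_le_three_mul_log (by omega)).trans (by gcongr)
  have h3 := size_le_three_mul_log h1
  have h4 : Real.log p.size ≤ Real.log 3 + Real.log (Real.log x) := by
    rw [← Real.log_mul (by norm_num) (by linarith)]
    exact Real.log_le_log (by positivity) h2
  have h5 : Real.log 3 ≤ 1.2 := by
    rw [Real.log_le_iff_le_exp (by norm_num)]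
    have h6 : (3 : ℝ) ^ 5 ≤ Real.exp 1.2 ^ 5 := by
      rw [← Real.exp_nat_mul, show ((5 : ℕ) : ℝ) * 1.2 = ((6 : ℕ) : ℝ) * 1 by norm_num,
        Real.exp_nat_mul]
      have := Real.exp_one_gt_d9
      calc (3 : ℝ) ^ 5 ≤ 2.7 ^ 6 := by norm_num
        _ ≤ _ := by gcongr; linarith
    exact le_of_pow_le_pow_left₀ (by norm_num) (Real.exp_pos _).le h6
  unfold hitCost
  push_cast
  linarith

/-- The expected running time for a prime `p ≤ x`. -/
lemma expectedTime_le_ofReal {x : ℕ} (hpp : p.Prime) (hp : 5 ≤ p) (hpx : p ≤ x) (hB : B ≤ b)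
    (hb : 0 ≤ b) :
    expectedTime p B ≤ ENNReal.ofReal
      (90 * Real.log x * (Real.log p * ∑ q ∈ smallFactors b (p - 1), √(q : ℝ)) +
      (90 * growthBound * b ^ (2 / 5 : ℝ) * Real.log x ^ 2 +
        9 * 42 * (1 + growthBound) * Real.log x ^ 2 * Real.log (Real.log x)) *
        ((p - 1).primeFactors.card : ℝ) ^ 3 +
      837 * Real.log x ^ 3 * ((p - 1).primeFactors.card : ℝ) ^ 1) := by
  have : Fact p.Prime := ⟨hpp⟩
  have hp' : (5 : ℝ) ≤ p := by exact_mod_cast hp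
  have hpx' : (p : ℝ) ≤ x := by exact_mod_cast hpx
  have hx' : (5 : ℝ) ≤ x := hp'.trans hpx'
  have hLL := two_fifths_le_log_log hx'
  have hX := one_le_log hx'
  have hlp := one_le_log hp'
  have hlpx : Real.log p ≤ Real.log x := Real.log_le_log (by linarith) hpx'
  have hG := growthBound_pos
  have hs := size_le_three_mul_log (n := p) (by omega)
  have hhit := hitCost_le hp hpx
  refine (expectedTime_le_totalBound (by omega)).trans
    ((mul_le_mul_left (totalBound_le (by omega) hB hb) _).trans ?_)
  rw [← ENNReal.ofReal_natCast, ← ENNReal.ofReal_pow (by positivity),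
    ← ENNReal.ofReal_mul (by positivity)]
  refine ENNReal.ofReal_le_ofReal ?_
  set X := Real.log x
  set LL := Real.log X
  set ω := ((p - 1).primeFactors.card : ℝ)
  set R := ∑ q ∈ smallFactors b (p - 1), √(q : ℝ)
  have hsq : 0 ≤ R := sum_nonneg fun _ _ => Real.sqrt_nonneg _
  have hω : 0 ≤ ω := Nat.cast_nonneg _
  have hs0 : (0 : ℝ) ≤ p.size := Nat.cast_nonneg _
  have hs1 : (p.size : ℝ) ≤ 3 * X := by linarith
  have hs2 : (p.size : ℝ) ^ 2 ≤ 9 * X ^ 2 := by nlinarith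
  -- One factor log p is kept, since the sums over primes p ≡ 1 modulo q are weighted with it.
  have hs3 : (p.size : ℝ) ^ 2 ≤ 9 * (X * Real.log p) := by nlinarith
  have hs4 : (p.size : ℝ) ^ 3 ≤ 27 * X ^ 3 := by
    have := pow_le_pow_left₀ hs0 hs1 3
    linarith
  have h3 : (3 : ℝ) + hitCost p ≤ 42 * LL := by linarith
  calc _ = 10 * ((p.size : ℝ) ^ 2 * R) + 10 * growthBound * b ^ (2 / 5 : ℝ) *
        ((p.size : ℝ) ^ 2 * ω ^ 3) + 31 * ((p.size : ℝ) ^ 3 * ω) +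
        (1 + growthBound) * ((3 + hitCost p) * (p.size : ℝ) ^ 2) * ω ^ 3 := by ring
    _ ≤ 10 * (9 * (X * Real.log p) * R) + 10 * growthBound * b ^ (2 / 5 : ℝ) *
        (9 * X ^ 2 * ω ^ 3) + 31 * (27 * X ^ 3 * ω) +
        (1 + growthBound) * (42 * LL * (9 * X ^ 2)) * ω ^ 3 := by
        gcongr
    _ = _ := by ring

lemma log_pow_three_le {X : ℝ} (hX : 1 ≤ X) : Real.log X ^ 3 ≤ 27000 * X ^ (1 / 10 : ℝ) := by
  have h0 : 0 ≤ Real.log X := Real.log_nonneg hX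
  have h1 : Real.log X ≤ 30 * X ^ (1 / 30 : ℝ) := by
    have := Real.log_le_rpow_div (by linarith : 0 ≤ X) (show (0 : ℝ) < 1 / 30 by norm_num)
    linarith
  calc Real.log X ^ 3 ≤ (30 * X ^ (1 / 30 : ℝ)) ^ 3 := by gcongr
    _ = 27000 * (X ^ (1 / 30 : ℝ)) ^ 3 := by ring
    _ = _ := by
      rw [← Real.rpow_natCast, ← Real.rpow_mul (by linarith)]
      norm_num

/-- The constant in the bound for the average running time. -/
noncomputable def timeBound : ℝ :=
  10 ^ 33 * (5040 * √2 + 90 * growthBound * √2 * (momentBound 3 * 27000) +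
    9 * 42 * (1 + growthBound) * (momentBound 3 * 27000) + 837 * momentBound 1)

lemma timeBound_pos : 0 < timeBound := by
  have h1 := growthBound_pos
  have h2 := momentBound_pos 3
  have h3 := momentBound_pos 1
  unfold timeBound
  positivity

/-- The average running time. -/
theorem sum_expectedTime_le {ε : ℝ} (hε : 0 < ε) (hε1 : ε < 1) {B : ℕ → ℝ}
    (hB : ∀ p : ℕ, p.Prime → 5 ≤ p → IsFactorBound p ε (B p)) (x : ℕ) :
    ∑ p ∈ (Icc 5 x).filter Nat.Prime, expectedTime p (B p) ≤
      ENNReal.ofReal (timeBound * ∑ p ∈ (Icc 5 x).filter Nat.Prime, timeOrder ε p) := by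
  rcases lt_or_ge x 5 with hx | hx
  · rw [Icc_eq_empty (by omega)]
    simp
  have hx' : (5 : ℝ) ≤ x := by exact_mod_cast hx
  have hLL := two_fifths_le_log_log hx'
  have hX := one_le_log hx'
  have hG := growthBound_pos
  have hM3 := momentBound_pos 3
  have hM1 := momentBound_pos 1
  have hlow := le_sum_timeOrder (ε := ε) hx
  have hω1 := sum_card_primeFactors_pow_le hx 1
  have hω3 := sum_card_primeFactors_pow_le hx 3
  set P := (Icc 5 x).filter Nat.Prime with hP
  set X := Real.log x with hXd
  set LL := Real.log X with hLLd
  -- A common bound for all B p with p ≤ x; the factor 2 makes it dominate the 3 in the maximum, as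
  -- X ≥ 3/2.
  set b := 2 * (X / ε) with hb
  have hXε : X ≤ X / ε := by
    rw [le_div_iff₀ hε]
    nlinarith
  have hb0 : 0 ≤ b := by positivity
  have hXb : X ≤ b := by linarith
  have hBb : ∀ p ∈ P, B p ≤ b := by
    intro p hp
    rw [hP, mem_filter, mem_Icc] at hp
    have hp5 : (5 : ℝ) ≤ p := by exact_mod_cast hp.1.1
    have hpx : (p : ℝ) ≤ x := by exact_mod_cast hp.1.2
    refine (IsFactorBound.le_max hp.1.1 hε (hB p hp.2 hp.1.1)).trans (max_le ?_ ?_)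
    · have h16 : (3 / 2 : ℝ) ≤ X := by
        rw [hXd, Real.le_log_iff_exp_le (by linarith)]
        have h3 : Real.exp (3 / 2) ^ 2 ≤ 5 ^ 2 := by
          rw [← Real.exp_nat_mul, show ((2 : ℕ) : ℝ) * (3 / 2) = ((3 : ℕ) : ℝ) * 1 by norm_num,
            Real.exp_nat_mul]
          have := Real.exp_one_lt_d9
          calc Real.exp 1 ^ 3 ≤ 2.72 ^ 3 := by gcongr; linarith
            _ ≤ _ := by norm_num
        exact (le_of_pow_le_pow_left₀ (by norm_num) (by norm_num) h3).trans hx'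
      linarith
    · have h1 : Real.log (((p : ℝ) - 1) / 2) ≤ X :=
        Real.log_le_log (by linarith) (by linarith)
      have h2 : Real.log (((p : ℝ) - 1) / 2) / ε ≤ X / ε := by gcongr
      linarith [hX.trans hXε]
  have hsqrtb : √b = √2 * √X * √(1 / ε) := by
    rw [hb, Real.sqrt_mul (by norm_num), div_eq_mul_one_div, Real.sqrt_mul (by linarith)]
    ring
  set A := 90 * growthBound * b ^ (2 / 5 : ℝ) * X ^ 2 + 9 * 42 * (1 + growthBound) * X ^ 2 * LL
    with hA
  have hA0 : 0 ≤ A := by positivity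
  have hsq := sum_log_mul_sum_sqrt_le x hb0
  have hterm : ∀ p ∈ P, 0 ≤ 90 * X * (Real.log p * ∑ q ∈ smallFactors b (p - 1), √(q : ℝ)) +
      A * ((p - 1).primeFactors.card : ℝ) ^ 3 +
        837 * X ^ 3 * ((p - 1).primeFactors.card : ℝ) ^ 1 := by
    intro p _
    have h1 : 0 ≤ Real.log p * ∑ q ∈ smallFactors b (p - 1), √(q : ℝ) :=
      mul_nonneg (Real.log_natCast_nonneg p) (sum_nonneg fun _ _ => Real.sqrt_nonneg _)
    positivity
  have hup : ∑ p ∈ P, expectedTime p (B p) ≤ ENNReal.ofReal (90 * X * (56 * x * √b) +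
      A * (momentBound 3 * LL ^ 3 * x / X) + 837 * X ^ 3 * (momentBound 1 * LL ^ 1 * x / X)) := by
    calc _ ≤ ∑ p ∈ P, ENNReal.ofReal
          (90 * X * (Real.log p * ∑ q ∈ smallFactors b (p - 1), √(q : ℝ)) +
            A * ((p - 1).primeFactors.card : ℝ) ^ 3 +
              837 * X ^ 3 * ((p - 1).primeFactors.card : ℝ) ^ 1) := by
          refine sum_le_sum fun p hp => ?_
          have hp' := hp
          rw [hP, mem_filter, mem_Icc] at hp'
          exact expectedTime_le_ofReal hp'.2 hp'.1.1 hp'.1.2 (hBb p hp) hb0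
      _ = ENNReal.ofReal (90 * X *
            ∑ p ∈ P, Real.log p * ∑ q ∈ smallFactors b (p - 1), √(q : ℝ) +
            A * ∑ p ∈ P, ((p - 1).primeFactors.card : ℝ) ^ 3 +
              837 * X ^ 3 * ∑ p ∈ P, ((p - 1).primeFactors.card : ℝ) ^ 1) := by
          rw [← ENNReal.ofReal_sum_of_nonneg hterm, sum_add_distrib, sum_add_distrib, mul_sum,
            mul_sum, mul_sum]
      _ ≤ _ := by
          refine ENNReal.ofReal_le_ofReal ?_
          gcongr
  refine hup.trans (ENNReal.ofReal_le_ofReal ?_)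
  -- The third moment of ω brings LL³. Next to b^(2/5) it is absorbed by b^(1/10), giving √b; in the
  -- term without b it is absorbed by one factor X.
  have hLL3 : LL ^ 3 ≤ 27000 * X ^ (1 / 10 : ℝ) := log_pow_three_le hX
  have hLL3b : LL ^ 3 ≤ 27000 * b ^ (1 / 10 : ℝ) := hLL3.trans (by gcongr)
  have hLL3X : LL ^ 3 ≤ 27000 * X := by
    refine hLL3.trans ?_
    have : X ^ (1 / 10 : ℝ) ≤ X ^ (1 : ℝ) := Real.rpow_le_rpow_of_exponent_le hX (by norm_num)
    rw [Real.rpow_one] at this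
    linarith
  have hbpow : b ^ (2 / 5 : ℝ) * b ^ (1 / 10 : ℝ) = √b := by
    rw [Real.sqrt_eq_rpow, ← Real.rpow_add (by linarith)]
    norm_num
  have hx0 : (0 : ℝ) ≤ x := by linarith
  have hbLL : b ^ (2 / 5 : ℝ) * LL ^ 3 ≤ 27000 * √b := by
    rw [← hbpow]
    calc _ ≤ b ^ (2 / 5 : ℝ) * (27000 * b ^ (1 / 10 : ℝ)) := by gcongr
      _ = _ := by ring
  have hX0 : X ≠ 0 := by linarith
  calc _ = 5040 * x * X * √b + 90 * growthBound * momentBound 3 * x * X *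
        (b ^ (2 / 5 : ℝ) * LL ^ 3) + 9 * 42 * (1 + growthBound) * momentBound 3 * x * X * LL *
          LL ^ 3 + 837 * momentBound 1 * x * X ^ 2 * LL := by
        rw [hA]
        field_simp
        ring
    _ ≤ 5040 * x * X * √b + 90 * growthBound * momentBound 3 * x * X *
        (27000 * √b) + 9 * 42 * (1 + growthBound) * momentBound 3 * x * X * LL *
          (27000 * X) + 837 * momentBound 1 * x * X ^ 2 * LL := by
        gcongr
    _ = (5040 * √2 + 90 * growthBound * √2 * (momentBound 3 * 27000)) *
          (x * (X * √X * √(1 / ε))) + (9 * 42 * (1 + growthBound) * (momentBound 3 * 27000) +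
            837 * momentBound 1) * (x * (X ^ 2 * LL)) := by
        rw [hsqrtb]
        ring
    _ ≤ timeBound * (1 / 10 ^ 33 * (x * (X * √X * √(1 / ε) + X ^ 2 * LL))) := by
        set c₁ := 5040 * √2 + 90 * growthBound * √2 * (momentBound 3 * 27000) with hc₁
        set c₂ := 9 * 42 * (1 + growthBound) * (momentBound 3 * 27000) + 837 * momentBound 1
          with hc₂
        have hc₁0 : 0 ≤ c₁ := by positivity
        have hc₂0 : 0 ≤ c₂ := by positivity
        have ht : timeBound = 10 ^ 33 * (c₁ + c₂) := by
          rw [hc₁, hc₂, timeBound]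
          ring
        rw [ht]
        set u := x * (X * √X * √(1 / ε)) with hu
        set v := x * (X ^ 2 * LL) with hv
        have hu0 : 0 ≤ u := by positivity
        have hv0 : 0 ≤ v := by positivity
        have h1 := mul_nonneg hc₂0 hu0
        have h2 := mul_nonneg hc₁0 hv0
        calc c₁ * u + c₂ * v ≤ (c₁ + c₂) * (u + v) := by linarith
          _ = _ := by
            rw [hu, hv]
            ring
    _ ≤ _ := mul_le_mul_of_nonneg_left hlow timeBound_pos.le

end averageTime

end ProbRoot


theorem mainTheorem2 :
    (∀ (p : ℕ) (ε : ℝ), p.Prime → 5 ≤ p → 0 < ε → ε < 1 →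
      (∃! B : ℝ, ProbRoot.IsFactorBound p ε B) ∧
      ∀ B : ℝ, ProbRoot.IsFactorBound p ε B →
        ((11 ≤ p ∨ 3 * ε ≤ Real.log (((p : ℝ) - 1) / 2)) →
          B ≤ Real.log (((p : ℝ) - 1) / 2) / ε) ∧
        B ≤ max 3 (Real.log (((p : ℝ) - 1) / 2) / ε) ∧
        (ProbRoot.cofactor p B ≠ 1 →
          ((ProbRoot.cofactor p B).primeFactors.card : ℝ)
              ≤ Real.logb B (ProbRoot.cofactor p B) ∧
          ProbRoot.reportedProb B (ProbRoot.cofactor p B)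
              ≤ ((ProbRoot.cofactor p B).totient : ℝ) / ((ProbRoot.cofactor p B : ℝ) - 1) ∧
          1 - ε < ((ProbRoot.cofactor p B).totient : ℝ) / ((ProbRoot.cofactor p B : ℝ) - 1)) ∧
        (∀ ps : List ℕ, ps.Nodup → ps.toFinset = ProbRoot.smallPrimes p B →
          ProbRoot.Correct p ε B (ProbRoot.State.pick ps 1 (ProbRoot.cofactor p B))) ∧
        ProbRoot.Correct p ε B ProbRoot.State.init) ∧
    ∃ C : ℝ, 0 < C ∧ ∀ ε : ℝ, 0 < ε → ε < 1 → ∀ B : ℕ → ℝ,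
      (∀ p : ℕ, p.Prime → 5 ≤ p → ProbRoot.IsFactorBound p ε (B p)) →
      ∀ x : ℕ,
        ∑ p ∈ (Finset.Icc 5 x).filter Nat.Prime, ProbRoot.expectedTime p (B p) ≤
          ENNReal.ofReal (C * ∑ p ∈ (Finset.Icc 5 x).filter Nat.Prime,
            (Real.sqrt (1 / ε) * Real.log p ^ (5 / 2 : ℝ)
              + Real.log p ^ 3 * Real.log (Real.log p))) := by
  refine ⟨fun p ε hpp hp hε hε1 => ⟨ProbRoot.existsUnique_isFactorBound hp hε hε1, fun B hB =>
    ⟨fun hc => hB.le_log_div hp hpp hε hε1 hc, hB.le_max hp hε, fun hQ => ?_,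
      fun ps hnd hps => ProbRoot.correct_pick hp hpp hε hB hnd hps,
      ProbRoot.correct_init hp hpp hε hB⟩⟩,
    ProbRoot.timeBound, ProbRoot.timeBound_pos, fun ε hε hε1 B hB x =>
      ProbRoot.sum_expectedTime_le hε hε1 hB x⟩
  have h1 := ProbRoot.reportedProb_le_totient_div (show 2 ≤ p by omega) hB.1 hQ
  exact ⟨ProbRoot.card_primeFactors_cofactor_le (by omega) hB.1, h1,
    (ProbRoot.one_sub_lt_reportedProb hp hpp hε hB).trans_le h1⟩
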